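/- **Proposition 3 (concentration of excursion-counts).** Identify the unit torus $\mathbb{T}_2$ with $[0,1)^2\subset\mathbb{R}^2$, with the metric $d(x,y)=\min\{\|x-y+(e_1,e_2)\| : e_1,e_2\in\{-1,0,1\}\}$, and write $B_r(x)=\{z: d(x,z)<r\}$ and $\partial B_r(x)=\{z: d(x,z)=r\}$. Let $W_t=(y+\hat W_t) \bmod 1$ be Brownian motion on $\mathbb{T}_2$ started at $y\in\mathbb{T}_2$, where $\hat W$ is standard Brownian motion on $\mathbb{R}^2$. For $x\in\mathbb{T}_2$ and $0<r_1<r_0<\tfrac12$ put $D_0(x)=0$, and for $n\ge 1$ let $D_n(x)$ be the time at which $W$ completes its $n$-th excursion from $\partial B_{r_1}(x)$ to $B_{r_0}(x)^c$: after time $D_{n-1}(x)$, wait until $W$ hits $\partial B_{r_1}(x)$ and then until it hits $B_{r_0}(x)^c$. Let $\delta,R\in(0,\tfrac12)$ and $r_0=R$. 1. There is a function $o(r_1)$, depending only on $\delta$ and $R$, with $o(r_1)\to0$ as $r_1\downarrow0$, such that for all $r_1\in(0,R)$, all $x,y\in\mathbb{T}_2$ and all $n\in\mathbb{N}$, $$\mathbb{P}\Big(D_n(x)\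 \ge\ (1+\delta)\,n\,\tfrac1\pi\ln\tfrac{r_0}{r_1}\Big)\ \le\ \exp\Big(-n\big(\tfrac{\delta^2}{8}+o(r_1)\big)\Big).$$ 2. For every $\eta>0$ there is a function $o(r_1)$, depending only on $\delta$, $R$ and $\eta$, with $o(r_1)\to0$ as $r_1\downarrow0$, such that for all $r_1\in(0,R)$, all $x,y\in\mathbb{T}_2$ and all $n\in\mathbb{N}$ such that $n\neq1$ or $d(x,y)\ge\eta$, $$\mathbb{P}\Big(D_n(x)\ \le\ (1-\delta)\,n\,\tfrac1\pi\ln\tfrac{r_0}{r_1}\Big)\ \le\ \exp\Big(-n\big(\tfrac{\delta^2}{4}+o(r_1)\big)\Big).$$ In particular, for a fixed starting point $y$ and fixed $x$, both bounds hold for all $n$ as $r_1\to0$, except for the second one when $n=1$ and $x=y$. -/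

import Mathlib

open MeasureTheory ProbabilityTheory Set Filter Topology
open scoped NNReal ENNReal

universe u

noncomputable section

/-- The Euclidean plane. -/
abbrev Plane : Type := EuclideanSpace ℝ (Fin 2)

/-- The unit torus, as the set of points of the plane with both coordinates in `[0, 1)`. -/
def UnitTorus : Type := {p : Plane // ∀ i, p i ∈ Set.Ico (0 : ℝ) 1}

/-- The point of the torus obtained by reducing both coordinates modulo one. -/
def modOne (p : Plane) : UnitTorus :=
  ⟨WithLp.toLp 2 fun i => Int.fract (p i),
    fun i => ⟨Int.fract_nonneg (p i), Int.fract_lt_one (p i)⟩⟩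

/-- The torus metric: the minimum of the nine Euclidean norms `‖x - y + (e₁, e₂)‖`
with `e₁, e₂ ∈ {-1, 0, 1}`. The three elements of `SignType` are `-1`, `0`, `1`. -/
def torusDist (x y : UnitTorus) : ℝ :=
  ⨅ e : Fin 2 → SignType, ‖x.1 - y.1 + WithLp.toLp 2 (fun i => ((e i : SignType) : ℝ))‖

/-- The open ball of the torus. -/
def torusBall (x : UnitTorus) (r : ℝ) : Set UnitTorus := {z | torusDist x z < r}

/-- The circle of the torus, which bounds the ball when `0 < r < 1/2`. -/
def torusCircle (x : UnitTorus) (r : ℝ) : Set UnitTorus := {z | torusDist x z = r}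

/-- Standard Brownian motion in the plane (started at the origin): the two coordinates are
independent real Brownian motions. -/
structure IsPlanarBrownian {Ω : Type*} [MeasurableSpace Ω] (B : ℝ≥0 → Ω → Plane)
    (P : Measure Ω) : Prop where
  coord : ∀ i : Fin 2, IsBrownianReal (fun t ω => B t ω i) P
  indep : IndepFun (fun ω (t : ℝ≥0) => B t ω 0) (fun ω (t : ℝ≥0) => B t ω 1) P

/-- The path on the torus started at `y` and driven by the planar path `b`. -/
def torusPath (y : UnitTorus) (b : ℝ≥0 → Plane) (t : ℝ≥0) : UnitTorus := modOne (y.1 + b t)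

/-- The first time not before `s` at which the path `w` is in `A` (`∞` if there is none). -/
def hitAfter (w : ℝ≥0 → UnitTorus) (A : Set UnitTorus) (s : ℝ≥0∞) : ℝ≥0∞ :=
  ⨅ (u : ℝ≥0) (_ : s ≤ (u : ℝ≥0∞) ∧ w u ∈ A), (u : ℝ≥0∞)

/-- The time at which the path `w` completes its `n`-th excursion from the circle of radius `r₁`
around `x` to the complement of the ball of radius `r₀` around `x`: after the completion of the
previous excursion, wait until the circle is hit, and then until the ball is left. -/
def excursionTime (w : ℝ≥0 → UnitTorus) (x : UnitTorus) (r₀ r₁ : ℝ) : ℕ → ℝ≥0∞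
  | 0 => 0
  | n + 1 => hitAfter w (torusBall x r₀)ᶜ
      (hitAfter w (torusCircle x r₁) (excursionTime w x r₀ r₁ n))

end

/-! An excursion is a wait until the circle of radius `r` is hit, followed by a crossing out to
radius `R`. The crossing has bounded mean duration. The wait from a far point is nearly exponential
with mean L = (1/π) log(1/r), because the Green function of the torus is (1/π) log(1/distance) up to
a bounded error. So D_n behaves like a sum of n independent exponential variables of mean L, and
both tails are Chernoff bounds, with rates δ - log(1+δ) > δ²/8 and -δ - log(1-δ) > δ²/4. The slack
in these rates absorbs all errors that vanish with `r`.

Hitting laws are never computed. The path is lifted to the plane and tested against V_ε = ∫_ε^∞ (p_t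
- 1) dt, which satisfies ½ΔV_ε = 1 - p_ε (`genPair_torusGreen`) and has the logarithmic size of
`exists_torusGreen_bounds`. Dynkin's formula `IsPlaneMarkov.hasDrift` and optional stopping
`HasDrift.integral_le_of_drift_nonpos` compare expectations at consecutive stopping times. A weight
depending on the earlier time is carried along, so the estimates iterate over excursions and the
Markov property is needed at fixed times only.

Upper tail (`eventually_real_le_excTime_le`): with l = δ/((1+δ)L), a constant minus V is a
supersolution outside the circle. Each wait multiplies E exp(l D) by about 1+δ, each crossing by
about 1.

Lower tail (`eventually_real_excTime_le_le`): with l = δ/((1-δ)L), a constant plus V shows that each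
wait from a far point multiplies E exp(-l D) by about 1-δ. From an arbitrary starting point the
first wait may be short and its factor is lost, which is harmless once nδ ≥ 4.

The finitely many n with n ≥ 2 and nδ < 4 need more than Chernoff
(`eventually_real_excTime_succ_le`): the n-1 remaining waits are compared with a Poisson process,
and a numerical bound for Poisson distribution functions (`le_poissonCdfLt_of_lt_four`) concludes.
-/

noncomputable section

/-! ### The heat kernel of the circle -/

/-- The heat kernel of the circle of length one, for the generator `½ d²/da²`. -/
def circleHeat (t a : ℝ) : ℝ := HurwitzZeta.cosKernel (a : UnitAddCircle) (2 * Real.pi * t)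

lemma hasSum_circleHeat {t : ℝ} (ht : 0 < t) (a : ℝ) :
    HasSum (fun n : ℤ => Real.cos (2 * Real.pi * n * a) *
      Real.exp (-(2 * Real.pi * n) ^ 2 * t / 2)) (circleHeat t a) := by
  have h := HurwitzZeta.hasSum_int_cosKernel a (t := 2 * Real.pi * t) (by positivity)
  have h2 := Complex.hasSum_re h
  rw [Complex.ofReal_re] at h2
  convert h2 using 2 with n
  · rw [Complex.re_mul_ofReal,
      show (2 * (Real.pi : ℂ) * Complex.I * a * n) =
        ((2 * Real.pi * n * a : ℝ) : ℂ) * Complex.I by push_cast; ring,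
      Complex.exp_ofReal_mul_I_re]
    congr 2
    ring
  · rfl

lemma summable_exp_circleHeat {t : ℝ} (ht : 0 < t) :
    Summable (fun n : ℤ => Real.exp (-(2 * Real.pi * n) ^ 2 * t / 2)) := by
  simpa using (hasSum_circleHeat ht 0).summable

lemma integral_cos_gaussianReal (c a : ℝ) (s : ℝ≥0) :
    ∫ w, Real.cos (c * (a + w)) ∂gaussianReal 0 s = Real.cos (c * a) * Real.exp (-c ^ 2 * s / 2) := by
  have h := charFun_gaussianReal (μ := 0) (v := s) c
  rw [charFun_apply_real] at h
  have hint : Integrable (fun w : ℝ => Complex.exp (((c * (a + w) : ℝ) : ℂ) * Complex.I))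
      (gaussianReal 0 s) := by
    refine Integrable.of_bound (C := 1) (by fun_prop) (ae_of_all _ fun w => ?_)
    rw [Complex.norm_exp_ofReal_mul_I]
  have h2 : ∫ w, Complex.exp (((c * (a + w) : ℝ) : ℂ) * Complex.I) ∂gaussianReal 0 s =
      Complex.exp (((c * a : ℝ) : ℂ) * Complex.I) * ((Real.exp (-c ^ 2 * s / 2) : ℝ) : ℂ) := by
    have e : ∀ w : ℝ, Complex.exp (((c * (a + w) : ℝ) : ℂ) * Complex.I) =
        Complex.exp (((c * a : ℝ) : ℂ) * Complex.I) * Complex.exp (c * w * Complex.I) := by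
      intro w
      rw [← Complex.exp_add]; push_cast; ring_nf
    simp_rw [e]
    rw [integral_const_mul, h]
    push_cast
    congr 2
    ring
  have h3 := congrArg Complex.re h2
  rw [Complex.re_mul_ofReal, Complex.exp_ofReal_mul_I_re] at h3
  rw [← h3]
  have := integral_re hint
  simp only [RCLike.re_to_complex, Complex.exp_ofReal_mul_I_re] at this
  exact this

/-- Semigroup property: Gaussian averaging multiplies the n-th Fourier mode by exp(-(2πn)² s / 2).
-/
lemma integral_circleHeat {t : ℝ} (ht : 0 < t) (s : ℝ≥0) (a : ℝ) :
    ∫ w, circleHeat t (a + w) ∂gaussianReal 0 s = circleHeat (t + s) a := by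
  have key := hasSum_integral_of_summable_integral_norm (μ := gaussianReal 0 s)
    (F := fun (n : ℤ) (w : ℝ) => Real.cos (2 * Real.pi * n * (a + w)) *
      Real.exp (-(2 * Real.pi * n) ^ 2 * t / 2)) ?_ ?_
  · have e : ∀ w : ℝ, ∑' n : ℤ, Real.cos (2 * Real.pi * n * (a + w)) *
      Real.exp (-(2 * Real.pi * n) ^ 2 * t / 2) = circleHeat t (a + w) := fun w =>
      (hasSum_circleHeat ht (a + w)).tsum_eq
    simp_rw [e, integral_mul_const, integral_cos_gaussianReal] at key
    refine key.unique ?_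
    have e2 : (fun n : ℤ => Real.cos (2 * Real.pi * n * a) *
        Real.exp (-(2 * Real.pi * n) ^ 2 * s / 2) * Real.exp (-(2 * Real.pi * n) ^ 2 * t / 2)) =
        fun n : ℤ => Real.cos (2 * Real.pi * n * a) *
          Real.exp (-(2 * Real.pi * n) ^ 2 * (t + s) / 2) := by
      funext n
      rw [mul_assoc (Real.cos _), ← Real.exp_add]
      congr 2
      ring
    rw [e2]
    exact hasSum_circleHeat (by positivity) a
  · intro n
    refine Integrable.of_bound (C := 1 * Real.exp (-(2 * Real.pi * n) ^ 2 * t / 2)) (by fun_prop)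
      (ae_of_all _ fun w => ?_)
    rw [norm_mul, Real.norm_of_nonneg (Real.exp_nonneg _)]
    gcongr
    exact Real.abs_cos_le_one _
  · refine Summable.of_nonneg_of_le (fun n => by positivity) (fun n => ?_)
      (summable_exp_circleHeat ht)
    calc _ ≤ ∫ w, Real.exp (-(2 * Real.pi * n) ^ 2 * t / 2) ∂gaussianReal 0 s := by
          refine integral_mono_of_nonneg (ae_of_all _ fun w => by positivity) (by simp)
            (ae_of_all _ fun w => ?_)
          simp only
          rw [norm_mul, Real.norm_of_nonneg (Real.exp_nonneg _)]
          exact mul_le_of_le_one_left (Real.exp_nonneg _) (Real.abs_cos_le_one _)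
      _ = _ := by simp

lemma abs_circleHeat_le {t : ℝ} (ht : 0 < t) (a : ℝ) : |circleHeat t a| ≤ circleHeat t 0 := by
  have h0 := hasSum_circleHeat ht 0
  simp only [mul_zero, Real.cos_zero, one_mul] at h0
  refine (hasSum_circleHeat ht a).norm_le_of_bounded h0 fun n => ?_
  rw [norm_mul, Real.norm_of_nonneg (Real.exp_nonneg _)]
  exact mul_le_of_le_one_left (Real.exp_nonneg _) (Real.abs_cos_le_one _)

lemma abs_circleHeat_sub_one_le {t : ℝ} (ht : 0 < t) (a : ℝ) :
    |circleHeat t a - 1| ≤ circleHeat t 0 - 1 := by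
  have h (b : ℝ) : HasSum (fun n : ℤ => if n = 0 then 0 else Real.cos (2 * Real.pi * n * b) *
      Real.exp (-(2 * Real.pi * n) ^ 2 * t / 2)) (circleHeat t b - 1) := by
    simpa using hasSum_ite_sub_hasSum (hasSum_circleHeat ht b) 0
  refine (h a).norm_le_of_bounded (h 0) fun n => ?_
  split_ifs
  · simp
  · rw [norm_mul, Real.norm_of_nonneg (Real.exp_nonneg _)]
    simp only [mul_zero, Real.cos_zero, one_mul]
    exact mul_le_of_le_one_left (Real.exp_nonneg _) (Real.abs_cos_le_one _)

lemma continuousAt_circleHeat {t : ℝ} (ht : 0 < t) (a : ℝ) :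
    ContinuousAt (fun x : ℝ × ℝ => circleHeat x.1 x.2) (t, a) := by
  have hg : ContinuousAt (fun x : ℝ × ℝ => ((x.2 : ℂ), Complex.I * ((2 * Real.pi * x.1 : ℝ) : ℂ)))
      (t, a) := by
    refine Continuous.continuousAt ?_
    exact (Complex.continuous_ofReal.comp continuous_snd).prodMk
      (continuous_const.mul (Complex.continuous_ofReal.comp (by fun_prop)))
  have h : ContinuousAt (fun x : ℝ × ℝ => jacobiTheta₂ (x.2 : ℂ)
      (Complex.I * ((2 * Real.pi * x.1 : ℝ) : ℂ))) (t, a) :=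
    ContinuousAt.comp (x := (t, a)) (g := fun p : ℂ × ℂ => jacobiTheta₂ p.1 p.2)
      (continuousAt_jacobiTheta₂ (a : ℂ) (τ := Complex.I * ((2 * Real.pi * t : ℝ) : ℂ))
      (by simp; positivity)) hg
  have h2 := Complex.continuous_re.continuousAt.comp h
  refine h2.congr (Eventually.of_forall fun x => ?_)
  simp only [Function.comp]
  rw [← HurwitzZeta.cosKernel_def, Complex.ofReal_re, circleHeat]

/-- The theta function, in its form as a periodised Gaussian. -/
lemma circleHeat_eq {t : ℝ} (ht : 0 < t) (a : ℝ) :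
    circleHeat t a = (Real.sqrt (2 * Real.pi * t))⁻¹ *
      HurwitzZeta.evenKernel (a : UnitAddCircle) (1 / (2 * Real.pi * t)) := by
  have h := HurwitzZeta.evenKernel_functional_equation (a : UnitAddCircle) (1 / (2 * Real.pi * t))
  rw [one_div_one_div] at h
  rw [h, circleHeat, ← Real.sqrt_eq_rpow, Real.sqrt_div zero_le_one, Real.sqrt_one]
  have : 0 < Real.sqrt (2 * Real.pi * t) := by positivity
  field_simp

/-- Of the periodised Gaussian, only the term of the nearest lattice point is kept. -/
lemma circleHeat_ge {t : ℝ} (ht : 0 < t) (a : ℝ) :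
    (Real.sqrt (2 * Real.pi * t))⁻¹ * Real.exp (-‖(a : UnitAddCircle)‖ ^ 2 / (2 * t)) ≤
      circleHeat t a := by
  rw [circleHeat_eq ht]
  gcongr
  have h := HurwitzZeta.hasSum_int_evenKernel a (t := 1 / (2 * Real.pi * t)) (by positivity)
  have h1 := le_hasSum h (-round a) fun _ _ => (Real.exp_nonneg _)
  refine le_trans (le_of_eq ?_) h1
  rw [UnitAddCircle.norm_eq, sq_abs]
  congr 1
  push_cast
  field_simp
  ring

/-- After `a` is reduced to |b| ≤ 1/2, the other images satisfy |n + b| ≥ |n|/2. The inequality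
e^(-y) ≤ 2/y² with y = n²/(8t) then bounds each of them by 128 t²/n⁴. An error of order t² survives
the prefactor 1/(2πt) of the planar kernel. -/
lemma exists_circleHeat_le : ∃ K : ℝ, 0 ≤ K ∧ ∀ t : ℝ, 0 < t → ∀ a : ℝ,
    circleHeat t a ≤ (Real.sqrt (2 * Real.pi * t))⁻¹ *
      (Real.exp (-‖(a : UnitAddCircle)‖ ^ 2 / (2 * t)) + K * t ^ 2) := by
  have hs : Summable (fun n : ℤ => 128 * (1 / (n : ℝ) ^ 4)) :=
    (Real.summable_one_div_int_pow.mpr (by norm_num)).mul_left _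
  refine ⟨∑' n : ℤ, 128 * (1 / (n : ℝ) ^ 4), tsum_nonneg fun n => by positivity, fun t ht a => ?_⟩
  set K := ∑' n : ℤ, 128 * (1 / (n : ℝ) ^ 4) with hK
  rw [circleHeat_eq ht]
  gcongr
  set b : ℝ := a - round a with hb
  have hab : (a : UnitAddCircle) = (b : UnitAddCircle) := by
    rw [hb, AddCircle.coe_sub, eq_comm, sub_eq_self, AddCircle.coe_eq_zero_iff]
    exact ⟨round a, by simp⟩
  have hb2 : |b| ≤ 1 / 2 := abs_sub_round a
  have h := HurwitzZeta.hasSum_int_evenKernel b (t := 1 / (2 * Real.pi * t)) (by positivity)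
  rw [hab]
  have hN : ‖(b : UnitAddCircle)‖ ^ 2 = b ^ 2 := by
    rw [← hab, UnitAddCircle.norm_eq, sq_abs]
  rw [hN]
  have hsum : HasSum (fun n : ℤ => (if n = 0 then Real.exp (-b ^ 2 / (2 * t)) else 0) +
      128 * (1 / (n : ℝ) ^ 4) * t ^ 2) (Real.exp (-b ^ 2 / (2 * t)) + K * t ^ 2) :=
    (hasSum_ite_eq 0 _).add (hs.hasSum.mul_right _)
  refine hasSum_le (fun n => ?_) h hsum
  have e : -Real.pi * ((n : ℝ) + b) ^ 2 * (1 / (2 * Real.pi * t)) = -((n + b) ^ 2 / (2 * t)) := by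
    field_simp
  rw [e]
  split_ifs with hn
  · subst hn
    simp [neg_div]
  · have hn1 : (1 : ℝ) ≤ |(n : ℝ)| := by exact_mod_cast Int.one_le_abs hn
    have hnb : |(n : ℝ)| / 2 ≤ |n + b| := by
      have := abs_sub_abs_le_abs_sub (n : ℝ) (-b)
      rw [abs_neg, sub_neg_eq_add] at this
      linarith
    have hsq : (n : ℝ) ^ 2 / 4 ≤ (n + b) ^ 2 := by
      have := mul_self_le_mul_self (by positivity) hnb
      rw [abs_mul_abs_self] at this
      nlinarith [sq_abs (n : ℝ)]
    have hn2 : (0 : ℝ) < (n : ℝ) ^ 2 := by positivity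
    set y : ℝ := (n : ℝ) ^ 2 / (8 * t) with hy
    have hy0 : 0 < y := by positivity
    have h1 : Real.exp (-((n + b) ^ 2 / (2 * t))) ≤ Real.exp (-y) := by
      apply Real.exp_le_exp.mpr
      rw [neg_le_neg_iff, hy, div_le_div_iff₀ (by positivity) (by positivity)]
      nlinarith
    have h2 : Real.exp (-y) ≤ 2 / y ^ 2 := by
      rw [Real.exp_neg, ← one_div, div_le_div_iff₀ (Real.exp_pos _) (by positivity)]
      nlinarith [Real.quadratic_le_exp_of_nonneg hy0.le]
    refine (h1.trans h2).trans (le_of_eq ?_)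
    rw [hy]
    field_simp
    ring

/-! ### The heat kernel and the regularised Green function of the torus -/

/-- The squared distance to the lattice of integer points. -/
def latticeDistSq (z : ℝ × ℝ) : ℝ := ‖(z.1 : UnitAddCircle)‖ ^ 2 + ‖(z.2 : UnitAddCircle)‖ ^ 2

/-- The law at time `r` of planar Brownian motion. -/
def planeGaussian (r : ℝ≥0) : Measure (ℝ × ℝ) := (gaussianReal 0 r).prod (gaussianReal 0 r)

instance (r : ℝ≥0) : IsProbabilityMeasure (planeGaussian r) := by
  unfold planeGaussian; infer_instance

/-- The heat kernel of the torus, as a periodic function on the plane. -/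
def torusHeat (t : ℝ) (z : ℝ × ℝ) : ℝ := circleHeat t z.1 * circleHeat t z.2

/-- The regularised Green function `∫_ε^∞ (p_t - 1) dt` of the torus. -/
def torusGreen (ε : ℝ) (z : ℝ × ℝ) : ℝ := ∫ t in Ioi ε, (torusHeat t z - 1)

lemma continuous_latticeDistSq : Continuous latticeDistSq := by
  have h : Continuous (fun a : ℝ => ((a : ℝ) : UnitAddCircle)) := AddCircle.continuous_mk' 1
  unfold latticeDistSq
  exact ((h.comp continuous_fst).norm.pow 2).add ((h.comp continuous_snd).norm.pow 2)

lemma continuousAt_torusHeat {t : ℝ} (ht : 0 < t) (z : ℝ × ℝ) :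
    ContinuousAt (fun x : ℝ × (ℝ × ℝ) => torusHeat x.1 x.2) (t, z) := by
  unfold torusHeat
  refine ContinuousAt.mul ?_ ?_
  · exact ContinuousAt.comp (x := (t, z)) (f := fun x : ℝ × (ℝ × ℝ) => (x.1, x.2.1))
      (g := fun x : ℝ × ℝ => circleHeat x.1 x.2)
      (continuousAt_circleHeat ht z.1) (by fun_prop)
  · exact ContinuousAt.comp (x := (t, z)) (f := fun x : ℝ × (ℝ × ℝ) => (x.1, x.2.2))
      (g := fun x : ℝ × ℝ => circleHeat x.1 x.2)
      (continuousAt_circleHeat ht z.2) (by fun_prop)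

lemma continuous_torusHeat {t : ℝ} (ht : 0 < t) : Continuous (torusHeat t) :=
  continuous_iff_continuousAt.mpr fun z => ContinuousAt.comp (x := z) (f := fun z => (t, z))
    (g := fun x : ℝ × (ℝ × ℝ) => torusHeat x.1 x.2) (continuousAt_torusHeat ht z) (by fun_prop)

lemma continuousOn_torusHeat (z : ℝ × ℝ) : ContinuousOn (fun t => torusHeat t z) (Ioi 0) :=
  fun t ht => (ContinuousAt.comp (x := t) (f := fun t => (t, z))
    (g := fun x : ℝ × (ℝ × ℝ) => torusHeat x.1 x.2) (continuousAt_torusHeat ht z)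
    (by fun_prop)).continuousWithinAt

lemma integral_torusHeat {t : ℝ} (ht : 0 < t) (s : ℝ≥0) (z : ℝ × ℝ) :
    ∫ w, torusHeat t (z + w) ∂planeGaussian s = torusHeat (t + s) z := by
  unfold torusHeat planeGaussian
  simp only [Prod.fst_add, Prod.snd_add]
  rw [integral_prod_mul (fun a => circleHeat t (z.1 + a)) (fun a => circleHeat t (z.2 + a)),
    integral_circleHeat ht, integral_circleHeat ht]

lemma abs_torusHeat_le {t : ℝ} (ht : 0 < t) (z : ℝ × ℝ) : |torusHeat t z| ≤ torusHeat t 0 := by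
  unfold torusHeat
  rw [abs_mul]
  exact mul_le_mul (abs_circleHeat_le ht _) (abs_circleHeat_le ht _) (abs_nonneg _)
    ((abs_nonneg _).trans (abs_circleHeat_le ht 0))

/-- Domination by the value at the origin, independent of `z`, serves every interchange of limits
and integrals for the Green function. -/
lemma abs_torusHeat_sub_one_le {t : ℝ} (ht : 0 < t) (z : ℝ × ℝ) :
    |torusHeat t z - 1| ≤ torusHeat t 0 - 1 := by
  unfold torusHeat
  have h1 := abs_circleHeat_sub_one_le ht z.1
  have h2 := abs_circleHeat_sub_one_le ht z.2
  set S := circleHeat t 0 - 1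
  have e : circleHeat t z.1 * circleHeat t z.2 - 1 = (circleHeat t z.1 - 1) *
    (circleHeat t z.2 - 1) + (circleHeat t z.1 - 1) + (circleHeat t z.2 - 1) := by ring
  have h3 : |(circleHeat t z.1 - 1) * (circleHeat t z.2 - 1)| ≤ S * S := by
    rw [abs_mul]
    exact mul_le_mul h1 h2 (abs_nonneg _) ((abs_nonneg _).trans h1)
  have e2 : circleHeat t (0 : ℝ × ℝ).1 * circleHeat t (0 : ℝ × ℝ).2 - 1 = S * S + S + S := by
    simp only [Prod.fst_zero, Prod.snd_zero, S]; ring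
  rw [e, e2]
  exact (abs_add_le _ _).trans (add_le_add ((abs_add_le _ _).trans (add_le_add h3 h1)) h2)

/-- The spectral gap of the circle gives exponential decay, transferred to the torus by h² - 1 = (h
- 1)(h + 1). -/
lemma integrableOn_torusHeat_zero {ε : ℝ} (hε : 0 < ε) :
    IntegrableOn (fun t => torusHeat t 0 - 1) (Ioi ε) := by
  obtain ⟨p, hp, hO⟩ := HurwitzZeta.isBigO_atTop_cosKernel_sub ((0 : ℝ) : UnitAddCircle)
  have hm : Tendsto (fun t : ℝ => 2 * Real.pi * t) atTop atTop :=
    tendsto_id.const_mul_atTop (by positivity)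
  have hO1 : (fun t => circleHeat t 0 - 1) =O[atTop] fun t => Real.exp (-(p * (2 * Real.pi)) * t) := by
    have := hO.comp_tendsto hm
    refine this.congr (fun t => rfl) (fun t => ?_)
    simp only [Function.comp]; ring_nf
  have hb : (fun t => circleHeat t 0 + 1) =O[atTop] fun _ => (1 : ℝ) := by
    have h1 : (fun t => circleHeat t 0 - 1) =O[atTop] fun _ => (1 : ℝ) := by
      refine hO1.trans (Asymptotics.IsBigO.of_bound 1 ?_)
      filter_upwards [eventually_ge_atTop 0] with t ht
      rw [Real.norm_of_nonneg (Real.exp_nonneg _), norm_one, one_mul]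
      rw [Real.exp_le_one_iff]
      have : 0 ≤ p * (2 * Real.pi) * t := by positivity
      linarith
    have h2 : (fun _ : ℝ => (2 : ℝ)) =O[atTop] fun _ => (1 : ℝ) :=
      Asymptotics.isBigO_const_const _ one_ne_zero _
    refine (h1.add h2).congr_left fun t => by ring
  have hO2 : (fun t => torusHeat t 0 - 1) =O[atTop]
      fun t => Real.exp (-(p * (2 * Real.pi)) * t) := by
    refine (hO1.mul hb).congr (fun t => ?_) (fun t => mul_one _)
    simp only [torusHeat, Prod.fst_zero, Prod.snd_zero]; ring
  refine integrable_of_isBigO_exp_neg (b := p * (2 * Real.pi)) (by positivity) ?_ hO2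
  exact ((continuousOn_torusHeat 0).mono fun t ht => hε.trans_le ht).sub continuousOn_const

lemma integrableOn_torusHeat {ε : ℝ} (hε : 0 < ε) (z : ℝ × ℝ) :
    IntegrableOn (fun t => torusHeat t z - 1) (Ioi ε) := by
  refine (integrableOn_torusHeat_zero hε).mono' ?_ ?_
  · exact (((continuousOn_torusHeat z).mono fun t ht => hε.trans ht).sub
      continuousOn_const).aestronglyMeasurable measurableSet_Ioi
  · filter_upwards [ae_restrict_mem measurableSet_Ioi] with t ht
    exact abs_torusHeat_sub_one_le (hε.trans ht) z

lemma continuous_torusGreen {ε : ℝ} (hε : 0 < ε) : Continuous (torusGreen ε) := by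
  refine continuous_of_dominated (bound := fun t => torusHeat t 0 - 1) (fun z => ?_)
    (fun z => ?_) (integrableOn_torusHeat_zero hε) ?_
  · exact (integrableOn_torusHeat hε z).aestronglyMeasurable
  · filter_upwards [ae_restrict_mem measurableSet_Ioi] with t ht
    exact abs_torusHeat_sub_one_le (hε.trans ht) z
  · filter_upwards [ae_restrict_mem measurableSet_Ioi] with t ht
    exact (continuous_torusHeat (hε.trans ht)).sub continuous_const

lemma abs_torusGreen_le {ε : ℝ} (hε : 0 < ε) (z : ℝ × ℝ) : |torusGreen ε z| ≤ torusGreen ε 0 := by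
  refine (norm_integral_le_of_norm_le (f := fun t => torusHeat t z - 1)
    (integrableOn_torusHeat_zero hε) ?_)
  filter_upwards [ae_restrict_mem measurableSet_Ioi] with t ht
  exact abs_torusHeat_sub_one_le (hε.trans ht) z

lemma torusGreen_eq_add {ε ε' : ℝ} (hε : 0 < ε) (h : ε ≤ ε') (z : ℝ × ℝ) :
    torusGreen ε z = (∫ t in ε..ε', (torusHeat t z - 1)) + torusGreen ε' z := by
  unfold torusGreen
  rw [intervalIntegral.integral_of_le h, ← setIntegral_union Ioc_disjoint_Ioi_same measurableSet_Ioi,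
    Ioc_union_Ioi_eq_Ioi h]
  · exact (integrableOn_torusHeat hε z).mono_set fun t ht => ht.1
  · exact integrableOn_torusHeat (hε.trans_le h) z

/-- By Fubini and the semigroup property, averaging over a time `s` only moves the cutoff.
Differentiating in `s` yields the generator without any second derivative in space. -/
lemma integral_torusGreen {ε : ℝ} (hε : 0 < ε) (s : ℝ≥0) (z : ℝ × ℝ) :
    ∫ w, torusGreen ε (z + w) ∂planeGaussian s = torusGreen (ε + s) z := by
  have hsw : ∫ w, torusGreen ε (z + w) ∂planeGaussian s =
      ∫ t in Ioi ε, ∫ w, (torusHeat t (z + w) - 1) ∂planeGaussian s := by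
    unfold torusGreen
    refine integral_integral_swap (f := fun w t => torusHeat t (z + w) - 1) ?_
    refine Integrable.mono' (g := fun x : (ℝ × ℝ) × ℝ => torusHeat x.2 0 - 1) ?_ ?_ ?_
    · exact (integrableOn_torusHeat_zero hε).comp_snd _
    · have hc : ContinuousOn (fun x : (ℝ × ℝ) × ℝ => torusHeat x.2 (z + x.1) - 1)
          (univ ×ˢ Ioi ε) := by
        intro x hx
        refine ContinuousAt.continuousWithinAt (ContinuousAt.sub ?_ continuousAt_const)
        exact ContinuousAt.comp (x := x) (f := fun x : (ℝ × ℝ) × ℝ => (x.2, z + x.1))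
          (g := fun x : ℝ × (ℝ × ℝ) => torusHeat x.1 x.2)
          (continuousAt_torusHeat (hε.trans hx.2) _) (by fun_prop)
      have := hc.aestronglyMeasurable (μ := (planeGaussian s).prod volume)
        (MeasurableSet.univ.prod measurableSet_Ioi)
      rwa [← Measure.prod_restrict, Measure.restrict_univ] at this
    · have : ∀ᵐ x ∂((planeGaussian s).prod (volume.restrict (Ioi ε))), x.2 ∈ Ioi ε :=
        Measure.quasiMeasurePreserving_snd.ae (ae_restrict_mem measurableSet_Ioi)
      filter_upwards [this] with x hx
      exact abs_torusHeat_sub_one_le (hε.trans hx) _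
  rw [hsw]
  have h2 : ∫ t in Ioi ε, ∫ w, (torusHeat t (z + w) - 1) ∂planeGaussian s =
      ∫ t in Ioi ε, (torusHeat (t + s) z - 1) := by
    refine setIntegral_congr_fun measurableSet_Ioi fun t ht => ?_
    have ht0 : 0 < t := hε.trans ht
    rw [integral_sub, integral_torusHeat ht0]
    · simp
    · refine Integrable.of_bound (C := torusHeat t 0) ?_ (ae_of_all _ fun w => abs_torusHeat_le ht0 _)
      exact ((continuous_torusHeat ht0).comp (by fun_prop)).aestronglyMeasurable
    · simp
  rw [h2, torusGreen]
  have h3 := (measurePreserving_add_right volume (s : ℝ)).setIntegral_preimage_emb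
    (measurableEmbedding_addRight (s : ℝ)) (fun t => torusHeat t z - 1) (Ioi (ε + s))
  rw [← h3]
  congr 2
  ext t
  simp

/-! ### Functions with a generator -/

/-- `g` is the image of `f` under the generator `½ Δ` of planar Brownian motion, in the sense that
`P_r f - f = ∫_0^r P_u g du` for the heat semigroup `P`. -/
structure GenPair (f g : ℝ × ℝ → ℝ) : Prop where
  cont_fst : Continuous f
  cont_snd : Continuous g
  bdd_fst : ∃ C, ∀ z, |f z| ≤ C
  bdd_snd : ∃ C, ∀ z, |g z| ≤ C
  semigroup : ∃ G : ℝ → ℝ × ℝ → ℝ, Continuous (Function.uncurry G) ∧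
    (∀ (r : ℝ≥0) z, G r z = ∫ w, g (z + w) ∂planeGaussian r) ∧
    ∀ (r : ℝ≥0) z, ∫ w, f (z + w) ∂planeGaussian r = f z + ∫ u in (0 : ℝ)..r, G u z

lemma integrable_planeGaussian {f : ℝ × ℝ → ℝ} (hf : Continuous f) (hb : ∃ C, ∀ z, |f z| ≤ C)
    (r : ℝ≥0) (z : ℝ × ℝ) : Integrable (fun w => f (z + w)) (planeGaussian r) := by
  obtain ⟨C, hC⟩ := hb
  exact Integrable.of_bound (C := C) (hf.comp (by fun_prop)).aestronglyMeasurable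
    (ae_of_all _ fun w => hC _)

lemma GenPair.add {f g f' g' : ℝ × ℝ → ℝ} (h : GenPair f g) (h' : GenPair f' g') :
    GenPair (fun z => f z + f' z) (fun z => g z + g' z) := by
  have hbadd : ∀ {a b : ℝ × ℝ → ℝ}, (∃ C, ∀ z, |a z| ≤ C) → (∃ C, ∀ z, |b z| ≤ C) →
      ∃ C, ∀ z, |a z + b z| ≤ C := by
    rintro a b ⟨C, hC⟩ ⟨C', hC'⟩
    exact ⟨C + C', fun z => (abs_add_le _ _).trans (add_le_add (hC z) (hC' z))⟩
  refine ⟨h.cont_fst.add h'.cont_fst, h.cont_snd.add h'.cont_snd, hbadd h.bdd_fst h'.bdd_fst,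
    hbadd h.bdd_snd h'.bdd_snd, ?_⟩
  obtain ⟨G, hG, hG1, hG2⟩ := h.semigroup
  obtain ⟨G', hG', hG1', hG2'⟩ := h'.semigroup
  refine ⟨fun r z => G r z + G' r z, hG.add hG', fun r z => ?_, fun r z => ?_⟩
  · beta_reduce
    rw [integral_add (integrable_planeGaussian h.cont_snd h.bdd_snd r z)
      (integrable_planeGaussian h'.cont_snd h'.bdd_snd r z), hG1, hG1']
  · rw [integral_add (integrable_planeGaussian h.cont_fst h.bdd_fst r z)
      (integrable_planeGaussian h'.cont_fst h'.bdd_fst r z), hG2, hG2',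
      intervalIntegral.integral_add]
    · ring
    · exact (hG.comp (continuous_id.prodMk continuous_const)).intervalIntegrable _ _
    · exact (hG'.comp (continuous_id.prodMk continuous_const)).intervalIntegrable _ _

lemma GenPair.const_mul {f g : ℝ × ℝ → ℝ} (h : GenPair f g) (c : ℝ) :
    GenPair (fun z => c * f z) (fun z => c * g z) := by
  have hb : ∀ {a : ℝ × ℝ → ℝ}, (∃ C, ∀ z, |a z| ≤ C) → ∃ C, ∀ z, |c * a z| ≤ C := by
    rintro a ⟨C, hC⟩
    exact ⟨|c| * C, fun z => by rw [abs_mul]; gcongr; exact hC z⟩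
  refine ⟨continuous_const.mul h.cont_fst, continuous_const.mul h.cont_snd, hb h.bdd_fst,
    hb h.bdd_snd, ?_⟩
  obtain ⟨G, hG, hG1, hG2⟩ := h.semigroup
  refine ⟨fun r z => c * G r z, continuous_const.mul hG, fun r z => ?_, fun r z => ?_⟩
  · beta_reduce
    rw [integral_const_mul, hG1]
  · rw [integral_const_mul, hG2, intervalIntegral.integral_const_mul]
    ring

lemma GenPair.const (c : ℝ) : GenPair (fun _ => c) (fun _ => 0) :=
  ⟨continuous_const, continuous_const, ⟨|c|, fun _ => le_rfl⟩, ⟨0, by simp⟩,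
    fun _ _ => 0, continuous_const, by simp, by simp⟩

lemma GenPair.comp_sub {f g : ℝ × ℝ → ℝ} (h : GenPair f g) (c : ℝ × ℝ) :
    GenPair (fun z => f (z - c)) (fun z => g (z - c)) := by
  refine ⟨h.cont_fst.comp (by fun_prop), h.cont_snd.comp (by fun_prop),
    h.bdd_fst.imp fun C hC z => hC _, h.bdd_snd.imp fun C hC z => hC _, ?_⟩
  obtain ⟨G, hG, hG1, hG2⟩ := h.semigroup
  refine ⟨fun r z => G r (z - c), hG.comp (f := fun x : ℝ × (ℝ × ℝ) => (x.1, x.2 - c))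
    (by fun_prop), fun r z => ?_, fun r z => ?_⟩
  · beta_reduce
    rw [hG1]
    simp only [sub_add_eq_add_sub]
  · rw [← hG2]
    simp only [sub_add_eq_add_sub]

lemma genPair_torusGreen {ε : ℝ} (hε : 0 < ε) :
    GenPair (torusGreen ε) (fun z => 1 - torusHeat ε z) := by
  refine ⟨continuous_torusGreen hε, continuous_const.sub (continuous_torusHeat hε),
    ⟨_, abs_torusGreen_le hε⟩, ⟨_, fun z => (abs_sub_comm _ _).trans_le
      (abs_torusHeat_sub_one_le hε z)⟩, ?_⟩
  -- `max r 0` is a continuous extension to negative times, where the value is irrelevant.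
  refine ⟨fun r z => 1 - torusHeat (ε + max r 0) z, ?_, fun r z => ?_, fun r z => ?_⟩
  · refine continuous_const.sub (continuous_iff_continuousAt.mpr fun x => ?_)
    have : 0 < ε + max x.1 0 := by positivity
    exact ContinuousAt.comp (x := x) (f := fun x : ℝ × (ℝ × ℝ) => (ε + max x.1 0, x.2))
          (g := fun x : ℝ × (ℝ × ℝ) => torusHeat x.1 x.2)
          (continuousAt_torusHeat this _) (by fun_prop)
  · rw [integral_sub (by simp), integral_torusHeat hε]
    · simp
    · exact integrable_planeGaussian (continuous_torusHeat hε) ⟨_, abs_torusHeat_le hε⟩ r z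
  · rw [integral_torusGreen hε, torusGreen_eq_add hε (ε' := ε + r) (by simp)]
    have h1 : ∫ u in (0 : ℝ)..r, (1 - torusHeat (ε + max u 0) z) =
        ∫ u in (0 : ℝ)..r, (fun t => 1 - torusHeat t z) (ε + u) := by
      refine intervalIntegral.integral_congr fun u hu => ?_
      rw [uIcc_of_le (by simp)] at hu
      simp only [max_eq_left hu.1]
    rw [h1, intervalIntegral.integral_comp_add_left (fun t => 1 - torusHeat t z), add_zero]
    have h2 : ∫ t in ε..(ε + r), (torusHeat t z - 1) = -∫ t in ε..(ε + r), (1 - torusHeat t z) := by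
      rw [← intervalIntegral.integral_neg]
      simp
    rw [h2]
    ring

/-! ### Bounds on the heat kernel and on the Green function -/

lemma latticeDistSq_nonneg (z : ℝ × ℝ) : 0 ≤ latticeDistSq z := by
  unfold latticeDistSq; positivity

lemma torusHeat_ge {t : ℝ} (ht : 0 < t) (z : ℝ × ℝ) :
    1 / (2 * Real.pi * t) * Real.exp (-latticeDistSq z / (2 * t)) ≤ torusHeat t z := by
  have h1 := circleHeat_ge ht z.1
  have h2 := circleHeat_ge ht z.2
  have h := mul_le_mul h1 h2 (by positivity) (le_trans (by positivity) h1)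
  refine le_trans (le_of_eq ?_) h
  rw [mul_mul_mul_comm, ← mul_inv, Real.mul_self_sqrt (by positivity), ← Real.exp_add, one_div,
    latticeDistSq]
  congr 2
  ring

lemma torusHeat_nonneg {t : ℝ} (ht : 0 < t) (z : ℝ × ℝ) : 0 ≤ torusHeat t z :=
  le_trans (by positivity) (torusHeat_ge ht z)

lemma exists_torusHeat_le : ∃ C : ℝ, 0 ≤ C ∧ ∀ t ∈ Ioc (0 : ℝ) 1, ∀ z : ℝ × ℝ,
    torusHeat t z ≤ 1 / (2 * Real.pi * t) * Real.exp (-latticeDistSq z / (2 * t)) + C * t := by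
  obtain ⟨K, hK, h⟩ := exists_circleHeat_le
  refine ⟨2 * K + K ^ 2, by positivity, fun t ht z => ?_⟩
  have ht0 := ht.1
  have h1 := h t ht0 z.1
  have h2 := h t ht0 z.2
  set e1 := Real.exp (-‖(z.1 : UnitAddCircle)‖ ^ 2 / (2 * t)) with he1
  set e2 := Real.exp (-‖(z.2 : UnitAddCircle)‖ ^ 2 / (2 * t)) with he2
  have h10 : 0 ≤ circleHeat t z.2 := le_trans (by positivity) (circleHeat_ge ht0 z.2)
  have hm := mul_le_mul h1 h2 h10 (by positivity)
  have e1le : e1 ≤ 1 := by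
    rw [he1, Real.exp_le_one_iff, neg_div]
    exact neg_nonpos.mpr (by positivity)
  have e2le : e2 ≤ 1 := by
    rw [he2, Real.exp_le_one_iff, neg_div]
    exact neg_nonpos.mpr (by positivity)
  have he : Real.exp (-latticeDistSq z / (2 * t)) = e1 * e2 := by
    rw [he1, he2, ← Real.exp_add, latticeDistSq]; congr 1; ring
  rw [mul_mul_mul_comm, ← mul_inv, Real.mul_self_sqrt (by positivity), ← one_div] at hm
  rw [he]
  refine hm.trans ?_
  have hsq : t ^ 2 ≤ 1 := pow_le_one₀ ht0.le ht.2
  have hb : (e1 + K * t ^ 2) * (e2 + K * t ^ 2) ≤ e1 * e2 + (2 * K + K ^ 2) * t ^ 2 := by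
    have h3 : e1 * (K * t ^ 2) ≤ 1 * (K * t ^ 2) := by gcongr
    have h4 : e2 * (K * t ^ 2) ≤ 1 * (K * t ^ 2) := by gcongr
    have h5 : K ^ 2 * t ^ 2 * t ^ 2 ≤ K ^ 2 * t ^ 2 * 1 := by gcongr
    nlinarith
  have hpi : 1 ≤ 2 * Real.pi := by linarith [Real.pi_gt_three]
  calc _ ≤ 1 / (2 * Real.pi * t) * (e1 * e2 + (2 * K + K ^ 2) * t ^ 2) := by gcongr
    _ = 1 / (2 * Real.pi * t) * (e1 * e2) + 1 / (2 * Real.pi) * ((2 * K + K ^ 2) * t) := by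
        field_simp
    _ ≤ 1 / (2 * Real.pi * t) * (e1 * e2) + 1 * ((2 * K + K ^ 2) * t) := by
        gcongr
        rw [div_le_one (by positivity)]; exact hpi
    _ = _ := by ring

/-- A cutoff `r ^ 4`, far below the diffusive scale r², makes the source p_ε negligible at distance
at least `r`. There the Green function has generator 1 up to O(r²). -/
lemma exists_torusHeat_pow_four_le : ∃ C : ℝ, 0 ≤ C ∧ ∀ r ∈ Ioc (0 : ℝ) 1, ∀ z : ℝ × ℝ,
    r ^ 2 ≤ latticeDistSq z → torusHeat (r ^ 4) z ≤ C * r ^ 2 := by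
  obtain ⟨C, hC, h⟩ := exists_torusHeat_le
  refine ⟨8 + C, by positivity, fun r hr z hz => ?_⟩
  have hr0 := hr.1
  have h4 : r ^ 4 ≤ 1 := pow_le_one₀ hr0.le hr.2
  refine (h (r ^ 4) ⟨by positivity, h4⟩ z).trans ?_
  set y := 1 / (2 * r ^ 2) with hy
  have hy0 : 0 < y := by positivity
  have h1 : Real.exp (-latticeDistSq z / (2 * r ^ 4)) ≤ Real.exp (-y) := by
    apply Real.exp_le_exp.mpr
    rw [neg_div, neg_le_neg_iff, hy, div_le_div_iff₀ (by positivity) (by positivity)]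
    have : r ^ 2 * (2 * r ^ 2) ≤ latticeDistSq z * (2 * r ^ 2) := by gcongr
    nlinarith
  have h2 : Real.exp (-y) ≤ 6 / y ^ 3 := by
    rw [Real.exp_neg, ← one_div, div_le_div_iff₀ (Real.exp_pos _) (by positivity)]
    have := Real.pow_div_factorial_le_exp y hy0.le 3
    norm_num [Nat.factorial] at this
    linarith
  have h3 : 6 / y ^ 3 = 48 * r ^ 6 := by
    rw [hy]; field_simp; norm_num
  have h5 : r ^ 4 ≤ r ^ 2 := pow_le_pow_of_le_one hr0.le hr.2 (by norm_num)
  calc _ ≤ 1 / (2 * Real.pi * r ^ 4) * (48 * r ^ 6) + C * r ^ 2 := by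
        gcongr
        exact (h1.trans h2).trans_eq h3
    _ = 24 / Real.pi * r ^ 2 + C * r ^ 2 := by
        congr 1
        field_simp
        norm_num
    _ ≤ 8 * r ^ 2 + C * r ^ 2 := by
        gcongr
        rw [div_le_iff₀ Real.pi_pos]
        linarith [Real.pi_gt_three]
    _ = _ := by ring

/-- At distance r the times between r² and 1 contribute ∫ dt/(2πt) = (1/π) log(1/r), and all other
times O(1). The lower bound needs only times above r², hence its cutoff; the upper bound is uniform
in the cutoff. -/
lemma exists_torusGreen_bounds : ∃ C : ℝ, 0 ≤ C ∧
    (∀ ε ∈ Ioc (0 : ℝ) 1, ∀ z, -C ≤ torusGreen ε z) ∧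
    (∀ ε ∈ Ioc (0 : ℝ) 1, ∀ r ∈ Ioc (0 : ℝ) 1, ∀ z, r ^ 2 ≤ latticeDistSq z →
      torusGreen ε z ≤ 1 / Real.pi * Real.log (1 / r) + C) ∧
    (∀ r ∈ Ioc (0 : ℝ) 1, ∀ z, latticeDistSq z ≤ r ^ 2 →
      1 / Real.pi * Real.log (1 / r) - C ≤ torusGreen (r ^ 2) z) := by
  obtain ⟨C, hC, hup⟩ := exists_torusHeat_le
  have hg0 : 0 ≤ torusGreen 1 0 := (abs_nonneg _).trans (abs_torusGreen_le one_pos 0)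
  have hlocal : ∀ ε ∈ Ioc (0 : ℝ) 1, ∀ z, IntervalIntegrable (fun t => torusHeat t z)
      volume ε 1 := by
    intro ε hε z
    refine ContinuousOn.intervalIntegrable ((continuousOn_torusHeat z).mono fun t ht => ?_)
    rw [uIcc_of_le hε.2] at ht
    exact hε.1.trans_le ht.1
  have hsplit : ∀ ε ∈ Ioc (0 : ℝ) 1, ∀ z,
      torusGreen ε z = (∫ t in ε..1, torusHeat t z) - (1 - ε) + torusGreen 1 z := by
    intro ε hε z
    rw [torusGreen_eq_add hε.1 hε.2, intervalIntegral.integral_sub (hlocal ε hε z) (by simp)]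
    simp
  have hlog2 : Real.log 2 ≤ 1 := by linarith [Real.log_two_lt_d9]
  refine ⟨torusGreen 1 0 + C + 3, by positivity, fun ε hε z => ?_, fun ε hε r hr z hz => ?_,
    fun r hr z hz => ?_⟩
  · rw [hsplit ε hε]
    have h1 := (abs_le.mp (abs_torusGreen_le one_pos z)).1
    have h2 : 0 ≤ ∫ t in ε..1, torusHeat t z :=
      intervalIntegral.integral_nonneg hε.2 fun t ht => torusHeat_nonneg (hε.1.trans_le ht.1) z
    linarith [hε.1]
  · rw [hsplit ε hε]
    have h1 := (abs_le.mp (abs_torusGreen_le one_pos z)).2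
    have hr0 := hr.1
    have hr1 : r ^ 2 ≤ 1 := pow_le_one₀ hr0.le hr.2
    have hpos : ∀ t ∈ Icc ε 1, 0 < t + r ^ 2 / 2 := fun t ht => by
      have := hε.1.trans_le ht.1
      positivity
    have hcont : ContinuousOn (fun t => (t + r ^ 2 / 2)⁻¹) (uIcc ε 1) := by
      rw [uIcc_of_le hε.2]
      exact ContinuousOn.inv₀ (by fun_prop) fun t ht => (hpos t ht).ne'
    have h2 : ∫ t in ε..1, torusHeat t z ≤
        ∫ t in ε..1, (1 / (2 * Real.pi) * (t + r ^ 2 / 2)⁻¹ + C) := by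
      refine intervalIntegral.integral_mono_on hε.2 (hlocal ε hε z)
        ((hcont.intervalIntegrable.const_mul _).add (by simp)) fun t ht => ?_
      have ht0 := hε.1.trans_le ht.1
      refine (hup t ⟨ht0, ht.2⟩ z).trans ?_
      -- The bound e^(-x) ≤ 1/(1+x) turns the integrand into 1/(2π(t + r²/2)), which has an explicit
      -- primitive and no singularity at t = 0.
      have h3 : Real.exp (-latticeDistSq z / (2 * t)) ≤ (1 + r ^ 2 / (2 * t))⁻¹ := by
        rw [neg_div, Real.exp_neg]
        gcongr
        have := Real.add_one_le_exp (latticeDistSq z / (2 * t))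
        have h4 : r ^ 2 / (2 * t) ≤ latticeDistSq z / (2 * t) := by gcongr
        linarith
      have h5 : C * t ≤ C := mul_le_of_le_one_right hC ht.2
      refine add_le_add ((mul_le_mul_of_nonneg_left h3 (by positivity)).trans_eq ?_) h5
      have := (hpos t ht).ne'
      field_simp
    have h6 : ∫ t in ε..1, (1 / (2 * Real.pi) * (t + r ^ 2 / 2)⁻¹ + C) =
        1 / (2 * Real.pi) * (Real.log ((1 + r ^ 2 / 2) / (ε + r ^ 2 / 2))) + C * (1 - ε) := by
      rw [intervalIntegral.integral_add (hcont.intervalIntegrable.const_mul _) (by simp),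
        intervalIntegral.integral_const_mul,
        intervalIntegral.integral_comp_add_right (fun t => t⁻¹), integral_inv_of_pos]
      · simp [mul_comm]
      · exact hpos ε ⟨le_rfl, hε.2⟩
      · exact hpos 1 ⟨hε.2, le_rfl⟩
    have h7 : Real.log ((1 + r ^ 2 / 2) / (ε + r ^ 2 / 2)) ≤ 2 * Real.log (1 / r) + 2 := by
      calc _ ≤ Real.log (4 * (1 / r) ^ 2) := by
            apply Real.log_le_log (div_pos (hpos 1 ⟨hε.2, le_rfl⟩) (hpos ε ⟨le_rfl, hε.2⟩))
            rw [div_le_iff₀ (hpos ε ⟨le_rfl, hε.2⟩)]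
            have : 4 * (1 / r) ^ 2 * (ε + r ^ 2 / 2) = 4 * (1 / r) ^ 2 * ε + 2 := by
              field_simp; ring
            rw [this]
            have := hε.1
            have : 0 ≤ 4 * (1 / r) ^ 2 * ε := by positivity
            linarith
        _ = 2 * Real.log 2 + 2 * Real.log (1 / r) := by
            rw [Real.log_mul (by norm_num) (by positivity), Real.log_pow,
              show (4 : ℝ) = 2 ^ 2 by norm_num, Real.log_pow]
            push_cast; ring
        _ ≤ _ := by linarith
    have h8 : 1 / (2 * Real.pi) * (Real.log ((1 + r ^ 2 / 2) / (ε + r ^ 2 / 2))) ≤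
        1 / Real.pi * Real.log (1 / r) + 1 := by
      calc _ ≤ 1 / (2 * Real.pi) * (2 * Real.log (1 / r) + 2) := by gcongr
        _ = 1 / Real.pi * Real.log (1 / r) + 1 / Real.pi := by field_simp
        _ ≤ _ := by
          gcongr
          rw [div_le_one Real.pi_pos]; linarith [Real.pi_gt_three]
    have h9 : C * (1 - ε) ≤ C := mul_le_of_le_one_right hC (by linarith [hε.1])
    linarith [hε.2]
  · have hr0 := hr.1
    have hr1 : r ^ 2 ≤ 1 := pow_le_one₀ hr0.le hr.2
    have hε : r ^ 2 ∈ Ioc (0 : ℝ) 1 := ⟨by positivity, hr1⟩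
    rw [hsplit _ hε]
    have h1 := (abs_le.mp (abs_torusGreen_le one_pos z)).1
    have hpos : ∀ t ∈ Icc (r ^ 2) 1, 0 < t := fun t ht => hε.1.trans_le ht.1
    have hnz : (0 : ℝ) ∉ uIcc (r ^ 2) 1 := by
      rw [uIcc_of_le hr1]
      exact fun h => (hpos 0 h).ne' rfl
    have hi1 : IntervalIntegrable (fun t : ℝ => t⁻¹) volume (r ^ 2) 1 :=
      intervalIntegral.intervalIntegrable_inv (fun t ht h => hnz (h ▸ ht)) continuousOn_id
    have hi2 : IntervalIntegrable (fun t : ℝ => t ^ (-2 : ℤ)) volume (r ^ 2) 1 :=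
      intervalIntegral.intervalIntegrable_zpow (Or.inr hnz)
    have h2 : ∫ t in (r ^ 2)..1, 1 / (2 * Real.pi) * (t⁻¹ - r ^ 2 / 2 * t ^ (-2 : ℤ)) ≤
        ∫ t in (r ^ 2)..1, torusHeat t z := by
      refine intervalIntegral.integral_mono_on hr1 ((hi1.sub (hi2.const_mul _)).const_mul _)
        (hlocal _ hε z) fun t ht => ?_
      have ht0 := hpos t ht
      refine le_trans ?_ (torusHeat_ge ht0 z)
      have h3 : 1 - r ^ 2 / (2 * t) ≤ Real.exp (-latticeDistSq z / (2 * t)) := by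
        have := Real.add_one_le_exp (-latticeDistSq z / (2 * t))
        have h4 : latticeDistSq z / (2 * t) ≤ r ^ 2 / (2 * t) := by gcongr
        rw [neg_div] at *
        linarith
      refine le_trans (le_of_eq ?_) (mul_le_mul_of_nonneg_left h3 (by positivity))
      rw [zpow_neg]
      norm_cast
      field_simp
    have h6 : ∫ t in (r ^ 2)..1, 1 / (2 * Real.pi) * (t⁻¹ - r ^ 2 / 2 * t ^ (-2 : ℤ)) =
        1 / (2 * Real.pi) * (2 * Real.log (1 / r) - 1 / 2 + r ^ 2 / 2) := by
      rw [intervalIntegral.integral_const_mul, intervalIntegral.integral_sub hi1 (hi2.const_mul _),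
        intervalIntegral.integral_const_mul, integral_inv_of_pos hε.1 one_pos,
        integral_zpow (Or.inr ⟨by norm_num, hnz⟩)]
      congr 1
      have e1 : Real.log (1 / r ^ 2) = 2 * Real.log (1 / r) := by
        rw [← one_div_pow, Real.log_pow]; norm_num
      rw [e1]
      norm_num
      field_simp
      ring
    have h7 : 1 / Real.pi * Real.log (1 / r) - 1 ≤
        1 / (2 * Real.pi) * (2 * Real.log (1 / r) - 1 / 2 + r ^ 2 / 2) := by
      have e : 1 / (2 * Real.pi) * (2 * Real.log (1 / r) - 1 / 2 + r ^ 2 / 2) =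
        1 / Real.pi * Real.log (1 / r) + 1 / (2 * Real.pi) * (- 1 / 2 + r ^ 2 / 2) := by
        field_simp; ring
      rw [e]
      have h8 : 1 / (2 * Real.pi) ≤ 1 := by
        rw [div_le_one (by positivity)]; linarith [Real.pi_gt_three]
      have h9 : (0 : ℝ) < 1 / (2 * Real.pi) := by positivity
      nlinarith [hε.1]
    linarith [hε.1]

/-! ### Processes with a drift and optional stopping -/

/-- The process `Y` has drift `D` with respect to the filtration `F`: the difference of `Y` and of
the time integral of `D` is a martingale, and everything is bounded on bounded time intervals. -/
structure HasDrift {Ω : Type*} {mΩ : MeasurableSpace Ω} (F : ℝ≥0 → MeasurableSpace Ω)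
    (P : Measure Ω) (Y : ℝ≥0 → Ω → ℝ) (D : ℝ → Ω → ℝ) : Prop where
  le : ∀ t, F t ≤ mΩ
  cont : ∀ ω, Continuous (Y · ω)
  meas : ∀ t, Measurable (Y t)
  bdd : ∀ T : ℝ≥0, ∃ C, ∀ t ≤ T, ∀ ω, |Y t ω| ≤ C
  cont_drift : ∀ ω, Continuous (D · ω)
  meas_drift : ∀ u, Measurable (D u)
  bdd_drift : ∀ T : ℝ≥0, ∃ C, ∀ u ∈ Icc (0 : ℝ) T, ∀ ω, |D u ω| ≤ C
  mart : ∀ s t : ℝ≥0, s ≤ t → ∀ A, MeasurableSet[F s] A →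
    ∫ ω in A, Y t ω ∂P - ∫ ω in A, Y s ω ∂P = ∫ u in (s : ℝ)..t, ∫ ω in A, D u ω ∂P

section

variable {Ω : Type*} {mΩ : MeasurableSpace Ω} {F : ℝ≥0 → MeasurableSpace Ω} {P : Measure Ω}
  {Y Y' : ℝ≥0 → Ω → ℝ} {D D' : ℝ → Ω → ℝ}

lemma setIntegral_intervalIntegral_swap [IsFiniteMeasure P] {H : ℝ → Ω → ℝ}
    (hc : ∀ ω, Continuous (H · ω)) (hm : ∀ u, Measurable (H u)) {s t C : ℝ} (hst : s ≤ t)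
    (hb : ∀ u ∈ Icc s t, ∀ ω, |H u ω| ≤ C) (A : Set Ω) :
    ∫ ω in A, (∫ u in s..t, H u ω) ∂P = ∫ u in s..t, ∫ ω in A, H u ω ∂P := by
  simp_rw [intervalIntegral.integral_of_le hst]
  refine integral_integral_swap (f := fun ω u => H u ω) ?_
  have hj : Measurable (Function.uncurry H) := measurable_uncurry_of_continuous_of_measurable hc hm
  refine Integrable.of_bound (C := C) (hj.comp measurable_swap).aestronglyMeasurable ?_
  have : ∀ᵐ x ∂((P.restrict A).prod (volume.restrict (Ioc s t))), x.2 ∈ Ioc s t :=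
    Measure.quasiMeasurePreserving_snd.ae (ae_restrict_mem measurableSet_Ioc)
  filter_upwards [this] with x hx
  exact hb _ ⟨hx.1.le, hx.2⟩ _

lemma continuous_intervalIntegral_path (hc : ∀ ω, Continuous (D · ω)) (ω : Ω) :
    Continuous (fun t : ℝ≥0 => ∫ u in (0 : ℝ)..t, D u ω) :=
  (intervalIntegral.continuous_primitive (fun a b => (hc ω).intervalIntegrable a b) 0).comp
    NNReal.continuous_coe

lemma measurable_intervalIntegral_path (hc : ∀ ω, Continuous (D · ω)) (hm : ∀ u, Measurable (D u))
    (t : ℝ) : Measurable (fun ω => ∫ u in (0 : ℝ)..t, D u ω) := by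
  have hj : Measurable (Function.uncurry D) := measurable_uncurry_of_continuous_of_measurable hc hm
  have h2 : StronglyMeasurable (Function.uncurry fun ω u => D u ω) :=
    (hj.comp measurable_swap).stronglyMeasurable
  unfold intervalIntegral
  exact (h2.integral_prod_right).measurable.sub (h2.integral_prod_right).measurable

lemma abs_intervalIntegral_path_le {T : ℝ≥0} {C : ℝ}
    (hC : ∀ u ∈ Icc (0 : ℝ) T, ∀ ω, |D u ω| ≤ C) {t : ℝ≥0} (ht : t ≤ T) (ω : Ω) :
    |∫ u in (0 : ℝ)..t, D u ω| ≤ C * T := by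
  have hC0 : 0 ≤ C := (abs_nonneg _).trans (hC 0 ⟨le_rfl, by simp⟩ ω)
  have := intervalIntegral.norm_integral_le_of_norm_le_const (a := (0 : ℝ)) (b := t) (C := C)
    (f := fun u => D u ω) fun u hu => by
      rw [uIoc_of_le (by simp)] at hu
      exact hC u ⟨hu.1.le, hu.2.trans (by exact_mod_cast ht)⟩ ω
  refine this.trans ?_
  rw [sub_zero, abs_of_nonneg (by simp)]
  gcongr

lemma sum_range_ite_telescope (u : ℕ → ℝ) (m K : ℕ) (h : m ≤ K) :
    ∑ i ∈ Finset.range K, (if i < m then u (i + 1) - u i else 0) = u m - u 0 := by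
  rw [← Finset.sum_range_sub, ← Finset.sum_filter]
  congr 1
  ext i
  simp only [Finset.mem_filter, Finset.mem_range]
  omega

lemma measurable_eval_time {Z : ℝ≥0 → Ω → ℝ} (hc : ∀ ω, Continuous (Z · ω))
    (hm : ∀ t, Measurable (Z t)) {τ : Ω → ℝ≥0} (hτ : Measurable τ) :
    Measurable (fun ω => Z (τ ω) ω) :=
  (measurable_uncurry_of_continuous_of_measurable hc hm).comp (hτ.prodMk measurable_id)

/-- Optional stopping for a continuous bounded martingale, at a bounded stopping time. -/
lemma integral_stopped_eq [IsFiniteMeasure P] {N : ℝ≥0 → Ω → ℝ} (hF : ∀ t, F t ≤ mΩ)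
    (hc : ∀ ω, Continuous (N · ω))
    (hm : ∀ t, Measurable (N t)) (hb : ∀ T : ℝ≥0, ∃ C, ∀ t ≤ T, ∀ ω, |N t ω| ≤ C)
    (hmart : ∀ s t : ℝ≥0, s ≤ t → ∀ A, MeasurableSet[F s] A →
      ∫ ω in A, N t ω ∂P = ∫ ω in A, N s ω ∂P)
    {τ : Ω → ℝ≥0} {T : ℝ≥0} (hT : ∀ ω, τ ω ≤ T) (hτ : ∀ t, MeasurableSet[F t] {ω | τ ω ≤ t}) :
    ∫ ω, N (τ ω) ω ∂P = ∫ ω, N 0 ω ∂P := by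
  -- The discretised times below may exceed `T` by up to one mesh, which is at most 1.
  obtain ⟨C, hC⟩ := hb (T + 1)
  have hint : ∀ t, Integrable (N t) P := fun t => by
    obtain ⟨C', hC'⟩ := hb t
    exact Integrable.of_bound (C := C') (hm t).aestronglyMeasurable
      (ae_of_all _ fun ω => hC' t le_rfl ω)
  have hτm : Measurable τ := measurable_of_Iic fun t => hF t _ (hτ t)
  -- `τ` is rounded up to a grid of mesh 1/(k+1). The increment over the i-th cell enters the
  -- telescoping sum on {grid i < τ}, an event known at the left end of the cell, so its integral
  -- vanishes. Continuity then removes the discretisation.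
  set grid : ℕ → ℕ → ℝ≥0 := fun k i => (i : ℝ≥0) / ((k : ℝ≥0) + 1) with hgrid
  have hk0 : ∀ k : ℕ, (0 : ℝ≥0) < (k : ℝ≥0) + 1 := fun k => by positivity
  set m : ℕ → Ω → ℕ := fun k ω => ⌈τ ω * ((k : ℝ≥0) + 1)⌉₊ with hmdef
  have hlt : ∀ k i ω, i < m k ω ↔ grid k i < τ ω := fun k i ω => by
    rw [hmdef, hgrid, Nat.lt_ceil, div_lt_iff₀ (hk0 k)]
  have hstep : ∀ k, ∫ ω, N (grid k (m k ω)) ω ∂P = ∫ ω, N 0 ω ∂P := by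
    intro k
    set K := ⌈T * ((k : ℝ≥0) + 1)⌉₊
    have hmK : ∀ ω, m k ω ≤ K := fun ω => Nat.ceil_mono (by gcongr; exact hT ω)
    have h1 : ∀ ω, N (grid k (m k ω)) ω = N 0 ω + ∑ i ∈ Finset.range K,
        {ω | τ ω ≤ grid k i}ᶜ.indicator (fun ω => N (grid k (i + 1)) ω - N (grid k i) ω) ω := by
      intro ω
      have := sum_range_ite_telescope (fun i => N (grid k i) ω) (m k ω) K (hmK ω)
      have h0 : grid k 0 = 0 := by simp [hgrid]
      rw [h0] at this
      rw [show N (grid k (m k ω)) ω = N 0 ω + (N (grid k (m k ω)) ω - N 0 ω) by ring, ← this]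
      congr 1
      refine Finset.sum_congr rfl fun i _ => ?_
      simp only [indicator, mem_compl_iff, mem_ofPred_eq, not_le, hlt]
    simp_rw [h1]
    have hms : ∀ i, MeasurableSet {ω | τ ω ≤ grid k i} := fun i => hF _ _ (hτ _)
    rw [integral_add (hint 0), integral_finsetSum]
    · rw [Finset.sum_eq_zero, add_zero]
      intro i _
      rw [integral_indicator (hms i).compl, integral_sub (hint _).integrableOn (hint _).integrableOn,
        sub_eq_zero]
      refine hmart _ _ ?_ _ (hτ _).compl
      simp only [hgrid]
      gcongr
      simp
    · exact fun i _ => ((hint _).sub (hint _)).indicator (hms i).compl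
    · exact integrable_finsetSum _ fun i _ => ((hint _).sub (hint _)).indicator (hms i).compl
  have hlim : Tendsto (fun k => ∫ ω, N (grid k (m k ω)) ω ∂P) atTop (𝓝 (∫ ω, N (τ ω) ω ∂P)) := by
    refine tendsto_integral_of_dominated_convergence (fun _ => C) (fun k => ?_) (by simp)
      (fun k => ae_of_all _ fun ω => ?_) (ae_of_all _ fun ω => ?_)
    · refine (measurable_eval_time hc hm ?_).aestronglyMeasurable
      have : Measurable (m k) := Nat.measurable_ceil.comp (hτm.mul_const _)
      exact (measurable_from_nat.comp this : Measurable ((grid k) ∘ (m k)))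
    · refine hC _ ?_ ω
      rw [hgrid, div_le_iff₀ (hk0 k)]
      refine (Nat.ceil_lt_add_one (by positivity)).le.trans ?_
      rw [add_mul]
      gcongr
      · exact hT ω
      · rw [one_mul]; simp
    · refine ((hc ω).tendsto _).comp ?_
      have h1 : Tendsto (fun k : ℕ => τ ω + 1 / ((k : ℝ≥0) + 1)) atTop (𝓝 (τ ω)) := by
        simpa using tendsto_const_nhds.add (tendsto_one_div_add_atTop_nhds_zero_nat (𝕜 := ℝ≥0))
      refine tendsto_of_tendsto_of_tendsto_of_le_of_le tendsto_const_nhds h1 (fun k => ?_)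
        (fun k => ?_)
      · simp only [hgrid, hmdef]
        rw [le_div_iff₀ (hk0 k)]
        exact Nat.le_ceil _
      · simp only [hgrid, hmdef]
        rw [div_le_iff₀ (hk0 k), add_mul, one_div, inv_mul_cancel₀ (hk0 k).ne']
        exact (Nat.ceil_lt_add_one (by positivity)).le
  simp_rw [hstep] at hlim
  exact (tendsto_nhds_unique hlim tendsto_const_nhds)

lemma HasDrift.integrable [IsFiniteMeasure P] (h : HasDrift F P Y D) (t : ℝ≥0) :
    Integrable (Y t) P := by
  obtain ⟨C, hC⟩ := h.bdd t
  exact Integrable.of_bound (C := C) (h.meas t).aestronglyMeasurable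
    (ae_of_all _ fun ω => hC t le_rfl ω)

lemma HasDrift.measurable_stopped (h : HasDrift F P Y D) {τ : Ω → ℝ≥0}
    (hτ : ∀ t, MeasurableSet[F t] {ω | τ ω ≤ t}) : Measurable (fun ω => Y (τ ω) ω) :=
  measurable_eval_time h.cont h.meas (measurable_of_Iic fun t => h.le t _ (hτ t))

lemma HasDrift.integrable_stopped [IsFiniteMeasure P] (h : HasDrift F P Y D) {τ : Ω → ℝ≥0}
    {T : ℝ≥0} (hT : ∀ ω, τ ω ≤ T) (hτ : ∀ t, MeasurableSet[F t] {ω | τ ω ≤ t}) :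
    Integrable (fun ω => Y (τ ω) ω) P := by
  obtain ⟨C, hC⟩ := h.bdd T
  exact Integrable.of_bound (C := C) (h.measurable_stopped hτ).aestronglyMeasurable
    (ae_of_all _ fun ω => hC _ (hT ω) ω)

lemma HasDrift.integrable_drift_stopped [IsFiniteMeasure P] (h : HasDrift F P Y D) {τ : Ω → ℝ≥0}
    {T : ℝ≥0} (hT : ∀ ω, τ ω ≤ T) (hτ : ∀ t, MeasurableSet[F t] {ω | τ ω ≤ t}) :
    Integrable (fun ω => ∫ u in (0 : ℝ)..τ ω, D u ω) P := by
  obtain ⟨C, hC⟩ := h.bdd_drift T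
  refine Integrable.of_bound (C := C * T) ?_ (ae_of_all _ fun ω =>
    abs_intervalIntegral_path_le hC (hT ω) ω)
  exact (measurable_eval_time (Z := fun t ω => ∫ u in (0 : ℝ)..t, D u ω)
    (continuous_intervalIntegral_path h.cont_drift)
    (fun t => measurable_intervalIntegral_path h.cont_drift h.meas_drift t)
    (measurable_of_Iic fun t => h.le t _ (hτ t))).aestronglyMeasurable

lemma HasDrift.integral_stopped [IsFiniteMeasure P] (h : HasDrift F P Y D) {τ : Ω → ℝ≥0}
    {T : ℝ≥0} (hT : ∀ ω, τ ω ≤ T) (hτ : ∀ t, MeasurableSet[F t] {ω | τ ω ≤ t}) :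
    ∫ ω, Y (τ ω) ω ∂P = ∫ ω, Y 0 ω ∂P + ∫ ω, (∫ u in (0 : ℝ)..τ ω, D u ω) ∂P := by
  have hi : ∀ t : ℝ≥0, Integrable (fun ω => ∫ u in (0 : ℝ)..t, D u ω) P := fun t => by
    obtain ⟨C, hC⟩ := h.bdd_drift t
    exact Integrable.of_bound (C := C * t)
      (measurable_intervalIntegral_path h.cont_drift h.meas_drift t).aestronglyMeasurable
      (ae_of_all _ fun ω => abs_intervalIntegral_path_le hC le_rfl ω)
  have key := integral_stopped_eq (P := P) (N := fun t ω => Y t ω - ∫ u in (0 : ℝ)..t, D u ω) h.le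
    (fun ω => (h.cont ω).sub (continuous_intervalIntegral_path h.cont_drift ω))
    (fun t => (h.meas t).sub (measurable_intervalIntegral_path h.cont_drift h.meas_drift t))
    (fun T => ?_) (fun s t hst A hA => ?_) hT hτ
  · rw [integral_sub (h.integrable_stopped hT hτ) (h.integrable_drift_stopped hT hτ)] at key
    simp only [NNReal.coe_zero, intervalIntegral.integral_same, sub_zero] at key
    linarith
  · obtain ⟨C, hC⟩ := h.bdd T
    obtain ⟨C', hC'⟩ := h.bdd_drift T
    exact ⟨C + C' * T, fun t ht ω => (abs_sub _ _).trans
      (add_le_add (hC t ht ω) (abs_intervalIntegral_path_le hC' ht ω))⟩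
  · rw [integral_sub (h.integrable t).integrableOn (hi t).integrableOn,
      integral_sub (h.integrable s).integrableOn (hi s).integrableOn]
    have h1 := h.mart s t hst A hA
    obtain ⟨C, hC⟩ := h.bdd_drift t
    have hst' : (s : ℝ) ≤ t := by exact_mod_cast hst
    rw [← setIntegral_intervalIntegral_swap h.cont_drift h.meas_drift (C := C) hst'
      (fun u hu ω => hC u ⟨(by simp : (0 : ℝ) ≤ s).trans hu.1, hu.2⟩ ω)] at h1
    have h2 : ∫ ω in A, (∫ u in (s : ℝ)..t, D u ω) ∂P = ∫ ω in A, (∫ u in (0 : ℝ)..t, D u ω) ∂P -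
        ∫ ω in A, (∫ u in (0 : ℝ)..s, D u ω) ∂P := by
      rw [← integral_sub (hi t).integrableOn (hi s).integrableOn]
      congr with ω
      rw [intervalIntegral.integral_interval_sub_left]
      · exact (h.cont_drift ω).intervalIntegrable _ _
      · exact (h.cont_drift ω).intervalIntegrable _ _
    linarith

/-- If the drift is nonpositive between two bounded stopping times, the expectation decreases. -/
lemma HasDrift.integral_le_of_drift_nonpos [IsFiniteMeasure P] (h : HasDrift F P Y D)
    {σ τ : Ω → ℝ≥0} {T : ℝ≥0} (hστ : ∀ ω, σ ω ≤ τ ω) (hT : ∀ ω, τ ω ≤ T)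
    (hσ : ∀ t, MeasurableSet[F t] {ω | σ ω ≤ t}) (hτ : ∀ t, MeasurableSet[F t] {ω | τ ω ≤ t})
    (hD : ∀ᵐ ω ∂P, ∀ u : ℝ≥0, σ ω < u → u < τ ω → D u ω ≤ 0) :
    ∫ ω, Y (τ ω) ω ∂P ≤ ∫ ω, Y (σ ω) ω ∂P := by
  have hT' : ∀ ω, σ ω ≤ T := fun ω => (hστ ω).trans (hT ω)
  rw [h.integral_stopped hT hτ, h.integral_stopped hT' hσ]
  refine add_le_add_right (integral_mono_ae (h.integrable_drift_stopped hT hτ)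
    (h.integrable_drift_stopped hT' hσ) ?_) _
  filter_upwards [hD] with ω hω
  have hi : ∀ a b, IntervalIntegrable (fun u => D u ω) volume a b := fun a b =>
    (h.cont_drift ω).intervalIntegrable _ _
  have h1 := intervalIntegral.integral_add_adjacent_intervals (hi 0 (σ ω)) (hi (σ ω) (τ ω))
  have hle : (σ ω : ℝ) ≤ τ ω := by exact_mod_cast hστ ω
  have h2 : ∫ u in (σ ω : ℝ)..τ ω, D u ω ≤ 0 := by
    rw [intervalIntegral.integral_of_le hle, integral_Ioc_eq_integral_Ioo]
    refine setIntegral_nonpos measurableSet_Ioo fun u hu => ?_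
    have hu0 : 0 ≤ u := (by simp : (0 : ℝ) ≤ σ ω).trans hu.1.le
    lift u to ℝ≥0 using hu0
    exact hω u (by exact_mod_cast hu.1) (by exact_mod_cast hu.2)
  linarith

lemma HasDrift.add [IsFiniteMeasure P] (h : HasDrift F P Y D) (h' : HasDrift F P Y' D') :
    HasDrift F P (fun t ω => Y t ω + Y' t ω) (fun u ω => D u ω + D' u ω) where
  le := h.le
  cont ω := (h.cont ω).add (h'.cont ω)
  meas t := (h.meas t).add (h'.meas t)
  bdd T := by
    obtain ⟨C, hC⟩ := h.bdd T
    obtain ⟨C', hC'⟩ := h'.bdd T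
    exact ⟨C + C', fun t ht ω => (abs_add_le _ _).trans (add_le_add (hC t ht ω) (hC' t ht ω))⟩
  cont_drift ω := (h.cont_drift ω).add (h'.cont_drift ω)
  meas_drift t := (h.meas_drift t).add (h'.meas_drift t)
  bdd_drift T := by
    obtain ⟨C, hC⟩ := h.bdd_drift T
    obtain ⟨C', hC'⟩ := h'.bdd_drift T
    exact ⟨C + C', fun t ht ω => (abs_add_le _ _).trans (add_le_add (hC t ht ω) (hC' t ht ω))⟩
  mart s t hst A hA := by
    have hst' : (s : ℝ) ≤ t := by exact_mod_cast hst
    rw [integral_add (h.integrable t).integrableOn (h'.integrable t).integrableOn,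
      integral_add (h.integrable s).integrableOn (h'.integrable s).integrableOn]
    have aux : ∀ {Y : ℝ≥0 → Ω → ℝ} {D : ℝ → Ω → ℝ}, HasDrift F P Y D →
        (∀ u ∈ Icc (s : ℝ) t, IntegrableOn (D u) A P) ∧
        IntervalIntegrable (fun u => ∫ ω in A, D u ω ∂P) volume s t := by
      intro Y D h
      obtain ⟨C, hC⟩ := h.bdd_drift t
      have hb : ∀ u ∈ Icc (s : ℝ) t, ∀ ω, |D u ω| ≤ C := fun u hu ω =>
        hC u ⟨(by simp : (0 : ℝ) ≤ s).trans hu.1, hu.2⟩ ω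
      have h1 : ∀ u ∈ Icc (s : ℝ) t, IntegrableOn (D u) A P := fun u hu =>
        Integrable.of_bound (C := C) (h.meas_drift u).aestronglyMeasurable
          (ae_of_all _ fun ω => hb u hu ω)
      refine ⟨h1, ContinuousOn.intervalIntegrable ?_⟩
      rw [uIcc_of_le hst']
      refine continuousOn_of_dominated (bound := fun _ => C)
        (fun u hu => (h1 u hu).aestronglyMeasurable)
        (fun u hu => ae_of_all _ fun ω => hb u hu ω) (by simp)
        (ae_of_all _ fun ω => (h.cont_drift ω).continuousOn)
    have h1 := aux h
    have h2 := aux h'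
    have h3 : ∫ u in (s : ℝ)..t, ∫ ω in A, (D u ω + D' u ω) ∂P =
        ∫ u in (s : ℝ)..t, ((∫ ω in A, D u ω ∂P) + ∫ ω in A, D' u ω ∂P) := by
      refine intervalIntegral.integral_congr fun u hu => ?_
      rw [uIcc_of_le hst'] at hu
      exact integral_add (h1.1 u hu) (h2.1 u hu)
    rw [h3, intervalIntegral.integral_add h1.2 h2.2, ← h.mart s t hst A hA,
      ← h'.mart s t hst A hA]
    ring

end

/-- A continuous adapted process in the plane which at fixed times has the Markov property of
planar Brownian motion. -/
structure IsPlaneMarkov {Ω : Type*} {mΩ : MeasurableSpace Ω} (F : ℝ≥0 → MeasurableSpace Ω)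
    (P : Measure Ω) (X : ℝ≥0 → Ω → ℝ × ℝ) : Prop where
  le : ∀ t, F t ≤ mΩ
  mono : Monotone F
  adapted : ∀ t, Measurable[F t] (X t)
  cont : ∀ ω, Continuous (X · ω)
  markov : ∀ (s r : ℝ≥0) (A : Set Ω), MeasurableSet[F s] A → ∀ f : ℝ × ℝ → ℝ, Continuous f →
    (∃ C, ∀ z, |f z| ≤ C) →
    ∫ ω in A, f (X (s + r) ω) ∂P = ∫ ω in A, (∫ w, f (X s ω + w) ∂planeGaussian r) ∂P

/-- Dynkin's formula for the functions `a(t) f(z)`. -/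
lemma IsPlaneMarkov.hasDrift {Ω : Type*} {mΩ : MeasurableSpace Ω} {F : ℝ≥0 → MeasurableSpace Ω}
    {P : Measure Ω} [IsFiniteMeasure P] {X : ℝ≥0 → Ω → ℝ × ℝ} (hX : IsPlaneMarkov F P X)
    {f g : ℝ × ℝ → ℝ} (hfg : GenPair f g) {a a' : ℝ → ℝ} (ha : ∀ t, HasDerivAt a (a' t) t)
    (ha' : Continuous a') :
    HasDrift F P (fun t ω => a t * f (X t ω))
      (fun u ω => a' u * f (X u.toNNReal ω) + a u * g (X u.toNNReal ω)) := by
  have hac : Continuous a := continuous_iff_continuousAt.mpr fun t => (ha t).continuousAt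
  have hXm : ∀ t, Measurable (X t) := fun t => (hX.adapted t).mono (hX.le t) le_rfl
  have hf := hfg.cont_fst
  have hg := hfg.cont_snd
  obtain ⟨Cf, hCf⟩ := hfg.bdd_fst
  obtain ⟨Cg, hCg⟩ := hfg.bdd_snd
  have hCf0 : 0 ≤ Cf := (abs_nonneg _).trans (hCf 0)
  have hCg0 : 0 ≤ Cg := (abs_nonneg _).trans (hCg 0)
  have hbnd : ∀ {b : ℝ → ℝ}, Continuous b → ∀ T : ℝ≥0, ∃ C, ∀ t ∈ Icc (0 : ℝ) T, |b t| ≤ C := by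
    intro b hb T
    obtain ⟨C, hC⟩ := (isCompact_Icc (a := (0 : ℝ)) (b := T)).exists_bound_of_continuousOn
      hb.continuousOn
    exact ⟨C, hC⟩
  have hpath : ∀ ω, Continuous (fun u : ℝ => X u.toNNReal ω) := fun ω =>
    (hX.cont ω).comp continuous_real_toNNReal
  refine ⟨hX.le, fun ω => (hac.comp NNReal.continuous_coe).mul (hf.comp (hX.cont ω)),
    fun t => (hf.measurable.comp (hXm t)).const_mul _, fun T => ?_,
    fun ω => (ha'.mul (hf.comp (hpath ω))).add (hac.mul (hg.comp (hpath ω))),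
    fun u => ((hf.measurable.comp (hXm _)).const_mul _).add ((hg.measurable.comp (hXm _)).const_mul _),
    fun T => ?_, fun s t hst A hA => ?_⟩
  · obtain ⟨C, hC⟩ := hbnd hac T
    refine ⟨C * Cf, fun t ht ω => ?_⟩
    have h1 := hC t ⟨by simp, by exact_mod_cast ht⟩
    rw [abs_mul]
    exact mul_le_mul h1 (hCf _) (abs_nonneg _) ((abs_nonneg _).trans h1)
  · obtain ⟨C, hC⟩ := hbnd hac T
    obtain ⟨C', hC'⟩ := hbnd ha' T
    refine ⟨C' * Cf + C * Cg, fun u hu ω => (abs_add_le _ _).trans (add_le_add ?_ ?_)⟩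
    · rw [abs_mul]
      exact mul_le_mul (hC' u hu) (hCf _) (abs_nonneg _) ((abs_nonneg _).trans (hC' u hu))
    · rw [abs_mul]
      exact mul_le_mul (hC u hu) (hCg _) (abs_nonneg _) ((abs_nonneg _).trans (hC u hu))
  · obtain ⟨G, hGc, hG1, hG2⟩ := hfg.semigroup
    set H : ℝ → ℝ × ℝ → ℝ := fun u z => G (max u 0) z with hH
    have hHc : Continuous (Function.uncurry H) :=
      hGc.comp (f := fun x : ℝ × (ℝ × ℝ) => (max x.1 0, x.2)) (by fun_prop)
    have hHb : ∀ u z, |H u z| ≤ Cg := by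
      intro u z
      have : H u z = ∫ w, g (z + w) ∂planeGaussian (max u 0).toNNReal := by
        rw [← hG1, Real.coe_toNNReal _ (le_max_right _ _)]
      rw [this]
      have := norm_integral_le_of_norm_le_const (μ := planeGaussian (max u 0).toNNReal)
        (f := fun w => g (z + w)) (C := Cg) (ae_of_all _ fun w => hCg _)
      simpa using this
    have hHm : ∀ u, Measurable (fun ω => H u (X s ω)) := fun u =>
      (hHc.comp (continuous_const.prodMk continuous_id)).measurable.comp (hXm s)
    have hHpath : ∀ ω, Continuous (fun u => H u (X s ω)) := fun ω =>
      hHc.comp (continuous_id.prodMk continuous_const)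
    set Γ : ℝ → ℝ := fun u => ∫ ω in A, H u (X s ω) ∂P with hΓ
    have hΓc : Continuous Γ := by
      refine continuous_of_dominated (bound := fun _ => Cg)
        (fun u => (hHm u).aestronglyMeasurable)
        (fun u => ae_of_all _ fun ω => hHb _ _) (by simp) (ae_of_all _ hHpath)
    have hintf : ∀ r, IntegrableOn (fun ω => f (X r ω)) A P := fun r =>
      Integrable.of_bound (C := Cf) (hf.measurable.comp (hXm r)).aestronglyMeasurable
        (ae_of_all _ fun ω => hCf _)
    have hintg : ∀ r, IntegrableOn (fun ω => g (X r ω)) A P := fun r =>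
      Integrable.of_bound (C := Cg) (hg.measurable.comp (hXm r)).aestronglyMeasurable
        (ae_of_all _ fun ω => hCg _)
    have hgΓ : ∀ r : ℝ≥0, ∫ ω in A, g (X (s + r) ω) ∂P = Γ r := by
      intro r
      rw [hX.markov s r A hA g hg hfg.bdd_snd, hΓ]
      simp only [hH, max_eq_left r.coe_nonneg, hG1]
    -- `Φ v` and `Γ v` are the integrals over `A` of f and g at time s + v. Since Φ' = Γ, the
    -- formula with the factor a(t) is the product rule and the fundamental theorem of calculus.
    set Φ : ℝ → ℝ := fun v => (∫ ω in A, f (X s ω) ∂P) + ∫ u in (0 : ℝ)..v, Γ u with hΦ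
    have hfΦ : ∀ r : ℝ≥0, ∫ ω in A, f (X (s + r) ω) ∂P = Φ r := by
      intro r
      rw [hX.markov s r A hA f hf hfg.bdd_fst, hΦ, hΓ]
      simp only [hG2]
      rw [← setIntegral_intervalIntegral_swap hHpath hHm (C := Cg) r.coe_nonneg
        (fun u _ ω => hHb _ _), ← integral_add (hintf s)]
      · refine integral_congr_ae (ae_of_all _ fun ω => ?_)
        simp only [add_right_inj]
        refine intervalIntegral.integral_congr fun u hu => ?_
        rw [uIcc_of_le r.coe_nonneg] at hu
        simp only [hH, max_eq_left hu.1]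
      · refine Integrable.of_bound (C := Cg * r) ?_ (ae_of_all _ fun ω =>
          abs_intervalIntegral_path_le (fun u _ ω => hHb _ _) le_rfl ω)
        exact (measurable_intervalIntegral_path hHpath hHm r).aestronglyMeasurable
    have hderiv : ∀ v, HasDerivAt (fun v => a (s + v) * Φ v) (a' (s + v) * Φ v + a (s + v) * Γ v) v := by
      intro v
      have h1 : HasDerivAt Φ (Γ v) v :=
        (hΓc.integral_hasStrictDerivAt 0 v).hasDerivAt.const_add _
      exact ((ha _).comp_const_add _ _).mul h1
    have hΦc : Continuous Φ := continuous_const.add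
      (intervalIntegral.continuous_primitive (fun _ _ => hΓc.intervalIntegrable _ _) 0)
    have hftc := intervalIntegral.integral_eq_sub_of_hasDerivAt (a := 0) (b := ((t - s : ℝ≥0) : ℝ))
      (fun v _ => hderiv v) (Continuous.intervalIntegrable (by fun_prop) _ _)
    have hrhs : ∫ u in (s : ℝ)..t, ∫ ω in A,
        (a' u * f (X u.toNNReal ω) + a u * g (X u.toNNReal ω)) ∂P =
        ∫ v in (0 : ℝ)..(t - s : ℝ≥0), (a' (s + v) * Φ v + a (s + v) * Γ v) := by
      have e := intervalIntegral.integral_comp_add_left (a := 0) (b := ((t - s : ℝ≥0) : ℝ))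
        (fun u => ∫ ω in A, (a' u * f (X u.toNNReal ω) + a u * g (X u.toNNReal ω)) ∂P) (s : ℝ)
      rw [NNReal.coe_sub hst, add_zero, add_sub_cancel] at e
      rw [← e, NNReal.coe_sub hst]
      refine intervalIntegral.integral_congr fun v hv => ?_
      have hst' : (s : ℝ) ≤ t := by exact_mod_cast hst
      rw [uIcc_of_le (by linarith)] at hv
      have hv0 := hv.1
      lift v to ℝ≥0 using hv0
      rw [← NNReal.coe_add, Real.toNNReal_coe, ← hgΓ, ← hfΦ, integral_add ((hintf _).const_mul _)
        ((hintg _).const_mul _), integral_const_mul, integral_const_mul]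
    rw [hrhs, hftc, integral_const_mul, integral_const_mul, ← hfΦ, add_tsub_cancel_of_le hst,
      NNReal.coe_sub hst]
    simp [hΦ]

/-! ### The Markov property of planar Brownian motion at fixed times -/

lemma generateFrom_image2_preimage_prod {Ω A B : Type*} [MeasurableSpace A] [MeasurableSpace B]
    (U : Ω → A) (V : Ω → B) :
    MeasurableSpace.generateFrom {s : Set Ω | ∃ a b, MeasurableSet a ∧ MeasurableSet b ∧
      s = U ⁻¹' a ∩ V ⁻¹' b} =
    MeasurableSpace.comap (fun ω => (U ω, V ω)) inferInstance := by
  rw [← generateFrom_prod, MeasurableSpace.comap_generateFrom]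
  congr 1
  ext s
  constructor
  · rintro ⟨a, b, ha, hb, rfl⟩
    exact ⟨a ×ˢ b, ⟨a, ha, b, hb, rfl⟩, rfl⟩
  · rintro ⟨_, ⟨a, ha, b, hb, rfl⟩, rfl⟩
    exact ⟨a, b, ha, hb, rfl⟩

lemma isPiSystem_preimage_inter {Ω A B : Type*} [MeasurableSpace A] [MeasurableSpace B]
    (U : Ω → A) (V : Ω → B) :
    IsPiSystem {s : Set Ω | ∃ a b, MeasurableSet a ∧ MeasurableSet b ∧
      s = U ⁻¹' a ∩ V ⁻¹' b} := by
  rintro _ ⟨a, b, ha, hb, rfl⟩ _ ⟨c, d, hc, hd, rfl⟩ _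
  refine ⟨a ∩ c, b ∩ d, ha.inter hc, hb.inter hd, ?_⟩
  ext ω
  simp only [mem_inter_iff, mem_preimage]
  tauto

/-- On rectangles the four events can be regrouped; rectangles form a generating π-system. It serves
to combine past and future of the two coordinates. -/
lemma IndepFun.prodMk_prodMk_of_pairs {Ω A B C D : Type*} {mΩ : MeasurableSpace Ω}
    {P : Measure Ω} [IsProbabilityMeasure P] [MeasurableSpace A] [MeasurableSpace B]
    [MeasurableSpace C] [MeasurableSpace D] {U₀ : Ω → A} {U₁ : Ω → B} {V₀ : Ω → C} {V₁ : Ω → D}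
    (hU₀ : Measurable U₀) (hU₁ : Measurable U₁) (hV₀ : Measurable V₀) (hV₁ : Measurable V₁)
    (h₀ : IndepFun U₀ V₀ P) (h₁ : IndepFun U₁ V₁ P)
    (h : IndepFun (fun ω => (U₀ ω, V₀ ω)) (fun ω => (U₁ ω, V₁ ω)) P) :
    IndepFun (fun ω => (U₀ ω, U₁ ω)) (fun ω => (V₀ ω, V₁ ω)) P := by
  unfold IndepFun Kernel.IndepFun
  rw [← generateFrom_image2_preimage_prod, ← generateFrom_image2_preimage_prod]
  refine IndepSets.indep' ?_ ?_ (isPiSystem_preimage_inter _ _) (isPiSystem_preimage_inter _ _) ?_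
  · rintro _ ⟨a, b, ha, hb, rfl⟩
    exact (hU₀ ha).inter (hU₁ hb)
  · rintro _ ⟨a, b, ha, hb, rfl⟩
    exact (hV₀ ha).inter (hV₁ hb)
  · rw [IndepSets_iff]
    rintro _ _ ⟨a, b, ha, hb, rfl⟩ ⟨c, d, hc, hd, rfl⟩
    have hU : IndepFun U₀ U₁ P := h.comp measurable_fst measurable_fst
    have hV : IndepFun V₀ V₁ P := h.comp measurable_snd measurable_snd
    have e : (U₀ ⁻¹' a ∩ U₁ ⁻¹' b) ∩ (V₀ ⁻¹' c ∩ V₁ ⁻¹' d) =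
        (fun ω => (U₀ ω, V₀ ω)) ⁻¹' (a ×ˢ c) ∩ (fun ω => (U₁ ω, V₁ ω)) ⁻¹' (b ×ˢ d) := by
      ext ω
      simp only [mem_inter_iff, mem_preimage, mem_prod]
      tauto
    rw [e, h.measure_inter_preimage_eq_mul _ _ (ha.prod hc) (hb.prod hd),
      hU.measure_inter_preimage_eq_mul _ _ ha hb, hV.measure_inter_preimage_eq_mul _ _ hc hd]
    have e1 : (fun ω => (U₀ ω, V₀ ω)) ⁻¹' (a ×ˢ c) = U₀ ⁻¹' a ∩ V₀ ⁻¹' c := rfl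
    have e2 : (fun ω => (U₁ ω, V₁ ω)) ⁻¹' (b ×ˢ d) = U₁ ⁻¹' b ∩ V₁ ⁻¹' d := rfl
    rw [e1, e2, h₀.measure_inter_preimage_eq_mul _ _ ha hc,
      h₁.measure_inter_preimage_eq_mul _ _ hb hd]
    ring

section

variable {Ω : Type*} {mΩ : MeasurableSpace Ω} {P : Measure Ω}

/-- The past up to time `s` of a process with two real coordinates. -/
def pastMap (b : Fin 2 → ℝ≥0 → Ω → ℝ) (s : ℝ≥0) (ω : Ω) :
    (Iic s → ℝ) × (Iic s → ℝ) := (fun u => b 0 u ω, fun u => b 1 u ω)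

/-- The natural filtration of a process with two real coordinates. -/
abbrev pastFiltration (b : Fin 2 → ℝ≥0 → Ω → ℝ) (s : ℝ≥0) : MeasurableSpace Ω :=
  MeasurableSpace.comap (pastMap b s) inferInstance

/-- The planar increment after time s is independent of the joint past and has law `planeGaussian
r`; Fubini on the product law gives the Markov identity. -/
lemma isPlaneMarkov_of_isPreBrownianReal [IsProbabilityMeasure P] {b : Fin 2 → ℝ≥0 → Ω → ℝ}
    (hm : ∀ i t, Measurable (b i t)) (hc : ∀ i ω, Continuous (b i · ω))
    (hb : ∀ i, IsPreBrownianReal (b i) P)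
    (hi : IndepFun (fun ω (t : ℝ≥0) => b 0 t ω) (fun ω (t : ℝ≥0) => b 1 t ω) P) (z : ℝ × ℝ) :
    IsPlaneMarkov (pastFiltration b) P (fun t ω => (z.1 + b 0 t ω, z.2 + b 1 t ω)) := by
  have hpm : ∀ s, Measurable (pastMap b s) := fun s =>
    (measurable_pi_lambda _ fun u => hm 0 _).prodMk (measurable_pi_lambda _ fun u => hm 1 _)
  refine ⟨fun t => (hpm t).comap_le, fun s t hst => ?_, fun t => ?_, fun ω => ?_,
    fun s r A hA f hf hfb => ?_⟩
  · have : pastMap b s = (fun x : (Iic t → ℝ) × (Iic t → ℝ) =>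
        ((fun u : Iic s => x.1 ⟨u, le_trans u.2 hst⟩), (fun u : Iic s => x.2 ⟨u, le_trans u.2 hst⟩)))
        ∘ pastMap b t := rfl
    unfold pastFiltration
    rw [this, ← MeasurableSpace.comap_comp]
    refine MeasurableSpace.comap_mono (Measurable.comap_le ?_)
    refine Measurable.prodMk ?_ ?_
    · exact measurable_pi_lambda _ fun u => (measurable_pi_apply _).comp measurable_fst
    · exact measurable_pi_lambda _ fun u => (measurable_pi_apply _).comp measurable_snd
  · have h : Measurable (fun x : (Iic t → ℝ) × (Iic t → ℝ) =>
        (z.1 + x.1 ⟨t, mem_Iic.mpr le_rfl⟩, z.2 + x.2 ⟨t, mem_Iic.mpr le_rfl⟩)) := by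
      refine Measurable.prodMk ?_ ?_
      · exact ((measurable_pi_apply _).comp measurable_fst).const_add _
      · exact ((measurable_pi_apply _).comp measurable_snd).const_add _
    exact h.comp (comap_measurable (pastMap b t))
  · exact (continuous_const.add (hc 0 ω)).prodMk (continuous_const.add (hc 1 ω))
  · obtain ⟨A', hA', rfl⟩ := hA
    set I : Ω → ℝ × ℝ := fun ω => (b 0 (s + r) ω - b 0 s ω, b 1 (s + r) ω - b 1 s ω) with hI
    have hIm : Measurable I := ((hm 0 _).sub (hm 0 _)).prodMk ((hm 1 _).sub (hm 1 _))
    have hUV : ∀ i, IndepFun (fun ω (u : Iic s) => b i u ω) (fun ω => b i (s + r) ω - b i s ω) P :=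
      fun i => (((hb i).indepFun_shift s).comp (φ := fun x : ℝ≥0 → ℝ => x r)
        (measurable_pi_apply r) measurable_id).symm
    have hpair : Measurable (fun x : ℝ≥0 → ℝ => ((fun u : Iic s => x u), x (s + r) - x s)) :=
      (measurable_pi_lambda _ fun u => measurable_pi_apply _).prodMk
        ((measurable_pi_apply _).sub (measurable_pi_apply _))
    have hind : IndepFun (pastMap b s) I P :=
      IndepFun.prodMk_prodMk_of_pairs (measurable_pi_lambda _ fun u => hm 0 _)
        (measurable_pi_lambda _ fun u => hm 1 _) ((hm 0 _).sub (hm 0 _)) ((hm 1 _).sub (hm 1 _))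
        (hUV 0) (hUV 1) (hi.comp hpair hpair)
    have hlaw : P.map I = planeGaussian r := by
      have h1 : ∀ i, P.map (fun ω => b i (s + r) ω - b i s ω) = gaussianReal 0 r := fun i =>
        (((hb i).shift s).hasLaw_eval r).map_eq
      have h2 : IndepFun (fun ω => b 0 (s + r) ω - b 0 s ω) (fun ω => b 1 (s + r) ω - b 1 s ω) P :=
        hi.comp (φ := fun x : ℝ≥0 → ℝ => x (s + r) - x s) (ψ := fun x : ℝ≥0 → ℝ => x (s + r) - x s)
          ((measurable_pi_apply _).sub (measurable_pi_apply _))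
          ((measurable_pi_apply _).sub (measurable_pi_apply _))
      have h3 := (indepFun_iff_map_prod_eq_prod_map_map (f := fun ω => b 0 (s + r) ω - b 0 s ω)
        (g := fun ω => b 1 (s + r) ω - b 1 s ω) ((hm 0 _).sub (hm 0 _)).aemeasurable
        ((hm 1 _).sub (hm 1 _)).aemeasurable).mp h2
      rw [hI, h3, h1, h1, planeGaussian]
    rw [indepFun_iff_map_prod_eq_prod_map_map (hpm s).aemeasurable hIm.aemeasurable, hlaw] at hind
    set Zs : (Iic s → ℝ) × (Iic s → ℝ) → ℝ × ℝ :=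
      fun x => (z.1 + x.1 ⟨s, mem_Iic.mpr le_rfl⟩, z.2 + x.2 ⟨s, mem_Iic.mpr le_rfl⟩) with hZs
    have hZm : Measurable Zs := by
      refine Measurable.prodMk ?_ ?_
      · exact ((measurable_pi_apply _).comp measurable_fst).const_add _
      · exact ((measurable_pi_apply _).comp measurable_snd).const_add _
    set h : ((Iic s → ℝ) × (Iic s → ℝ)) × (ℝ × ℝ) → ℝ := fun x =>
      A'.indicator (fun y => f (Zs y + x.2)) x.1 with hh
    have hhm : Measurable h := by
      have h1 : Measurable (fun x : ((Iic s → ℝ) × (Iic s → ℝ)) × (ℝ × ℝ) => f (Zs x.1 + x.2)) :=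
        hf.measurable.comp ((hZm.comp measurable_fst).add measurable_snd)
      exact h1.indicator (measurable_fst hA')
    obtain ⟨C, hC⟩ := hfb
    have hC0 : 0 ≤ C := (abs_nonneg _).trans (hC 0)
    have hhb : ∀ x, ‖h x‖ ≤ C := fun x => by
      simp only [hh, indicator]
      split_ifs
      · exact hC _
      · simpa using hC0
    have hAm : MeasurableSet (pastMap b s ⁻¹' A') := hpm s hA'
    calc ∫ ω in pastMap b s ⁻¹' A', f (z.1 + b 0 (s + r) ω, z.2 + b 1 (s + r) ω) ∂P
        = ∫ ω, h (pastMap b s ω, I ω) ∂P := by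
          rw [← integral_indicator hAm]
          refine integral_congr_ae (ae_of_all _ fun ω => ?_)
          have : Zs (pastMap b s ω) + I ω = (z.1 + b 0 (s + r) ω, z.2 + b 1 (s + r) ω) := by
            simp only [hZs, pastMap, hI, Prod.mk_add_mk]
            congr 1 <;> ring
          by_cases hω : pastMap b s ω ∈ A'
          · rw [indicator_of_mem (show ω ∈ pastMap b s ⁻¹' A' from hω)]
            simp only [hh, indicator_of_mem hω, this]
          · rw [indicator_of_notMem (show ω ∉ pastMap b s ⁻¹' A' from hω)]
            simp only [hh, indicator_of_notMem hω]
      _ = ∫ x, h x ∂((P.map (pastMap b s)).prod (planeGaussian r)) := by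
          rw [← hind, integral_map ((hpm s).prodMk hIm).aemeasurable hhm.aestronglyMeasurable]
      _ = ∫ y, ∫ w, h (y, w) ∂planeGaussian r ∂(P.map (pastMap b s)) := by
          have := Measure.isProbabilityMeasure_map (μ := P) (hpm s).aemeasurable
          exact integral_prod _ (Integrable.of_bound hhm.aestronglyMeasurable C (ae_of_all _ hhb))
      _ = ∫ ω, ∫ w, h (pastMap b s ω, w) ∂planeGaussian r ∂P := by
          rw [integral_map (hpm s).aemeasurable]
          exact (hhm.stronglyMeasurable.integral_prod_right').aestronglyMeasurable
      _ = _ := by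
          rw [← integral_indicator hAm]
          refine integral_congr_ae (ae_of_all _ fun ω => ?_)
          by_cases hω : pastMap b s ω ∈ A'
          · rw [indicator_of_mem (show ω ∈ pastMap b s ⁻¹' A' from hω)]
            simp only [hh, indicator_of_mem hω]
            rfl
          · rw [indicator_of_notMem (show ω ∉ pastMap b s ⁻¹' A' from hω)]
            simp only [hh, indicator_of_notMem hω, integral_zero]

/-- Planar Brownian motion started at `z` has a version which is continuous and Markov. -/
lemma IsPlanarBrownian.exists_isPlaneMarkov [IsProbabilityMeasure P] {B : ℝ≥0 → Ω → Plane}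
    (hB : IsPlanarBrownian B P) (z : ℝ × ℝ) :
    ∃ (F : ℝ≥0 → MeasurableSpace Ω) (X : ℝ≥0 → Ω → ℝ × ℝ), IsPlaneMarkov F P X ∧
      (∀ ω, X 0 ω = z) ∧ ∀ᵐ ω ∂P, ∀ t, X t ω = (z.1 + B t ω 0, z.2 + B t ω 1) := by
  set D : ℕ → ℝ≥0 := TopologicalSpace.denseSeq ℝ≥0 with hD
  have hae : ∀ i t, AEMeasurable (fun ω => B t ω i) P := fun i t => (hB.coord i).aemeasurable t
  have hgood : ∀ᵐ ω ∂P, ∀ i : Fin 2, Continuous (fun t => B t ω i) ∧ B 0 ω i = 0 ∧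
      ∀ k, B (D k) ω i = (hae i (D k)).mk _ ω := by
    rw [ae_all_iff]
    intro i
    have h1 : ∀ᵐ ω ∂P, ∀ k, B (D k) ω i = (hae i (D k)).mk _ ω :=
      ae_all_iff.mpr fun k => (hae i (D k)).ae_eq_mk
    filter_upwards [(hB.coord i).cont, (hB.coord i).eval_zero_ae_eq_zero, h1] with ω a b c
    exact ⟨a, b, c⟩
  -- The given process is continuous only almost surely and measurable only up to null sets. Setting
  -- it to 0 on a measurable null set `N` makes every path continuous; measurability along a dense
  -- sequence of times then extends to all times by limits.
  obtain ⟨N, hN, hNm, hN0⟩ := exists_measurable_superset_of_null (ae_iff.mp hgood)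
  have hNc : ∀ ω ∉ N, ∀ i : Fin 2, Continuous (fun t => B t ω i) ∧ B 0 ω i = 0 ∧
      ∀ k, B (D k) ω i = (hae i (D k)).mk _ ω := by
    intro ω hω
    by_contra h
    exact hω (hN h)
  have hNae : ∀ᵐ ω ∂P, ω ∉ N := measure_eq_zero_iff_ae_notMem.mp hN0
  set b : Fin 2 → ℝ≥0 → Ω → ℝ := fun i t => Nᶜ.indicator (fun ω => B t ω i) with hb
  have hbeq : ∀ ω ∉ N, ∀ i t, b i t ω = B t ω i := fun ω hω i t => by
    simp only [hb, indicator, mem_compl_iff, hω, not_false_eq_true, if_true]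
  have hbN : ∀ ω ∈ N, ∀ i t, b i t ω = 0 := fun ω hω i t => by
    simp only [hb, indicator, mem_compl_iff, hω, not_true, if_false]
  have hc : ∀ i ω, Continuous (b i · ω) := by
    intro i ω
    by_cases hω : ω ∈ N
    · simp only [hbN ω hω]; exact continuous_const
    · simp only [hbeq ω hω]; exact (hNc ω hω i).1
  have hmD : ∀ i k, Measurable (b i (D k)) := by
    intro i k
    have : b i (D k) = Nᶜ.indicator ((hae i (D k)).mk _) := by
      funext ω
      by_cases hω : ω ∈ N
      · simp [hb, hω]
      · simp [hb, hω, (hNc ω hω i).2.2 k]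
    rw [this]
    exact (hae i (D k)).measurable_mk.indicator hNm.compl
  have hm : ∀ i t, Measurable (b i t) := by
    intro i t
    obtain ⟨u, hu, hut⟩ := mem_closure_iff_seq_limit.mp
      ((TopologicalSpace.denseRange_denseSeq ℝ≥0) t)
    choose k hk using hu
    refine measurable_of_tendsto_metrizable (f := fun n => b i (u n)) (fun n => ?_) ?_
    · rw [← hk n]; exact hmD i (k n)
    · exact tendsto_pi_nhds.mpr fun ω => ((hc i ω).tendsto t).comp hut
  have hpre : ∀ i, IsPreBrownianReal (b i) P := fun i =>
    (hB.coord i).toIsPreBrownianReal.congr fun t => by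
      filter_upwards [hNae] with ω hω
      exact (hbeq ω hω i t).symm
  have hind : IndepFun (fun ω (t : ℝ≥0) => b 0 t ω) (fun ω (t : ℝ≥0) => b 1 t ω) P := by
    refine hB.indep.congr ?_ ?_
    · filter_upwards [hNae] with ω hω
      funext t
      exact (hbeq ω hω 0 t).symm
    · filter_upwards [hNae] with ω hω
      funext t
      exact (hbeq ω hω 1 t).symm
  refine ⟨pastFiltration b, _, isPlaneMarkov_of_isPreBrownianReal hm hc hpre hind z, fun ω => ?_, ?_⟩
  · have : ∀ i, b i 0 ω = 0 := fun i => by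
      by_cases hω : ω ∈ N
      · exact hbN ω hω i 0
      · rw [hbeq ω hω]; exact (hNc ω hω i).2.1
    simp [this]
  · filter_upwards [hNae] with ω hω t
    rw [hbeq ω hω, hbeq ω hω]

end

/-! ### Hitting times of a real path -/

/-- The first time not before `s` at which the real path `q` is in `S`. -/
def levelHit (q : ℝ≥0 → ℝ) (S : Set ℝ) (s : ℝ≥0∞) : ℝ≥0∞ :=
  ⨅ (u : ℝ≥0) (_ : s ≤ (u : ℝ≥0∞) ∧ q u ∈ S), (u : ℝ≥0∞)

/-- The time at which the path `q` completes its `n`-th passage from the level `c` to above the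
level `d`. -/
def levelExc (q : ℝ≥0 → ℝ) (c d : ℝ) : ℕ → ℝ≥0∞
  | 0 => 0
  | n + 1 => levelHit q (Ici d) (levelHit q {c} (levelExc q c d n))

section

variable {q : ℝ≥0 → ℝ} {S : Set ℝ} {s : ℝ≥0∞}

lemma levelHit_le {u : ℝ≥0} (hu : s ≤ u) (hS : q u ∈ S) : levelHit q S s ≤ u :=
  iInf₂_le u ⟨hu, hS⟩

lemma le_levelHit : s ≤ levelHit q S s := le_iInf₂ fun _ hu => hu.1

lemma exists_eq_levelHit (hq : Continuous q) (hS : IsClosed S) {t : ℝ≥0}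
    (h : levelHit q S s ≤ t) : ∃ u : ℝ≥0, levelHit q S s = u ∧ q u ∈ S := by
  set K : Set ℝ≥0 := {u | s ≤ (u : ℝ≥0∞) ∧ q u ∈ S} with hK
  have hne : K.Nonempty := by
    by_contra hne
    have : levelHit q S s = ⊤ := by
      unfold levelHit
      rw [iInf_eq_top]
      intro u
      rw [iInf_eq_top]
      exact fun hu => absurd ⟨u, hu⟩ hne
    rw [this] at h
    exact absurd h (by simp)
  have hcl : IsClosed K :=
    (isClosed_le continuous_const ENNReal.continuous_coe).inter (hS.preimage hq)
  have hmem : sInf K ∈ K := hcl.csInf_mem hne (OrderBot.bddBelow K)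
  refine ⟨sInf K, le_antisymm (levelHit_le hmem.1 hmem.2) (le_iInf₂ fun u hu => ?_), hmem.2⟩
  exact_mod_cast csInf_le (OrderBot.bddBelow K) hu

/-- By the intermediate value theorem, a path cannot cross a level before hitting it. -/
lemma le_of_levelHit_singleton (hq : Continuous q) {c : ℝ} {v u : ℝ≥0} (hsv : s ≤ v) (hv : c ≤ q v)
    (hvu : v ≤ u) (hu : (u : ℝ≥0∞) ≤ levelHit q {c} s) : c ≤ q u := by
  by_contra! h
  obtain ⟨w, hw, hwc⟩ := intermediate_value_Icc' hvu hq.continuousOn ⟨h.le, hv⟩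
  have h1 : levelHit q {c} s ≤ w := levelHit_le (hsv.trans (by exact_mod_cast hw.1)) hwc
  have h2 : u ≤ w := by exact_mod_cast hu.trans h1
  rw [le_antisymm h2 hw.2, hwc] at h
  exact lt_irrefl _ h

lemma ge_of_levelHit_singleton (hq : Continuous q) {c : ℝ} {v u : ℝ≥0} (hsv : s ≤ v) (hv : q v ≤ c)
    (hvu : v ≤ u) (hu : (u : ℝ≥0∞) ≤ levelHit q {c} s) : q u ≤ c := by
  by_contra! h
  obtain ⟨w, hw, hwc⟩ := intermediate_value_Icc hvu hq.continuousOn ⟨hv, h.le⟩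
  have h1 : levelHit q {c} s ≤ w := levelHit_le (hsv.trans (by exact_mod_cast hw.1)) hwc
  have h2 : u ≤ w := by exact_mod_cast hu.trans h1
  rw [le_antisymm h2 hw.2, hwc] at h
  exact lt_irrefl _ h

lemma ge_of_levelHit_Ici (hq : Continuous q) {c : ℝ} {v u : ℝ≥0} (hsv : s ≤ v) (hv : q v ≤ c)
    (hvu : v ≤ u) (hu : (u : ℝ≥0∞) ≤ levelHit q (Ici c) s) : q u ≤ c := by
  by_contra! h
  obtain ⟨w, hw, hwc⟩ := intermediate_value_Icc hvu hq.continuousOn ⟨hv, h.le⟩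
  have h1 : levelHit q (Ici c) s ≤ w := levelHit_le (hsv.trans (by exact_mod_cast hw.1)) hwc.ge
  have h2 : u ≤ w := by exact_mod_cast hu.trans h1
  rw [le_antisymm h2 hw.2, hwc] at h
  exact lt_irrefl _ h

lemma levelExc_le_levelHit (c d : ℝ) (n : ℕ) :
    levelExc q c d n ≤ levelHit q {c} (levelExc q c d n) := le_levelHit

lemma levelHit_le_levelExc (c d : ℝ) (n : ℕ) :
    levelHit q {c} (levelExc q c d n) ≤ levelExc q c d (n + 1) := le_levelHit

lemma le_of_levelExc_succ_eq (hq : Continuous q) {c d : ℝ} {n : ℕ} {u : ℝ≥0}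
    (h : levelExc q c d (n + 1) = u) : d ≤ q u := by
  obtain ⟨v, hv, hvS⟩ := exists_eq_levelHit hq isClosed_Ici (s := levelHit q {c} (levelExc q c d n))
    (t := u) h.le
  have : (v : ℝ≥0∞) = u := hv.symm.trans h
  rw [ENNReal.coe_inj] at this
  exact this ▸ hvS

lemma eq_of_levelHit_singleton_eq (hq : Continuous q) {c : ℝ} {u : ℝ≥0}
    (h : levelHit q {c} s = u) : q u = c := by
  obtain ⟨v, hv, hvS⟩ := exists_eq_levelHit hq isClosed_singleton (t := u) h.le
  have : (v : ℝ≥0∞) = u := hv.symm.trans h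
  rw [ENNReal.coe_inj] at this
  exact this ▸ hvS

end

/-! ### Stopping times -/

/-- Stopping times with values in `[0, ∞]`. -/
def IsStop {Ω : Type*} (F : ℝ≥0 → MeasurableSpace Ω) (σ : Ω → ℝ≥0∞) : Prop :=
  ∀ t : ℝ≥0, MeasurableSet[F t] {ω | σ ω ≤ t}

/-- The time `σ ∧ T`. -/
def truncTime {Ω : Type*} (σ : Ω → ℝ≥0∞) (T : ℝ≥0) (ω : Ω) : ℝ≥0 := (min (σ ω) T).toNNReal

section

variable {Ω : Type*} {σ τ : Ω → ℝ≥0∞} {F : ℝ≥0 → MeasurableSpace Ω} {T : ℝ≥0} {ω : Ω}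

lemma coe_truncTime : (truncTime σ T ω : ℝ≥0∞) = min (σ ω) T :=
  ENNReal.coe_toNNReal (ne_top_of_le_ne_top ENNReal.coe_ne_top (min_le_right _ _))

lemma truncTime_le : truncTime σ T ω ≤ T := by
  have : (truncTime σ T ω : ℝ≥0∞) ≤ T := coe_truncTime.trans_le (min_le_right _ _)
  exact_mod_cast this

lemma truncTime_mono (h : σ ω ≤ τ ω) : truncTime σ T ω ≤ truncTime τ T ω := by
  have : (truncTime σ T ω : ℝ≥0∞) ≤ truncTime τ T ω := by
    rw [coe_truncTime, coe_truncTime]; exact min_le_min_right _ h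
  exact_mod_cast this

lemma coe_truncTime_of_le (h : σ ω ≤ T) : (truncTime σ T ω : ℝ≥0∞) = σ ω := by
  rw [coe_truncTime, min_eq_left h]

lemma truncTime_of_le (h : (T : ℝ≥0∞) ≤ σ ω) : truncTime σ T ω = T := by
  have : (truncTime σ T ω : ℝ≥0∞) = T := by rw [coe_truncTime, min_eq_right h]
  exact_mod_cast this

lemma coe_truncTime_le : (truncTime σ T ω : ℝ≥0∞) ≤ σ ω := coe_truncTime.trans_le (min_le_left _ _)

lemma truncTime_zero : truncTime (fun _ : Ω => 0) T ω = 0 := by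
  have : (truncTime (fun _ : Ω => 0) T ω : ℝ≥0∞) = 0 := by rw [coe_truncTime]; simp
  exact_mod_cast this

lemma IsStop.measurableSet_truncTime_le (hσ : IsStop F σ) (T t : ℝ≥0) :
    MeasurableSet[F t] {ω | truncTime σ T ω ≤ t} := by
  have : {ω | truncTime σ T ω ≤ t} = {ω | σ ω ≤ t} ∪ {_ω | T ≤ t} := by
    ext ω
    have h : truncTime σ T ω ≤ t ↔ (truncTime σ T ω : ℝ≥0∞) ≤ t := by norm_cast
    simp only [mem_ofPred_eq, mem_union]
    rw [h, coe_truncTime, min_le_iff]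
    norm_cast
  rw [this]
  exact (hσ t).union (MeasurableSet.const _)

lemma isStop_zero : IsStop F (fun _ => 0) := fun t => by simp

/-- The hitting time of a closed set of levels by a continuous adapted process is a stopping
time. -/
lemma IsStop.hit {q : ℝ≥0 → Ω → ℝ} (hmono : Monotone F) (hq : ∀ t, Measurable[F t] (q t))
    (hc : ∀ ω, Continuous (q · ω)) {S : Set ℝ} (hS : IsClosed S) (hSne : S.Nonempty)
    (hσ : IsStop F σ) : IsStop F (fun ω => levelHit (q · ω) S (σ ω)) := by
  intro t
  set D : ℕ → ℝ≥0 := TopologicalSpace.denseSeq ℝ≥0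
  set f : ℝ≥0 → Ω → ℝ := fun t ω => Metric.infDist (q t ω) S with hf
  have hfm : ∀ t, Measurable[F t] (f t) := fun t =>
    (Metric.continuous_infDist_pt S).measurable.comp (hq t)
  have hfc : ∀ ω, Continuous (f · ω) := fun ω => (Metric.continuous_infDist_pt S).comp (hc ω)
  have hf0 : ∀ u ω, f u ω ≤ 0 ↔ q u ω ∈ S := fun u ω => by
    rw [hS.mem_iff_infDist_zero hSne]
    exact ⟨fun h => le_antisymm h Metric.infDist_nonneg, fun h => h.le⟩
  -- The closed set is hit by time t exactly when the distance to it gets below every 1/(k+1) at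
  -- times of [σ, t]; compactness gives the converse. Countably many times `min (D j) t` suffice,
  -- and since t itself is among the limits of the truncation, no right-continuity of the filtration
  -- is required.
  have key : {ω | levelHit (q · ω) S (σ ω) ≤ t} =
      ⋂ k : ℕ, ⋃ j : ℕ, ({ω | σ ω ≤ (min (D j) t : ℝ≥0)} ∩
        {ω | f (min (D j) t) ω < 1 / ((k : ℝ) + 1)}) := by
    ext ω
    simp only [mem_ofPred_eq, mem_iInter, mem_iUnion, mem_inter_iff]
    constructor
    · intro h k
      obtain ⟨u, hu, huS⟩ := exists_eq_levelHit (hc ω) hS h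
      have hut : u ≤ t := by rw [hu] at h; exact_mod_cast h
      have hσu : σ ω ≤ u := hu ▸ le_levelHit
      have hopen : ∀ᶠ v in 𝓝 u, f v ω < 1 / ((k : ℝ) + 1) := by
        refine (hfc ω).continuousAt.eventually_lt_const ?_
        exact ((hf0 u ω).mpr huS).trans_lt (by positivity)
      obtain ⟨b, hub, hb⟩ := exists_Ico_subset_of_mem_nhds hopen (exists_gt u)
      obtain ⟨j, hj⟩ := (TopologicalSpace.denseRange_denseSeq ℝ≥0).exists_mem_open
        isOpen_Ioo (nonempty_Ioo.mpr hub)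
      have hmin : u ≤ min (D j) t := le_min hj.1.le hut
      refine ⟨j, hσu.trans (by exact_mod_cast hmin), ?_⟩
      exact hb ⟨hmin, (min_le_left _ _).trans_lt hj.2⟩
    · intro h
      set K : Set ℝ≥0 := {u | σ ω ≤ (u : ℝ≥0∞)} ∩ Icc 0 t with hK
      have hKc : IsCompact K :=
        isCompact_Icc.inter_left (isClosed_le continuous_const ENNReal.continuous_coe)
      have hKmem : ∀ k : ℕ, ∃ v ∈ K, f v ω < 1 / ((k : ℝ) + 1) := fun k => by
        obtain ⟨j, hj1, hj2⟩ := h k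
        exact ⟨_, ⟨hj1, zero_le, min_le_right _ _⟩, hj2⟩
      obtain ⟨u, huK, hu⟩ := hKc.exists_isMinOn
        (let ⟨v, hv, _⟩ := hKmem 0; ⟨v, hv⟩) (hfc ω).continuousOn
      have hle : f u ω ≤ 0 := by
        refine ge_of_tendsto' (tendsto_one_div_add_atTop_nhds_zero_nat (𝕜 := ℝ)) fun k => ?_
        obtain ⟨v, hv, hvk⟩ := hKmem k
        exact (hu hv).trans hvk.le
      exact (levelHit_le huK.1 ((hf0 u ω).mp hle)).trans (by exact_mod_cast huK.2.2)
  rw [key]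
  refine MeasurableSet.iInter fun k => MeasurableSet.iUnion fun j => MeasurableSet.inter ?_ ?_
  · exact hmono (min_le_right _ _) _ (hσ _)
  · exact hmono (min_le_right _ _) _ (measurableSet_lt (hfm _) measurable_const)

end

/-! ### The torus metric in terms of the distance to the lattice -/

lemma norm_coe_unitAddCircle_le (t : ℝ) (k : ℤ) : ‖(t : UnitAddCircle)‖ ≤ |t + k| := by
  rw [UnitAddCircle.norm_eq]
  simpa using round_le t (-k)

lemma norm_coe_sub_fract (a b : ℝ) :
    ‖((a - Int.fract b : ℝ) : UnitAddCircle)‖ = ‖((b - a : ℝ) : UnitAddCircle)‖ := by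
  have h : ((a - Int.fract b : ℝ) : UnitAddCircle) = -((b - a : ℝ) : UnitAddCircle) := by
    rw [← AddCircle.coe_neg, ← sub_eq_zero, ← AddCircle.coe_sub, AddCircle.coe_eq_zero_iff]
    refine ⟨⌊b⌋, ?_⟩
    rw [Int.fract]
    simp
  rw [h, norm_neg]

/-- The integer nearest to a number in (-1, 1) is -1, 0 or 1. This is why nine translates suffice in
the torus metric. -/
lemma exists_sign_abs_add_eq {v : ℝ} (h1 : -1 < v) (h2 : v < 1) :
    ∃ e : SignType, |v + (e : ℝ)| = ‖(v : UnitAddCircle)‖ := by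
  have hr : round v = -1 ∨ round v = 0 ∨ round v = 1 := by
    have h3 : (-2 : ℤ) < round v := by
      rw [round_eq, ← Int.add_one_le_iff, Int.le_floor]
      push_cast
      linarith
    have h4 : round v < 2 := by
      rw [round_eq, Int.floor_lt]
      push_cast
      linarith
    omega
  rw [UnitAddCircle.norm_eq]
  rcases hr with h | h | h
  · exact ⟨1, by rw [h]; simp⟩
  · exact ⟨0, by rw [h]; simp⟩
  · exact ⟨-1, by rw [h]; simp [sub_eq_add_neg]⟩

lemma torusDist_modOne (x : UnitTorus) (p : Plane) :
    torusDist x (modOne p) = √(latticeDistSq (p 0 - x.1 0, p 1 - x.1 1)) := by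
  have hnorm : ∀ e : Fin 2 → SignType,
      ‖x.1 - (modOne p).1 + WithLp.toLp 2 (fun i => ((e i : SignType) : ℝ))‖ =
      √(|x.1 0 - Int.fract (p 0) + (e 0 : ℝ)| ^ 2 + |x.1 1 - Int.fract (p 1) + (e 1 : ℝ)| ^ 2) := by
    intro e
    rw [EuclideanSpace.norm_eq, Fin.sum_univ_two]
    simp [modOne]
  unfold torusDist latticeDistSq
  simp_rw [hnorm, ← norm_coe_sub_fract (x.1 _) (p _)]
  refine le_antisymm ?_ ?_
  · have hv : ∀ i, ∃ e : SignType, |x.1 i - Int.fract (p i) + (e : ℝ)| =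
        ‖((x.1 i - Int.fract (p i) : ℝ) : UnitAddCircle)‖ := fun i =>
      exists_sign_abs_add_eq (by linarith [(x.2 i).1, Int.fract_lt_one (p i)])
        (by linarith [(x.2 i).2, Int.fract_nonneg (p i)])
    choose e he using hv
    refine (ciInf_le (Set.finite_range _).bddBelow e).trans (le_of_eq ?_)
    rw [he, he]
  · refine le_ciInf fun e => Real.sqrt_le_sqrt ?_
    have h : ∀ i, ‖((x.1 i - Int.fract (p i) : ℝ) : UnitAddCircle)‖ ≤
        |x.1 i - Int.fract (p i) + (e i : ℝ)| := fun i => by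
      have := norm_coe_unitAddCircle_le (x.1 i - Int.fract (p i)) ((e i : SignType) : ℤ)
      have hc : (((e i : SignType) : ℤ) : ℝ) = ((e i : SignType) : ℝ) := by
        cases e i <;> simp
      rwa [hc] at this
    gcongr
    · exact h 0
    · exact h 1

lemma modOne_self (y : UnitTorus) : modOne y.1 = y := by
  apply Subtype.ext
  ext i
  exact Int.fract_eq_self.mpr (y.2 i)

/-- The excursion times of a path on the torus, in terms of the distance to the lattice of its lift
to the plane. -/
lemma excursionTime_eq_levelExc (x y : UnitTorus) (b : ℝ≥0 → Plane) {r₀ r₁ : ℝ} (h₀ : 0 ≤ r₀)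
    (h₁ : 0 ≤ r₁) (n : ℕ) :
    excursionTime (torusPath y b) x r₀ r₁ n =
      levelExc (fun t => latticeDistSq (y.1 0 - x.1 0 + b t 0, y.1 1 - x.1 1 + b t 1))
        (r₁ ^ 2) (r₀ ^ 2) n := by
  have hd : ∀ t, torusDist x (torusPath y b t) =
      √(latticeDistSq (y.1 0 - x.1 0 + b t 0, y.1 1 - x.1 1 + b t 1)) := fun t => by
    rw [torusPath, torusDist_modOne]
    congr 3 <;> (simp; ring)
  have hcirc : ∀ t, torusPath y b t ∈ torusCircle x r₁ ↔
      latticeDistSq (y.1 0 - x.1 0 + b t 0, y.1 1 - x.1 1 + b t 1) ∈ ({r₁ ^ 2} : Set ℝ) := fun t => by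
    rw [torusCircle, mem_ofPred_eq, hd, mem_singleton_iff,
      Real.sqrt_eq_iff_eq_sq (latticeDistSq_nonneg _) h₁]
  have hball : ∀ t, torusPath y b t ∈ (torusBall x r₀)ᶜ ↔
      latticeDistSq (y.1 0 - x.1 0 + b t 0, y.1 1 - x.1 1 + b t 1) ∈ Ici (r₀ ^ 2) := fun t => by
    rw [torusBall, mem_compl_iff, mem_ofPred_eq, hd, not_lt, mem_Ici]
    exact Real.le_sqrt h₀ (latticeDistSq_nonneg _)
  induction n with
  | zero => rfl
  | succ n ih =>
    rw [excursionTime, levelExc, ih]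
    unfold hitAfter levelHit
    simp only [hcirc, hball]

/-! ### Estimates between two stopping times -/

section

variable {Ω : Type*} {mΩ : MeasurableSpace Ω} {F : ℝ≥0 → MeasurableSpace Ω} {P : Measure Ω}
  {X : ℝ≥0 → Ω → ℝ × ℝ} {σ τ : Ω → ℝ≥0∞}

lemma IsStop.measurable_truncTime (hF : ∀ t, F t ≤ mΩ) (hσ : IsStop F σ) (T : ℝ≥0) :
    Measurable (truncTime σ T) :=
  measurable_of_Iic fun t => hF t _ (hσ.measurableSet_truncTime_le T t)

lemma IsStop.integrable_comp_truncTime [IsFiniteMeasure P] (hF : ∀ t, F t ≤ mΩ) (hσ : IsStop F σ)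
    (T : ℝ≥0) {h : ℝ → ℝ} (hh : Continuous h) : Integrable (fun ω => h (truncTime σ T ω)) P := by
  obtain ⟨C, hC⟩ := (isCompact_Icc (a := (0 : ℝ)) (b := T)).exists_bound_of_continuousOn
    hh.continuousOn
  refine Integrable.of_bound (C := C) ?_ (ae_of_all _ fun ω => hC _ ⟨by simp, ?_⟩)
  · exact (hh.measurable.comp (measurable_coe_nnreal_real.comp
      (hσ.measurable_truncTime hF T))).aestronglyMeasurable
  · exact NNReal.coe_le_coe.mpr truncTime_le

/-- Either the truncation leaves no time between σ and τ, or σ itself is not truncated, so that the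
information about the path after σ is available. -/
lemma truncTime_eq_or (h : σ ω ≤ τ ω) (T : ℝ≥0) : truncTime σ T ω = truncTime τ T ω ∨
    ((truncTime σ T ω : ℝ≥0∞) = σ ω ∧ σ ω ≤ truncTime τ T ω) := by
  rcases le_total (σ ω) T with hT | hT
  · right
    have h1 := coe_truncTime_of_le hT
    refine ⟨h1, ?_⟩
    rw [← h1]
    exact_mod_cast truncTime_mono h
  · left
    rw [truncTime_of_le hT, truncTime_of_le (hT.trans h)]

/-- An upper bound for exponential moments of the time spent in a region where
`a + f` satisfies `½ Δ (a + f) ≤ - l (a + f)`. -/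
lemma integral_exp_truncTime_le [IsProbabilityMeasure P] (hX : IsPlaneMarkov F P X)
    {f g : ℝ × ℝ → ℝ} (hfg : GenPair f g) {l a M : ℝ} (ha : 0 < a) (hM : 0 ≤ M)
    (hσ : IsStop F σ) (hτ : IsStop F τ) (hστ : ∀ ω, σ ω ≤ τ ω)
    (hreg : ∀ ω (u : ℝ≥0), σ ω ≤ u → u ≤ τ ω → 0 ≤ f (X u ω) ∧ f (X u ω) ≤ M ∧
      l * (a + f (X u ω)) + g (X u ω) ≤ 0) (T : ℝ≥0) :
    ∫ ω, Real.exp (l * truncTime τ T ω) ∂P ≤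
      (a + M) / a * ∫ ω, Real.exp (l * truncTime σ T ω) ∂P := by
  have hd := hX.hasDrift ((GenPair.const a).add hfg) (a := fun t => Real.exp (l * t))
    (a' := fun t => Real.exp (l * t) * l) (fun t => by
      simpa using ((hasDerivAt_id t).const_mul l).exp) (by fun_prop)
  have hle := hd.integral_le_of_drift_nonpos (σ := truncTime σ T) (τ := truncTime τ T) (T := T)
    (fun ω => truncTime_mono (hστ ω)) (fun ω => truncTime_le) (hσ.measurableSet_truncTime_le T)
    (hτ.measurableSet_truncTime_le T) (ae_of_all _ fun ω u hu1 hu2 => by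
      have h1 : σ ω ≤ u := by
        rcases truncTime_eq_or (hστ ω) T with h | h
        · exact absurd (hu1.trans hu2) (by rw [h]; exact lt_irrefl _)
        · rw [← h.1]; exact_mod_cast hu1.le
      have h2 : (u : ℝ≥0∞) ≤ τ ω :=
        le_trans (by exact_mod_cast hu2.le) (coe_truncTime_le (T := T))
      have h3 := (hreg ω u h1 h2).2.2
      rw [Real.toNNReal_coe]
      have : 0 < Real.exp (l * u) := Real.exp_pos _
      nlinarith)
  have hiσ := hσ.integrable_comp_truncTime (P := P) hX.le T
    (h := fun t => Real.exp (l * t)) (by fun_prop)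
  have hiτ := hτ.integrable_comp_truncTime (P := P) hX.le T
    (h := fun t => Real.exp (l * t)) (by fun_prop)
  have hYσ := hd.integrable_stopped (τ := truncTime σ T) (T := T)
    (fun ω => truncTime_le) (hσ.measurableSet_truncTime_le T)
  have hYτ := hd.integrable_stopped (τ := truncTime τ T) (T := T)
    (fun ω => truncTime_le) (hτ.measurableSet_truncTime_le T)
  -- The process exp(lt)(a + f) has nonpositive drift between the two times. Using f ≥ 0 at the end
  -- and f ≤ M at the start costs the factor (a + M)/a; where both times are truncated the two
  -- processes agree and M ≥ 0 suffices.
  have hpt : ∫ ω, (a * Real.exp (l * truncTime τ T ω) - (a + M) * Real.exp (l * truncTime σ T ω)) ∂P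
      ≤ ∫ ω, (Real.exp (l * truncTime τ T ω) * (a + f (X (truncTime τ T ω) ω)) -
        Real.exp (l * truncTime σ T ω) * (a + f (X (truncTime σ T ω) ω))) ∂P := by
    refine integral_mono ((hiτ.const_mul _).sub (hiσ.const_mul _)) (hYτ.sub hYσ) fun ω => ?_
    simp only
    rcases truncTime_eq_or (hστ ω) T with h | h
    · rw [h]
      have := Real.exp_pos (l * truncTime τ T ω)
      nlinarith
    · have h1 := (hreg ω (truncTime σ T ω) h.1.ge (coe_truncTime_le.trans (hστ ω))).2.1
      have h2 := (hreg ω (truncTime τ T ω) h.2 coe_truncTime_le).1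
      have e1 := Real.exp_pos (l * truncTime τ T ω)
      have e2 := Real.exp_pos (l * truncTime σ T ω)
      nlinarith [mul_nonneg e1.le h2, mul_le_mul_of_nonneg_left h1 e2.le]
  rw [integral_sub (hiτ.const_mul _) (hiσ.const_mul _), integral_sub hYτ hYσ,
    integral_const_mul, integral_const_mul] at hpt
  rw [div_mul_eq_mul_div, le_div_iff₀ ha]
  linarith

/-- The weight `w` at the time `σ` if `σ ≤ T`, and `c` otherwise. -/
def stoppedWeight (w : ℝ → ℝ) (c : ℝ) (σ : Ω → ℝ≥0∞) (T : ℝ≥0) (ω : Ω) : ℝ :=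
  {ω | σ ω ≤ T}.indicator (fun ω => w (truncTime σ T ω) - c) ω + c

lemma stoppedWeight_of_le {w : ℝ → ℝ} {c : ℝ} {T : ℝ≥0} {ω : Ω} (h : σ ω ≤ T) :
    stoppedWeight w c σ T ω = w (truncTime σ T ω) := by
  unfold stoppedWeight
  rw [indicator_of_mem (show ω ∈ {ω | σ ω ≤ T} from h), sub_add_cancel]

lemma stoppedWeight_of_lt {w : ℝ → ℝ} {c : ℝ} {T : ℝ≥0} {ω : Ω} (h : (T : ℝ≥0∞) < σ ω) :
    stoppedWeight w c σ T ω = c := by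
  unfold stoppedWeight
  rw [indicator_of_notMem (show ω ∉ {ω | σ ω ≤ T} from not_le.mpr h), zero_add]

lemma IsStop.integrable_stoppedWeight [IsFiniteMeasure P] (hF : ∀ t, F t ≤ mΩ) (hσ : IsStop F σ)
    (T : ℝ≥0) {w : ℝ → ℝ} (hw : Continuous w) (c : ℝ) :
    Integrable (stoppedWeight w c σ T) P :=
  (((hσ.integrable_comp_truncTime hF T hw).sub (integrable_const c)).indicator (hF T _ (hσ T))).add
    (integrable_const c)

/-- An upper bound for the Laplace transform, with a function such that `½ Δ f ≤ l f`. -/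
lemma integral_exp_neg_le [IsProbabilityMeasure P] (hX : IsPlaneMarkov F P X)
    {f g : ℝ × ℝ → ℝ} (hfg : GenPair f g) {l m₀ m₁ : ℝ}
    (hσ : IsStop F σ) (hτ : IsStop F τ) (hστ : ∀ ω, σ ω ≤ τ ω)
    (hf : ∀ z, 0 ≤ f z) (hg : ∀ z, g z ≤ l * f z)
    (h₀ : ∀ ω (u : ℝ≥0), σ ω = u → f (X u ω) ≤ m₀) (h₁ : ∀ ω (u : ℝ≥0), τ ω = u → m₁ ≤ f (X u ω))
    (T : ℝ≥0) :
    m₁ * ∫ ω, stoppedWeight (fun t => Real.exp (-l * t)) 0 τ T ω ∂P ≤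
      m₀ * ∫ ω, stoppedWeight (fun t => Real.exp (-l * t)) 0 σ T ω ∂P := by
  have hd := hX.hasDrift hfg (a := fun t => Real.exp (-l * t))
    (a' := fun t => Real.exp (-l * t) * -l) (fun t => by
      simpa using ((hasDerivAt_id t).const_mul (-l)).exp) (by fun_prop)
  have hle := hd.integral_le_of_drift_nonpos (σ := truncTime σ T) (τ := truncTime τ T) (T := T)
    (fun ω => truncTime_mono (hστ ω)) (fun ω => truncTime_le) (hσ.measurableSet_truncTime_le T)
    (hτ.measurableSet_truncTime_le T) (ae_of_all _ fun ω u _ _ => by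
      have h3 := hg (X u ω)
      rw [Real.toNNReal_coe]
      have : 0 < Real.exp (-l * u) := Real.exp_pos _
      nlinarith)
  have hiσ := hσ.integrable_stoppedWeight (P := P) hX.le T
    (w := fun t => Real.exp (-l * t)) (by fun_prop) 0
  have hiτ := hτ.integrable_stoppedWeight (P := P) hX.le T
    (w := fun t => Real.exp (-l * t)) (by fun_prop) 0
  have hYσ := hd.integrable_stopped (τ := truncTime σ T) (T := T)
    (fun ω => truncTime_le) (hσ.measurableSet_truncTime_le T)
  have hYτ := hd.integrable_stopped (τ := truncTime τ T) (T := T)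
    (fun ω => truncTime_le) (hτ.measurableSet_truncTime_le T)
  rw [← integral_const_mul, ← integral_const_mul, ← sub_nonpos,
    ← integral_sub (hiτ.const_mul _) (hiσ.const_mul _)]
  rw [← sub_nonpos, ← integral_sub hYτ hYσ] at hle
  refine le_trans (integral_mono ((hiτ.const_mul _).sub (hiσ.const_mul _)) (hYτ.sub hYσ)
    fun ω => ?_) hle
  simp only [Pi.sub_apply]
  rcases le_or_gt (σ ω) T with hs | hs
  · rw [stoppedWeight_of_le hs]
    have e2 := Real.exp_pos (-l * truncTime σ T ω)
    have k2 := h₀ ω _ (coe_truncTime_of_le hs).symm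
    have e1 := Real.exp_pos (-l * truncTime τ T ω)
    have k3 := mul_le_mul_of_nonneg_left k2 e2.le
    rcases le_or_gt (τ ω) T with ht | ht
    · rw [stoppedWeight_of_le ht]
      have k1 := h₁ ω _ (coe_truncTime_of_le ht).symm
      have k4 := mul_le_mul_of_nonneg_left k1 e1.le
      linarith
    · rw [stoppedWeight_of_lt ht]
      have k4 := mul_nonneg e1.le (hf (X (truncTime τ T ω) ω))
      linarith
  · have ht := hs.trans_le (hστ ω)
    rw [stoppedWeight_of_lt hs, stoppedWeight_of_lt ht, truncTime_of_le hs.le,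
      truncTime_of_le ht.le]
    simp

/-- A lower bound for the expectation of a weight at the end of an excursion, from a space-time
subsolution `w₁ + (w₀ - w₁) φ`. -/
lemma integral_stoppedWeight_sub_le [IsProbabilityMeasure P] (hX : IsPlaneMarkov F P X)
    {φ g : ℝ × ℝ → ℝ} (hφ : GenPair φ g) {w₀ w₁ w₀' w₁' : ℝ → ℝ}
    (hw₀ : ∀ t, HasDerivAt w₀ (w₀' t) t) (hw₁ : ∀ t, HasDerivAt w₁ (w₁' t) t)
    (hw₀' : Continuous w₀') (hw₁' : Continuous w₁') {T : ℝ≥0} {e₀ e₁ : ℝ} (he₀ : 0 ≤ e₀)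
    (he₁ : 0 ≤ e₁) (hσ : IsStop F σ) (hτ : IsStop F τ) (hστ : ∀ ω, σ ω ≤ τ ω)
    (hφ1 : ∀ z, φ z ≤ 1)
    (hw : ∀ t ∈ Icc (0 : ℝ) T, 0 ≤ w₁ t ∧ w₁ t ≤ w₀ t ∧ w₀ t ≤ 1)
    (hreg : ∀ ω (u : ℝ≥0), σ ω ≤ u → u ≤ τ ω → u ≤ T →
      0 ≤ w₁' u + (w₀' u - w₁' u) * φ (X u ω) + (w₀ u - w₁ u) * g (X u ω))
    (h₀ : ∀ ω (u : ℝ≥0), σ ω = u → 1 - e₀ ≤ φ (X u ω))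
    (h₁ : ∀ ω (u : ℝ≥0), τ ω = u → φ (X u ω) ≤ e₁) :
    ∫ ω, stoppedWeight w₀ 1 σ T ω ∂P - (e₀ + e₁) ≤ ∫ ω, stoppedWeight w₁ 1 τ T ω ∂P := by
  have hw₀c : Continuous w₀ := continuous_iff_continuousAt.mpr fun t => (hw₀ t).continuousAt
  have hw₁c : Continuous w₁ := continuous_iff_continuousAt.mpr fun t => (hw₁ t).continuousAt
  -- The process is minus the subsolution, so that its drift is nonpositive.
  have hd := (hX.hasDrift (GenPair.const (-1)) hw₁ hw₁').add
    (hX.hasDrift (hφ.const_mul (-1)) (fun t => (hw₀ t).sub (hw₁ t)) (hw₀'.sub hw₁'))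
  have hle := hd.integral_le_of_drift_nonpos (σ := truncTime σ T) (τ := truncTime τ T) (T := T)
    (fun ω => truncTime_mono (hστ ω)) (fun ω => truncTime_le) (hσ.measurableSet_truncTime_le T)
    (hτ.measurableSet_truncTime_le T) (ae_of_all _ fun ω u hu1 hu2 => by
      have h1 : σ ω ≤ u := by
        rcases truncTime_eq_or (hστ ω) T with h | h
        · exact absurd (hu1.trans hu2) (by rw [h]; exact lt_irrefl _)
        · rw [← h.1]; exact_mod_cast hu1.le
      have h2 : (u : ℝ≥0∞) ≤ τ ω :=
        le_trans (by exact_mod_cast hu2.le) (coe_truncTime_le (T := T))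
      have h3 := hreg ω u h1 h2 (hu2.le.trans truncTime_le)
      rw [Real.toNNReal_coe]
      simp only [Pi.sub_apply]
      linarith)
  have hiσ := hσ.integrable_stoppedWeight (P := P) hX.le T hw₀c 1
  have hiτ := hτ.integrable_stoppedWeight (P := P) hX.le T hw₁c 1
  have hYσ := hd.integrable_stopped (τ := truncTime σ T) (T := T)
    (fun ω => truncTime_le) (hσ.measurableSet_truncTime_le T)
  have hYτ := hd.integrable_stopped (τ := truncTime τ T) (T := T)
    (fun ω => truncTime_le) (hτ.measurableSet_truncTime_le T)
  rw [← sub_nonpos, ← integral_sub hYτ hYσ] at hle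
  have hkey : ∫ ω, (stoppedWeight w₀ 1 σ T ω - stoppedWeight w₁ 1 τ T ω - (e₀ + e₁)) ∂P ≤ 0 := by
    refine le_trans (integral_mono ((hiσ.sub hiτ).sub (integrable_const _)) (hYτ.sub hYσ)
      fun ω => ?_) hle
    simp only [Pi.sub_apply]
    rcases le_or_gt (σ ω) T with hs | hs
    · rw [stoppedWeight_of_le hs]
      set s := truncTime σ T ω
      set t := truncTime τ T ω with ht_def
      have hsT : (s : ℝ) ∈ Icc (0 : ℝ) T := ⟨by simp, by exact NNReal.coe_le_coe.mpr truncTime_le⟩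
      have htT : (t : ℝ) ∈ Icc (0 : ℝ) T := ⟨by simp, by exact NNReal.coe_le_coe.mpr truncTime_le⟩
      have k2 := h₀ ω s (coe_truncTime_of_le hs).symm
      obtain ⟨s1, s2, s3⟩ := hw s hsT
      obtain ⟨t1, t2, t3⟩ := hw t htT
      have k3 := mul_le_mul_of_nonneg_left k2 (sub_nonneg.mpr s2)
      have k5 : (w₀ s - w₁ s) * e₀ ≤ 1 * e₀ := by gcongr; linarith
      rcases le_or_gt (τ ω) T with ht | ht
      · rw [stoppedWeight_of_le ht]
        have k1 := h₁ ω t (coe_truncTime_of_le ht).symm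
        have k4 := mul_le_mul_of_nonneg_left k1 (sub_nonneg.mpr t2)
        have k6 : (w₀ t - w₁ t) * e₁ ≤ 1 * e₁ := by gcongr; linarith
        linarith
      -- Here τ has not occurred by time `T` and the weight is 1, which dominates the subsolution
      -- because φ ≤ 1 and w₀ ≤ 1.
      · rw [stoppedWeight_of_lt ht]
        have k4 := mul_le_mul_of_nonneg_left (hφ1 (X t ω)) (sub_nonneg.mpr t2)
        linarith
    · have ht := hs.trans_le (hστ ω)
      rw [stoppedWeight_of_lt hs, stoppedWeight_of_lt ht, truncTime_of_le hs.le,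
        truncTime_of_le ht.le]
      linarith
  rw [integral_sub (f := fun ω => stoppedWeight w₀ 1 σ T ω - stoppedWeight w₁ 1 τ T ω)
    (hiσ.sub hiτ) (integrable_const _), integral_sub hiσ hiτ] at hkey
  simp only [integral_const, probReal_univ, smul_eq_mul, one_mul] at hkey
  linarith

end

/-! ### Poisson weights -/

/-- The Poisson distribution function `P(N < k)` for `N` of mean `u`. -/
def poissonCdfLt (k : ℕ) (u : ℝ) : ℝ :=
  ∑ i ∈ Finset.range k, Real.exp (-u) * u ^ i / i.factorial

lemma poissonCdfLt_zero (u : ℝ) : poissonCdfLt 0 u = 0 := by simp [poissonCdfLt]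

lemma poissonCdfLt_succ (k : ℕ) (u : ℝ) :
    poissonCdfLt (k + 1) u = poissonCdfLt k u + Real.exp (-u) * u ^ k / k.factorial :=
  Finset.sum_range_succ _ _

/-- The forward equation of the Poisson process: the derivatives of the individual terms telescope.
It is what makes these functions suitable weights for successive waiting times. -/
lemma hasDerivAt_poissonCdfLt_succ (k : ℕ) (u : ℝ) :
    HasDerivAt (poissonCdfLt (k + 1)) (poissonCdfLt k u - poissonCdfLt (k + 1) u) u := by
  have he : HasDerivAt (fun u : ℝ => Real.exp (-u)) (-Real.exp (-u)) u := by
    simpa using (hasDerivAt_neg u).exp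
  induction k with
  | zero =>
    have h : poissonCdfLt (0 + 1) = fun u => Real.exp (-u) := by
      ext v; simp [poissonCdfLt]
    rw [h, poissonCdfLt_zero]
    simpa using he
  | succ k ih =>
    have h : poissonCdfLt (k + 1 + 1) = fun u => poissonCdfLt (k + 1) u +
        Real.exp (-u) * u ^ (k + 1) / (k + 1).factorial := by
      ext v; exact poissonCdfLt_succ _ _
    have hd := ih.add ((he.mul (hasDerivAt_pow (k + 1) u)).div_const ((k + 1).factorial : ℝ))
    rw [h]
    refine hd.congr_deriv ?_
    have hf : (k.factorial : ℝ) ≠ 0 := by positivity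
    have hk : (k : ℝ) + 1 ≠ 0 := by positivity
    beta_reduce
    rw [poissonCdfLt_succ k u, Nat.factorial_succ]
    push_cast
    field_simp
    ring

lemma poissonCdfLt_le_succ (k : ℕ) {u : ℝ} (hu : 0 ≤ u) :
    poissonCdfLt k u ≤ poissonCdfLt (k + 1) u := by
  rw [poissonCdfLt_succ]
  have : 0 ≤ Real.exp (-u) * u ^ k / k.factorial := by positivity
  linarith

lemma poissonCdfLt_nonneg (k : ℕ) {u : ℝ} (hu : 0 ≤ u) : 0 ≤ poissonCdfLt k u :=
  Finset.sum_nonneg fun i _ => by positivity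

lemma poissonCdfLt_le_one (k : ℕ) {u : ℝ} (hu : 0 ≤ u) : poissonCdfLt k u ≤ 1 := by
  have h := Real.sum_le_exp_of_nonneg hu k
  have : poissonCdfLt k u = Real.exp (-u) * ∑ i ∈ Finset.range k, u ^ i / i.factorial := by
    rw [poissonCdfLt, Finset.mul_sum]
    exact Finset.sum_congr rfl fun i _ => by ring
  rw [this]
  calc Real.exp (-u) * ∑ i ∈ Finset.range k, u ^ i / i.factorial
      ≤ Real.exp (-u) * Real.exp u := by gcongr
    _ = 1 := by rw [← Real.exp_add]; simp

lemma continuous_poissonCdfLt (k : ℕ) : Continuous (poissonCdfLt k) := by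
  unfold poissonCdfLt
  fun_prop

lemma antitoneOn_poissonCdfLt (k : ℕ) : AntitoneOn (poissonCdfLt k) (Ici 0) := by
  cases k with
  | zero => intro a _ b _ _; simp [poissonCdfLt_zero]
  | succ k =>
    refine antitoneOn_of_deriv_nonpos (convex_Ici 0) (continuous_poissonCdfLt _).continuousOn
      (fun x _ => (hasDerivAt_poissonCdfLt_succ k x).differentiableAt.differentiableWithinAt)
      fun x hx => ?_
    rw [interior_Ici, mem_Ioi] at hx
    rw [(hasDerivAt_poissonCdfLt_succ k x).deriv]
    linarith [poissonCdfLt_le_succ k hx.le]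

/-! ### Excursions of a planar process -/

section

variable {Ω : Type*} {mΩ : MeasurableSpace Ω} {F : ℝ≥0 → MeasurableSpace Ω} {P : Measure Ω}
  {X : ℝ≥0 → Ω → ℝ × ℝ} {c d : ℝ}

/-- The squared distance of the process to the lattice. -/
def latticePath (X : ℝ≥0 → Ω → ℝ × ℝ) (ω : Ω) (t : ℝ≥0) : ℝ := latticeDistSq (X t ω)

/-- The completion time of the `n`-th passage of the process. -/
def excTime (X : ℝ≥0 → Ω → ℝ × ℝ) (c d : ℝ) (n : ℕ) (ω : Ω) : ℝ≥0∞ :=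
  levelExc (latticePath X ω) c d n

/-- The first time after the `n`-th passage at which the process has the level `c`. -/
def excHit (X : ℝ≥0 → Ω → ℝ × ℝ) (c d : ℝ) (n : ℕ) (ω : Ω) : ℝ≥0∞ :=
  levelHit (latticePath X ω) {c} (excTime X c d n ω)

lemma excTime_le_excHit (n : ℕ) (ω : Ω) : excTime X c d n ω ≤ excHit X c d n ω :=
  levelExc_le_levelHit c d n

lemma excHit_le_excTime (n : ℕ) (ω : Ω) : excHit X c d n ω ≤ excTime X c d (n + 1) ω :=
  levelHit_le_levelExc c d n

lemma IsPlaneMarkov.continuous_latticePath (hX : IsPlaneMarkov F P X) (ω : Ω) :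
    Continuous (latticePath X ω) :=
  continuous_latticeDistSq.comp (hX.cont ω)

lemma IsPlaneMarkov.measurable_latticePath (hX : IsPlaneMarkov F P X) (t : ℝ≥0) :
    Measurable[F t] (fun ω => latticePath X ω t) :=
  continuous_latticeDistSq.measurable.comp (hX.adapted t)

lemma IsPlaneMarkov.isStop_excHit_of (hX : IsPlaneMarkov F P X) {n : ℕ}
    (h : IsStop F (excTime X c d n)) : IsStop F (excHit X c d n) :=
  h.hit (q := fun t ω => latticePath X ω t) hX.mono hX.measurable_latticePath
    hX.continuous_latticePath isClosed_singleton (singleton_nonempty c)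

lemma IsPlaneMarkov.isStop_excTime (hX : IsPlaneMarkov F P X) (n : ℕ) :
    IsStop F (excTime X c d n) := by
  induction n with
  | zero => exact isStop_zero
  | succ n ih =>
    exact (hX.isStop_excHit_of ih).hit (q := fun t ω => latticePath X ω t) hX.mono
      hX.measurable_latticePath hX.continuous_latticePath isClosed_Ici nonempty_Ici

lemma IsPlaneMarkov.isStop_excHit (hX : IsPlaneMarkov F P X) (n : ℕ) :
    IsStop F (excHit X c d n) := hX.isStop_excHit_of (hX.isStop_excTime n)

lemma IsPlaneMarkov.le_of_excTime_succ (hX : IsPlaneMarkov F P X) {n : ℕ} {ω : Ω} {u : ℝ≥0}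
    (h : excTime X c d (n + 1) ω = u) : d ≤ latticeDistSq (X u ω) :=
  le_of_levelExc_succ_eq (hX.continuous_latticePath ω) h

lemma IsPlaneMarkov.eq_of_excHit (hX : IsPlaneMarkov F P X) {n : ℕ} {ω : Ω} {u : ℝ≥0}
    (h : excHit X c d n ω = u) : latticeDistSq (X u ω) = c :=
  eq_of_levelHit_singleton_eq (hX.continuous_latticePath ω) h

/-- Between the `n + 1`-st passage and the following hit of the level `c`, the process stays above
this level. -/
lemma IsPlaneMarkov.le_of_mem_excHit (hX : IsPlaneMarkov F P X) (hcd : c ≤ d) {n : ℕ} {ω : Ω}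
    {u : ℝ≥0} (h : excTime X c d (n + 1) ω ≤ u) (hu : u ≤ excHit X c d (n + 1) ω) :
    c ≤ latticeDistSq (X u ω) := by
  lift excTime X c d (n + 1) ω to ℝ≥0 using ne_top_of_le_ne_top ENNReal.coe_ne_top h with v hv
  exact le_of_levelHit_singleton (hX.continuous_latticePath ω) hv.ge
    (hcd.trans (hX.le_of_excTime_succ hv.symm)) (by exact_mod_cast h) hu

/-- Between a hit of the level `c` and the completion of the passage, the process stays below the
level `d`. -/
lemma IsPlaneMarkov.ge_of_mem_excTime (hX : IsPlaneMarkov F P X) (hcd : c ≤ d) {n : ℕ} {ω : Ω}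
    {u : ℝ≥0} (h : excHit X c d n ω ≤ u) (hu : u ≤ excTime X c d (n + 1) ω) :
    latticeDistSq (X u ω) ≤ d := by
  lift excHit X c d n ω to ℝ≥0 using ne_top_of_le_ne_top ENNReal.coe_ne_top h with v hv
  exact ge_of_levelHit_Ici (hX.continuous_latticePath ω) hv.ge
    ((hX.eq_of_excHit hv.symm).trans_le hcd) (by exact_mod_cast h) hu

/-! ### Exponential moments and the upper tail -/

/-- An upper bound for the exponential moments of the passage times. -/
lemma IsPlaneMarkov.integral_exp_excTime_le [IsProbabilityMeasure P] (hX : IsPlaneMarkov F P X)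
    (hcd : c ≤ d) {z : ℝ × ℝ} (hz : ∀ ω, X 0 ω = z) {f g f' g' : ℝ × ℝ → ℝ} (hfg : GenPair f g)
    (hfg' : GenPair f' g') {l a M a' M' : ℝ} (ha : 0 < a) (ha' : 0 < a') (hM : 0 ≤ M)
    (hM' : 0 ≤ M') (hle : (a' + M') / a' ≤ (a + M) / a)
    (hout : ∀ z, c ≤ latticeDistSq z → 0 ≤ f z ∧ f z ≤ M ∧ l * (a + f z) + g z ≤ 0)
    (hin : ∀ z, latticeDistSq z ≤ d → 0 ≤ f' z ∧ f' z ≤ M' ∧ l * (a' + f' z) + g' z ≤ 0)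
    (T : ℝ≥0) (n : ℕ) :
    ∫ ω, Real.exp (l * truncTime (excTime X c d n) T ω) ∂P ≤
      ((a + M) / a * ((a' + M') / a')) ^ n := by
  induction n with
  | zero =>
    have h0 : ∀ ω, truncTime (excTime X c d 0) T ω = 0 := fun ω => truncTime_zero
    simp [h0]
  | succ n ih =>
    have h1 : ∫ ω, Real.exp (l * truncTime (excHit X c d n) T ω) ∂P ≤
        (a + M) / a * ∫ ω, Real.exp (l * truncTime (excTime X c d n) T ω) ∂P := by
      have hint : 0 ≤ ∫ ω, Real.exp (l * truncTime (excTime X c d n) T ω) ∂P :=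
        integral_nonneg fun ω => (Real.exp_pos _).le
      cases n with
      | zero =>
        have hzero : ∀ ω, excTime X c d 0 ω = ((0 : ℝ≥0) : ℝ≥0∞) := fun ω => rfl
        rcases le_total c (latticeDistSq z) with hc | hc
        · refine integral_exp_truncTime_le hX hfg ha hM (hX.isStop_excTime 0)
            (hX.isStop_excHit 0) (excTime_le_excHit 0) (fun ω u h hu => hout _ ?_) T
          exact le_of_levelHit_singleton (hX.continuous_latticePath ω) (v := 0) (hzero ω).le
            (by rw [latticePath, hz]; exact hc) zero_le hu
        · refine (integral_exp_truncTime_le hX hfg' ha' hM' (hX.isStop_excTime 0)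
            (hX.isStop_excHit 0) (excTime_le_excHit 0) (fun ω u h hu => hin _ ?_) T).trans
            (mul_le_mul_of_nonneg_right hle hint)
          exact le_trans (ge_of_levelHit_singleton (hX.continuous_latticePath ω) (v := 0)
            (hzero ω).le (by rw [latticePath, hz]; exact hc) zero_le hu) hcd
      | succ n =>
        exact integral_exp_truncTime_le hX hfg ha hM (hX.isStop_excTime _)
          (hX.isStop_excHit _) (excTime_le_excHit _)
          (fun ω u h hu => hout _ (hX.le_of_mem_excHit hcd h hu)) T
    have h2 := integral_exp_truncTime_le hX hfg' ha' hM' (hX.isStop_excHit (c := c) (d := d) n)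
      (hX.isStop_excTime (n + 1)) (excHit_le_excTime n)
      (fun ω u h hu => hin _ (hX.ge_of_mem_excTime hcd h hu)) T
    have hA : 0 ≤ (a + M) / a := by positivity
    have hB : 0 ≤ (a' + M') / a' := by positivity
    calc _ ≤ (a' + M') / a' * ((a + M) / a *
          ((a + M) / a * ((a' + M') / a')) ^ n) := h2.trans (by gcongr; exact h1.trans (by gcongr))
      _ = _ := by ring

/-- An upper bound for the probability of a late passage. -/
lemma IsPlaneMarkov.real_le_excTime_le [IsProbabilityMeasure P] (hX : IsPlaneMarkov F P X)
    {l E : ℝ} {n : ℕ} {T : ℝ≥0}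
    (h : ∫ ω, Real.exp (l * truncTime (excTime X c d n) T ω) ∂P ≤ E) :
    P.real {ω | (T : ℝ≥0∞) ≤ excTime X c d n ω} ≤ Real.exp (-l * T) * E := by
  have hi := (hX.isStop_excTime (c := c) (d := d) n).integrable_comp_truncTime (P := P) hX.le T
    (h := fun t => Real.exp (l * t)) (by fun_prop)
  have hm := mul_meas_ge_le_integral_of_nonneg (ae_of_all _ fun ω => (Real.exp_pos _).le) hi
    (Real.exp (l * T))
  have hsub : P.real {ω | (T : ℝ≥0∞) ≤ excTime X c d n ω} ≤
      P.real {ω | Real.exp (l * T) ≤ Real.exp (l * truncTime (excTime X c d n) T ω)} :=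
    measureReal_mono fun ω hω => by
      simp only [mem_ofPred_eq] at hω ⊢
      rw [truncTime_of_le hω]
  have e : Real.exp (-l * T) * Real.exp (l * T) = 1 := by rw [← Real.exp_add]; simp
  calc _ ≤ Real.exp (-l * T) * (Real.exp (l * T) *
        P.real {ω | Real.exp (l * T) ≤ Real.exp (l * truncTime (excTime X c d n) T ω)}) := by
        rw [← mul_assoc, e, one_mul]; exact hsub
    _ ≤ _ := by gcongr; exact hm.trans h

/-! ### Laplace transforms and the lower tail -/

/-- The Laplace transform of the passage times. -/
def excLaplace (P : Measure Ω) (X : ℝ≥0 → Ω → ℝ × ℝ) (c d l : ℝ) (T : ℝ≥0) (n : ℕ) : ℝ :=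
  ∫ ω, stoppedWeight (fun t => Real.exp (-l * t)) 0 (excTime X c d n) T ω ∂P

lemma stoppedWeight_exp_nonneg {l : ℝ} {T : ℝ≥0} {σ : Ω → ℝ≥0∞} (ω : Ω) :
    0 ≤ stoppedWeight (fun t => Real.exp (-l * t)) 0 σ T ω := by
  rcases le_or_gt (σ ω) T with h | h
  · rw [stoppedWeight_of_le h]; positivity
  · rw [stoppedWeight_of_lt h]

lemma IsPlaneMarkov.excLaplace_le_one [IsProbabilityMeasure P] (hX : IsPlaneMarkov F P X) {l : ℝ}
    (hl : 0 ≤ l) (T : ℝ≥0) (n : ℕ) : excLaplace P X c d l T n ≤ 1 := by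
  have h : ∫ _ω, (1 : ℝ) ∂P = 1 := by simp
  rw [← h]
  refine integral_mono ((hX.isStop_excTime n).integrable_stoppedWeight hX.le T
    (by fun_prop) 0) (integrable_const _) fun ω => ?_
  rcases le_or_gt (excTime X c d n ω) T with h | h
  · rw [stoppedWeight_of_le h]
    exact Real.exp_le_one_iff.mpr (by
      have : 0 ≤ l * (truncTime (excTime X c d n) T ω : ℝ) := by positivity
      linarith)
  · rw [stoppedWeight_of_lt h]; exact zero_le_one

/-- Only the wait for the circle is estimated; the crossing afterwards makes the time longer and is
discarded. -/
lemma IsPlaneMarkov.excLaplace_succ_le [IsProbabilityMeasure P] (hX : IsPlaneMarkov F P X)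
    {f g : ℝ × ℝ → ℝ} (hfg : GenPair f g) {l m₀ m₁ : ℝ} (hl : 0 ≤ l) (hm₁ : 0 < m₁)
    (hf : ∀ z, 0 ≤ f z) (hg : ∀ z, g z ≤ l * f z)
    (hcirc : ∀ z, latticeDistSq z = c → m₁ ≤ f z) (T : ℝ≥0) (n : ℕ)
    (h₀ : ∀ ω (u : ℝ≥0), excTime X c d n ω = u → f (X u ω) ≤ m₀) :
    excLaplace P X c d l T (n + 1) ≤ m₀ / m₁ * excLaplace P X c d l T n := by
  have h1 := integral_exp_neg_le hX hfg (hX.isStop_excTime (c := c) (d := d) n)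
    (hX.isStop_excHit n) (excTime_le_excHit n) hf hg h₀
    (fun ω u h => hcirc _ (hX.eq_of_excHit h)) T
  have h2 : excLaplace P X c d l T (n + 1) ≤
      ∫ ω, stoppedWeight (fun t => Real.exp (-l * t)) 0 (excHit X c d n) T ω ∂P := by
    refine integral_mono ((hX.isStop_excTime _).integrable_stoppedWeight hX.le T (by fun_prop) 0)
      ((hX.isStop_excHit _).integrable_stoppedWeight hX.le T (by fun_prop) 0) fun ω => ?_
    have hle := excHit_le_excTime (X := X) (c := c) (d := d) n ω
    rcases le_or_gt (excTime X c d (n + 1) ω) T with h | h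
    · simp only
      rw [stoppedWeight_of_le h, stoppedWeight_of_le (hle.trans h)]
      have : (truncTime (excHit X c d n) T ω : ℝ) ≤ truncTime (excTime X c d (n + 1)) T ω :=
        NNReal.coe_le_coe.mpr (truncTime_mono hle)
      refine Real.exp_le_exp.mpr ?_
      nlinarith
    · simp only
      rw [stoppedWeight_of_lt h]
      exact stoppedWeight_exp_nonneg ω
  rw [div_mul_eq_mul_div, le_div_iff₀ hm₁]
  calc _ ≤ m₁ * ∫ ω, stoppedWeight (fun t => Real.exp (-l * t)) 0 (excHit X c d n) T ω ∂P := by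
        rw [mul_comm]; gcongr
    _ ≤ _ := h1

/-- The Laplace transform of the passage times, from any starting point. -/
lemma IsPlaneMarkov.excLaplace_succ_le_pow [IsProbabilityMeasure P] (hX : IsPlaneMarkov F P X)
    {f g : ℝ × ℝ → ℝ} (hfg : GenPair f g) {l m₀ m₁ : ℝ} (hl : 0 ≤ l) (hm₀ : 0 ≤ m₀) (hm₁ : 0 < m₁)
    (hf : ∀ z, 0 ≤ f z) (hg : ∀ z, g z ≤ l * f z)
    (hcirc : ∀ z, latticeDistSq z = c → m₁ ≤ f z) (hfar : ∀ z, d ≤ latticeDistSq z → f z ≤ m₀)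
    (T : ℝ≥0) (n : ℕ) : excLaplace P X c d l T (n + 1) ≤ (m₀ / m₁) ^ n := by
  induction n with
  -- The first passage gets the trivial bound 1, since the start may be close to the circle. This is
  -- the lost factor: exponent `n` for `n + 1` passages.
  | zero => simpa using hX.excLaplace_le_one hl T 1
  | succ n ih =>
    refine (hX.excLaplace_succ_le hfg hl hm₁ hf hg hcirc T (n + 1)
      fun ω u h => hfar _ (hX.le_of_excTime_succ h)).trans ?_
    rw [pow_succ']
    gcongr

/-- The Laplace transform of the passage times, from a distant starting point. -/
lemma IsPlaneMarkov.excLaplace_le_pow [IsProbabilityMeasure P] (hX : IsPlaneMarkov F P X)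
    {z : ℝ × ℝ} (hz : ∀ ω, X 0 ω = z)
    {f g : ℝ × ℝ → ℝ} (hfg : GenPair f g) {l m₀ m₁ : ℝ} (hl : 0 ≤ l) (hm₀ : 0 ≤ m₀) (hm₁ : 0 < m₁)
    (hf : ∀ z, 0 ≤ f z) (hg : ∀ z, g z ≤ l * f z)
    (hcirc : ∀ z, latticeDistSq z = c → m₁ ≤ f z) (hfar : ∀ z, d ≤ latticeDistSq z → f z ≤ m₀)
    (hstart : f z ≤ m₀) (T : ℝ≥0) (n : ℕ) : excLaplace P X c d l T n ≤ (m₀ / m₁) ^ n := by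
  induction n with
  | zero => simpa using hX.excLaplace_le_one hl T 0
  | succ n ih =>
    refine (hX.excLaplace_succ_le hfg hl hm₁ hf hg hcirc T n fun ω u h => ?_).trans
      (by rw [pow_succ']; gcongr)
    cases n with
    | zero =>
      have h0 : (0 : ℝ≥0∞) = u := h
      have : u = 0 := by exact_mod_cast h0.symm
      rw [this, hz]; exact hstart
    | succ n => exact hfar _ (hX.le_of_excTime_succ h)

/-- An upper bound for the probability of an early passage. -/
lemma IsPlaneMarkov.real_excTime_le_le [IsProbabilityMeasure P] (hX : IsPlaneMarkov F P X)
    {l E : ℝ} (hl : 0 ≤ l) {n : ℕ} {T : ℝ≥0} (h : excLaplace P X c d l T n ≤ E) :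
    P.real {ω | excTime X c d n ω ≤ T} ≤ Real.exp (l * T) * E := by
  have hi := (hX.isStop_excTime (c := c) (d := d) n).integrable_stoppedWeight (P := P) hX.le T
    (w := fun t => Real.exp (-l * t)) (by fun_prop) 0
  have hm := mul_meas_ge_le_integral_of_nonneg (ae_of_all _ fun ω => stoppedWeight_exp_nonneg ω) hi
    (Real.exp (-l * T))
  have hsub : P.real {ω | excTime X c d n ω ≤ T} ≤ P.real {ω | Real.exp (-l * T) ≤
      stoppedWeight (fun t => Real.exp (-l * t)) 0 (excTime X c d n) T ω} :=
    measureReal_mono fun ω hω => by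
      simp only [mem_ofPred_eq] at hω ⊢
      rw [stoppedWeight_of_le hω]
      have : (truncTime (excTime X c d n) T ω : ℝ) ≤ T := NNReal.coe_le_coe.mpr truncTime_le
      refine Real.exp_le_exp.mpr ?_
      nlinarith
  have e : Real.exp (l * T) * Real.exp (-l * T) = 1 := by rw [← Real.exp_add]; simp
  calc _ ≤ Real.exp (l * T) * (Real.exp (-l * T) * P.real {ω | Real.exp (-l * T) ≤
        stoppedWeight (fun t => Real.exp (-l * t)) 0 (excTime X c d n) T ω}) := by
        rw [← mul_assoc, e, one_mul]; exact hsub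
    _ ≤ _ := by gcongr; exact hm.trans h

/-! ### Comparison of a few passages with a Poisson process -/

lemma stoppedWeight_mono_time {w : ℝ → ℝ} {T : ℝ≥0} {σ τ : Ω → ℝ≥0∞} {ω : Ω} (h : σ ω ≤ τ ω)
    (hw : MonotoneOn w (Icc 0 T)) (hw1 : ∀ t ∈ Icc (0 : ℝ) T, w t ≤ 1) :
    stoppedWeight w 1 σ T ω ≤ stoppedWeight w 1 τ T ω := by
  have hmem : ∀ ρ : Ω → ℝ≥0∞, (truncTime ρ T ω : ℝ) ∈ Icc (0 : ℝ) T := fun ρ =>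
    ⟨NNReal.coe_nonneg _, NNReal.coe_le_coe.mpr truncTime_le⟩
  rcases le_or_gt (τ ω) T with ht | ht
  · rw [stoppedWeight_of_le ht, stoppedWeight_of_le (h.trans ht)]
    exact hw (hmem _) (hmem _) (NNReal.coe_le_coe.mpr (truncTime_mono h))
  · rw [stoppedWeight_of_lt ht]
    rcases le_or_gt (σ ω) T with hs | hs
    · rw [stoppedWeight_of_le hs]
      exact hw1 _ (hmem _)
    · rw [stoppedWeight_of_lt hs]

/-- Comparison of the passage times with a Poisson process of rate `l`. -/
lemma IsPlaneMarkov.integral_poissonCdfLt_le [IsProbabilityMeasure P] (hX : IsPlaneMarkov F P X)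
    (hcd : c ≤ d) {φ g : ℝ × ℝ → ℝ} (hφ : GenPair φ g) {l e₀ e₁ : ℝ} (hl : 0 ≤ l) (he₀ : 0 ≤ e₀)
    (he₁ : 0 ≤ e₁) (hφ1 : ∀ z, φ z ≤ 1) (hreg : ∀ z, c ≤ latticeDistSq z → 0 ≤ l * φ z + g z)
    (hfar : ∀ z, d ≤ latticeDistSq z → 1 - e₀ ≤ φ z)
    (hcirc : ∀ z, latticeDistSq z = c → φ z ≤ e₁) (T : ℝ≥0) (k j : ℕ) :
    ∫ ω, stoppedWeight (fun s => poissonCdfLt k (l * (T - s))) 1 (excTime X c d (j + 1)) T ω ∂P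
      - k * (e₀ + e₁) ≤ P.real {ω | (T : ℝ≥0∞) < excTime X c d (j + 1 + k) ω} := by
  induction k generalizing j with
  | zero =>
    have hms : MeasurableSet {ω | (T : ℝ≥0∞) < excTime X c d (j + 1) ω} := by
      have := (hX.le T _ (hX.isStop_excTime (c := c) (d := d) (j + 1) T)).compl
      convert this using 1
      ext ω; simp
    rw [Nat.cast_zero, zero_mul, sub_zero, add_zero, ← integral_indicator_one hms]
    refine (integral_congr_ae (ae_of_all _ fun ω => ?_)).le
    rcases le_or_gt (excTime X c d (j + 1) ω) T with h | h
    · rw [stoppedWeight_of_le h, poissonCdfLt_zero, indicator_of_notMem (by simpa using h)]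
    · rw [stoppedWeight_of_lt h, indicator_of_mem (by simpa using h), Pi.one_apply]
  | succ k ih =>
    refine le_trans ?_ ((ih (j + 1)).trans (le_of_eq (by congr 3; ext; ring_nf)))
    have hu : ∀ t ∈ Icc (0 : ℝ) T, 0 ≤ l * (T - t) := fun t ht =>
      mul_nonneg hl (sub_nonneg.mpr ht.2)
    have hder : ∀ (m : ℕ) (t : ℝ), HasDerivAt (fun s => poissonCdfLt (m + 1) (l * (T - s)))
        (l * (poissonCdfLt (m + 1) (l * (T - t)) - poissonCdfLt m (l * (T - t)))) t := fun m t => by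
      have h := (hasDerivAt_poissonCdfLt_succ m (l * (T - t))).comp t
        (((hasDerivAt_id t).const_sub (T : ℝ)).const_mul l)
      refine h.congr_deriv ?_
      ring
    -- The derivative formula for index `k` involves `k - 1`, so the vanishing weight for k = 0 is
    -- treated apart.
    have hder' : ∃ w' : ℝ → ℝ, Continuous w' ∧ (∀ t, HasDerivAt
        (fun s => poissonCdfLt k (l * (T - s))) (w' t) t) ∧
        ∀ t ∈ Icc (0 : ℝ) T, 0 ≤ w' t := by
      cases k with
      | zero =>
        refine ⟨fun _ => 0, continuous_const, fun t => ?_, fun _ _ => le_rfl⟩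
        simpa [poissonCdfLt_zero] using hasDerivAt_const t (0 : ℝ)
      | succ m =>
        refine ⟨_, ?_, hder m, fun t ht => mul_nonneg hl
          (sub_nonneg.mpr (poissonCdfLt_le_succ m (hu t ht)))⟩
        have := continuous_poissonCdfLt m
        have := continuous_poissonCdfLt (m + 1)
        fun_prop
    obtain ⟨w', hw'c, hw', hw'0⟩ := hder'
    have hc1 := continuous_poissonCdfLt k
    have hc2 := continuous_poissonCdfLt (k + 1)
    have h1 := integral_stoppedWeight_sub_le hX hφ (hder k) hw' (by fun_prop) hw'c he₀ he₁
      (hX.isStop_excTime (c := c) (d := d) (j + 1)) (hX.isStop_excHit (j + 1))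
      (excTime_le_excHit (j + 1)) (T := T) hφ1
      (fun t ht => ⟨poissonCdfLt_nonneg k (hu t ht), poissonCdfLt_le_succ k (hu t ht),
        poissonCdfLt_le_one _ (hu t ht)⟩)
      (fun ω u h1 h2 h3 => by
        have ht : (u : ℝ) ∈ Icc (0 : ℝ) T := ⟨u.2, NNReal.coe_le_coe.mpr h3⟩
        -- Since w₀' = l(w₀ - w₁), the drift of the subsolution is w₁'(1 - φ) + (w₀ - w₁)(lφ + g), a
        -- sum of two nonnegative terms.
        have k1 := hreg _ (hX.le_of_mem_excHit hcd h1 h2)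
        have k2 := mul_nonneg (hw'0 u ht) (sub_nonneg.mpr (hφ1 (X u ω)))
        have k3 := mul_nonneg (sub_nonneg.mpr (poissonCdfLt_le_succ k (hu u ht))) k1
        linarith)
      (fun ω u h => hfar _ (hX.le_of_excTime_succ h))
      (fun ω u h => hcirc _ (hX.eq_of_excHit h))
    have h2 : ∫ ω, stoppedWeight (fun s => poissonCdfLt k (l * (T - s))) 1
        (excHit X c d (j + 1)) T ω ∂P ≤ ∫ ω, stoppedWeight
        (fun s => poissonCdfLt k (l * (T - s))) 1 (excTime X c d (j + 1 + 1)) T ω ∂P := by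
      refine integral_mono ((hX.isStop_excHit _).integrable_stoppedWeight hX.le T (by fun_prop) 1)
        ((hX.isStop_excTime _).integrable_stoppedWeight hX.le T (by fun_prop) 1) fun ω => ?_
      refine stoppedWeight_mono_time (excHit_le_excTime _ _) (fun s hs t ht hst => ?_)
        fun t ht => poissonCdfLt_le_one _ (hu t ht)
      exact antitoneOn_poissonCdfLt k (hu t ht) (hu s hs) (by gcongr)
    push_cast
    linarith

/-- A lower bound for the probability of a late passage. -/
lemma IsPlaneMarkov.poissonCdfLt_sub_le [IsProbabilityMeasure P] (hX : IsPlaneMarkov F P X)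
    (hcd : c ≤ d) {φ g : ℝ × ℝ → ℝ} (hφ : GenPair φ g) {l e₀ e₁ : ℝ} (hl : 0 ≤ l) (he₀ : 0 ≤ e₀)
    (he₁ : 0 ≤ e₁) (hφ1 : ∀ z, φ z ≤ 1) (hreg : ∀ z, c ≤ latticeDistSq z → 0 ≤ l * φ z + g z)
    (hfar : ∀ z, d ≤ latticeDistSq z → 1 - e₀ ≤ φ z)
    (hcirc : ∀ z, latticeDistSq z = c → φ z ≤ e₁) (T : ℝ≥0) (k : ℕ) :
    poissonCdfLt k (l * T) - k * (e₀ + e₁) ≤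
      P.real {ω | (T : ℝ≥0∞) < excTime X c d (k + 1) ω} := by
  refine le_trans ?_ ((hX.integral_poissonCdfLt_le hcd hφ hl he₀ he₁ hφ1 hreg hfar hcirc T k
    0).trans (le_of_eq (by congr 3; ext; ring_nf)))
  gcongr
  have hc := continuous_poissonCdfLt k
  have h : ∫ _ω, poissonCdfLt k (l * T) ∂P = poissonCdfLt k (l * T) := by simp
  rw [← h]
  refine integral_mono (integrable_const _)
    ((hX.isStop_excTime _).integrable_stoppedWeight hX.le T (by fun_prop) 1) fun ω => ?_
  rcases le_or_gt (excTime X c d (0 + 1) ω) T with h | h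
  · simp only
    rw [stoppedWeight_of_le h]
    have h1 : (truncTime (excTime X c d (0 + 1)) T ω : ℝ) ≤ T := NNReal.coe_le_coe.mpr truncTime_le
    refine antitoneOn_poissonCdfLt k (mem_Ici.mpr (mul_nonneg hl (sub_nonneg.mpr h1)))
      (mem_Ici.mpr (by positivity)) ?_
    have : (0 : ℝ) ≤ truncTime (excTime X c d (0 + 1)) T ω := NNReal.coe_nonneg _
    gcongr
    linarith
  · simp only
    rw [stoppedWeight_of_lt h]
    exact poissonCdfLt_le_one _ (by positivity)

end

/-! ### Numerical inequalities -/

lemma log_one_add_lt {δ : ℝ} (h₀ : 0 < δ) (h₁ : δ < 1 / 2) :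
    Real.log (1 + δ) < δ - δ ^ 2 / 8 := by
  rw [Real.log_lt_iff_lt_exp (by linarith)]
  have hx : 0 ≤ δ - δ ^ 2 / 8 := by nlinarith
  refine lt_of_lt_of_le ?_ (Real.quadratic_le_exp_of_nonneg hx)
  have h : δ / 2 < δ - δ ^ 2 / 8 := by nlinarith
  nlinarith [mul_pos h₀ h₀, mul_self_lt_mul_self (by positivity) h]

lemma lt_neg_log_one_sub {δ : ℝ} (h₀ : 0 < δ) (h₁ : δ < 1 / 2) :
    δ + δ ^ 2 / 2 + δ ^ 3 / 3 ≤ -Real.log (1 - δ) := by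
  have h := sum_le_hasSum (Finset.range 3) (fun i _ => by positivity)
    (Real.hasSum_pow_div_log_of_abs_lt_one (x := δ) (by rw [abs_of_pos h₀]; linarith))
  norm_num [Finset.sum_range_succ] at h
  linarith

/-- The room in the lower-tail rate that pays for one lost factor 1 - δ as soon as nδ ≥ 4. -/
lemma lt_mul_neg_log_one_sub {δ : ℝ} (h₀ : 0 < δ) (h₁ : δ < 1 / 2) :
    4 * (δ + δ ^ 2 / 4) < (4 - δ) * -Real.log (1 - δ) := by
  have h := mul_le_mul_of_nonneg_left (lt_neg_log_one_sub h₀ h₁) (by linarith : 0 ≤ 4 - δ)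
  have h3 : 0 < δ ^ 3 := by positivity
  nlinarith

/-! ### A lower bound for Poisson distribution functions -/

/-- The factorial moments of orders 0, 1 and 2 of the Poisson law, as needed for Cantelli's
inequality. -/
lemma hasSum_poisson_quadratic (t A B D : ℝ) :
    HasSum (fun i : ℕ => Real.exp (-t) * t ^ i / i.factorial * (A + B * i + D * (i * (i - 1))))
      (A + B * t + D * t ^ 2) := by
  have h0 : HasSum (fun i : ℕ => t ^ i / i.factorial) (Real.exp t) := by
    rw [Real.exp_eq_exp_ℝ]; exact NormedSpace.expSeries_div_hasSum_exp t
  have h1 : HasSum (fun i : ℕ => t ^ i / i.factorial * i) (Real.exp t * t) := by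
    rw [← hasSum_nat_add_iff' 1]
    simp only [Finset.range_one, Finset.sum_singleton, Nat.cast_zero, mul_zero, sub_zero]
    refine (h0.mul_right t).congr_fun fun i => ?_
    rw [Nat.factorial_succ]
    push_cast
    field_simp
    ring
  have h2 : HasSum (fun i : ℕ => t ^ i / i.factorial * (i * (i - 1))) (Real.exp t * t ^ 2) := by
    rw [← hasSum_nat_add_iff' 2]
    simp only [Finset.sum_range_succ, Finset.range_zero, Finset.sum_empty, Nat.cast_zero,
      Nat.cast_one, sub_self, mul_zero, zero_mul, sub_zero, add_zero]
    refine (h0.mul_right (t ^ 2)).congr_fun fun i => ?_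
    rw [Nat.factorial_succ, Nat.factorial_succ]
    push_cast
    field_simp
    ring
  have h := (((h0.mul_left A).add (h1.mul_left B)).add (h2.mul_left D)).mul_left (Real.exp (-t))
  have e : Real.exp (-t) * Real.exp t = 1 := by rw [← Real.exp_add]; simp
  have hv : A + B * t + D * t ^ 2 = Real.exp (-t) *
      (A * Real.exp t + B * (Real.exp t * t) + D * (Real.exp t * t ^ 2)) := by
    linear_combination -(A + B * t + D * t ^ 2) * e
  rw [hv]
  exact h.congr_fun fun i => by ring

/-- Cantelli's inequality for the Poisson distribution. -/
lemma le_poissonCdfLt {t : ℝ} {k : ℕ} (ht : 0 ≤ t) (hk : t < k) :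
    (k - t) ^ 2 / (t + (k - t) ^ 2) ≤ poissonCdfLt k t := by
  set s : ℝ := k - t with hs
  have hs0 : 0 < s := by linarith
  -- The indicator of i < k is at least 1 - (i - t + v)²/(s + v)² for every v ≥ 0; variance over s
  -- is the optimal shift.
  set v : ℝ := t / s with hv
  have hv0 : 0 ≤ v := by positivity
  have hsum := hasSum_poisson_quadratic t (1 - (v - t) ^ 2 / (s + v) ^ 2)
    (-(1 + 2 * (v - t)) / (s + v) ^ 2) (-1 / (s + v) ^ 2)
  have hterm : ∀ i : ℕ, 1 - (v - t) ^ 2 / (s + v) ^ 2 + -(1 + 2 * (v - t)) / (s + v) ^ 2 * i +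
      -1 / (s + v) ^ 2 * (i * (i - 1)) = 1 - (i - t + v) ^ 2 / (s + v) ^ 2 := fun i => by
    field_simp; ring
  simp only [hterm] at hsum
  have hval : 1 - (v - t) ^ 2 / (s + v) ^ 2 + -(1 + 2 * (v - t)) / (s + v) ^ 2 * t +
      -1 / (s + v) ^ 2 * t ^ 2 = s ^ 2 / (t + s ^ 2) := by
    have h1 : t = v * s := by rw [hv]; field_simp
    have h2 : v * s + s ^ 2 = s * (s + v) := by ring
    rw [h1, h2]
    field_simp
    ring
  rw [hval] at hsum
  have hle : s ^ 2 / (t + s ^ 2) ≤ ∑ i ∈ Finset.range k, Real.exp (-t) * t ^ i / i.factorial *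
      (1 - (i - t + v) ^ 2 / (s + v) ^ 2) := by
    have := sum_le_hasSum (Finset.range k) (fun i hi => ?_) hsum.neg
    · simp only [Finset.sum_neg_distrib] at this
      linarith
    · have hi' : (k : ℝ) ≤ i := by exact_mod_cast not_lt.mp fun h => hi (Finset.mem_range.mpr h)
      have : 1 ≤ (i - t + v) ^ 2 / (s + v) ^ 2 := by
        rw [one_le_div (by positivity)]
        have : s + v ≤ i - t + v := by linarith
        gcongr
      have hw : 0 ≤ Real.exp (-t) * t ^ i / i.factorial := by positivity
      nlinarith
  refine hle.trans (Finset.sum_le_sum fun i _ => ?_)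
  have hw : 0 ≤ Real.exp (-t) * t ^ i / i.factorial := by positivity
  have : 0 ≤ (i - t + v) ^ 2 / (s + v) ^ 2 := by positivity
  nlinarith

/-- The Stirling sequence decreases from its value e/√2 at 1, hence k! ≤ e √k (k/e)^k. -/
lemma one_div_le_exp_mul_pow_div_factorial {k : ℕ} (hk : k ≠ 0) :
    1 / (Real.exp 1 * √k) ≤ Real.exp (-k) * k ^ k / k.factorial := by
  obtain ⟨m, rfl⟩ := Nat.exists_eq_succ_of_ne_zero hk
  have h := Stirling.stirlingSeq'_antitone (Nat.zero_le m)
  simp only [Function.comp_apply, Nat.succ_eq_add_one, zero_add, Stirling.stirlingSeq_one] at h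
  rw [Stirling.stirlingSeq] at h
  have hm : (0 : ℝ) < ((m + 1 : ℕ) : ℝ) := by positivity
  set x : ℝ := ((m + 1 : ℕ) : ℝ) with hx
  have hsq : 0 < √x := Real.sqrt_pos.mpr hm
  rw [Real.sqrt_mul (by norm_num), div_le_div_iff₀ (by positivity) (by positivity), div_pow,
    ← Real.exp_nat_mul, mul_one, ← hx] at h
  have h2 : (0 : ℝ) < √2 := by positivity
  have h3 : ((m + 1).factorial : ℝ) ≤ Real.exp 1 * (√x * (x ^ (m + 1) / Real.exp x)) := by
    have : √2 * ((m + 1).factorial : ℝ) ≤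
        √2 * (Real.exp 1 * (√x * (x ^ (m + 1) / Real.exp x))) := by linarith
    exact le_of_mul_le_mul_left this h2
  rw [Nat.succ_eq_add_one, div_le_div_iff₀ (by positivity) (by positivity), one_mul,
    Real.exp_neg]
  refine h3.trans (le_of_eq ?_)
  field_simp

lemma exp_one_mul_sqrt_le {n : ℕ} (hn : 2 ≤ n) : Real.exp 1 * √n ≤ 4 * (n - 1) := by
  have hn' : (2 : ℝ) ≤ n := by exact_mod_cast hn
  have he := Real.exp_one_lt_d9
  have he0 := Real.exp_pos 1
  have hs := Real.sq_sqrt (by linarith : (0 : ℝ) ≤ n)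
  refine abs_le_of_sq_le_sq' ?_ (by linarith) |>.2
  rw [mul_pow, hs]
  have : Real.exp 1 ^ 2 ≤ 8 := by nlinarith
  nlinarith

lemma exp_one_mul_sqrt_le_two_mul {n : ℕ} (hn : 2 ≤ n) : Real.exp 1 * √n ≤ 2 * n := by
  have hn' : (2 : ℝ) ≤ n := by exact_mod_cast hn
  have he := Real.exp_one_lt_d9
  have he0 := Real.exp_pos 1
  have hs := Real.sq_sqrt (by linarith : (0 : ℝ) ≤ n)
  refine abs_le_of_sq_le_sq' ?_ (by linarith) |>.2
  rw [mul_pow, hs]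
  have : Real.exp 1 ^ 2 ≤ 8 := by nlinarith
  nlinarith

lemma poisson_term_pred {k : ℕ} (t : ℝ) (ht : t ≠ 0) :
    Real.exp (-t) * t ^ k / k.factorial =
      Real.exp (-t) * t ^ (k + 1) / (k + 1).factorial * ((k + 1) / t) := by
  rw [Nat.factorial_succ]
  push_cast
  field_simp
  ring

lemma le_poissonCdfLt_of_lt_four {δ : ℝ} {k : ℕ} (h₀ : 0 < δ) (h₁ : δ < 1 / 2) (hk : 1 ≤ k)
    (h4 : (k + 1) * δ < 4) :
    (k + 1) * δ ^ 2 / 4 ≤ poissonCdfLt k ((1 - δ) * (k + 1)) := by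
  have hk' : (1 : ℝ) ≤ k := by exact_mod_cast hk
  set c : ℝ := (k + 1) * δ with hc
  have hc0 : 0 < c := by positivity
  have hce : (k + 1) * δ ^ 2 / 4 = c ^ 2 / (4 * (k + 1)) := by rw [hc]; field_simp
  have ht : (1 - δ) * (k + 1) = k + 1 - c := by rw [hc]; ring
  have ht0 : 0 ≤ k + 1 - c := by nlinarith
  rw [hce, ht]
  -- For c ≥ 2 the mean k + 1 - c lies far enough below `k` for Cantelli's inequality.
  rcases le_or_gt 2 c with h2 | h2
  · refine le_trans ?_ (le_poissonCdfLt (k := k) ht0 (by linarith))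
    have e : (k : ℝ) - (k + 1 - c) = c - 1 := by ring
    rw [e, div_le_div_iff₀ (by positivity) (by nlinarith)]
    have h5 : c ^ 2 / 4 ≤ (c - 1) ^ 2 := by nlinarith
    have h6 : c ^ 2 * (k + 1 - c) ≤ 4 * (c - 1) ^ 2 * (k + 1 - c) := by nlinarith
    nlinarith [mul_nonneg (sub_nonneg.mpr h4.le) hc0.le, sq_nonneg (c - 1)]
  -- For 1 ≤ c < 2 the mean is at most `k`. By monotonicity it is raised to `k`, and the two top
  -- terms i = k - 1 and i = k - 2 suffice.
  rcases le_or_gt 1 c with h3 | h3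
  · have hk2 : 2 ≤ k := by
      by_contra! h
      have : k = 1 := by omega
      subst this
      rw [hc] at h3
      push_cast at h3
      linarith
    have hk2' : (2 : ℝ) ≤ k := by exact_mod_cast hk2
    refine le_trans ?_ (antitoneOn_poissonCdfLt k (mem_Ici.mpr ht0)
      (mem_Ici.mpr (by positivity : (0 : ℝ) ≤ k)) (by linarith))
    obtain ⟨m, rfl⟩ : ∃ m, k = m + 2 := ⟨k - 2, by omega⟩
    have hS := one_div_le_exp_mul_pow_div_factorial (k := m + 2) (by omega)
    have hE := exp_one_mul_sqrt_le_two_mul hk2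
    have hz : ((m + 2 : ℕ) : ℝ) ≠ 0 := by positivity
    rw [poissonCdfLt_succ, poissonCdfLt_succ, poisson_term_pred (k := m) _ hz,
      poisson_term_pred (k := m + 1) _ hz]
    have hP := poissonCdfLt_nonneg m (by positivity : (0 : ℝ) ≤ ((m + 2 : ℕ) : ℝ))
    set S : ℝ := Real.exp (-((m + 2 : ℕ) : ℝ)) * ((m + 2 : ℕ) : ℝ) ^ (m + 2) /
      (m + 2).factorial with hSdef
    set x : ℝ := ((m + 2 : ℕ) : ℝ) with hx
    have hm : (m : ℝ) = x - 2 := by rw [hx]; push_cast; ring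
    have hS2 : 1 / (2 * x) ≤ S :=
      (one_div_le_one_div_of_le (by positivity) hE).trans hS
    push_cast
    rw [hm]
    have e1 : (x - 2 + 1 + 1) / x = 1 := by rw [div_eq_one_iff_eq hz]; ring
    have hb : c ^ 2 / (4 * (x + 1)) ≤ 1 / (x + 1) := by
      rw [div_le_div_iff₀ (by positivity) (by positivity)]
      nlinarith
    have hlow : 1 / (x + 1) ≤ 1 / (2 * x) * ((x - 2 + 1) / x) + 1 / (2 * x) := by
      rw [div_mul_div_comm, div_add_div _ _ (by positivity) (by positivity),
        div_le_div_iff₀ (by positivity) (by positivity)]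
      nlinarith [mul_nonneg (sub_nonneg.mpr hk2') (sub_nonneg.mpr hk2'), mul_nonneg
        (mul_nonneg (sub_nonneg.mpr hk2') (sub_nonneg.mpr hk2')) (sub_nonneg.mpr hk2')]
    have hx1 : 0 ≤ (x - 2 + 1) / x := div_nonneg (by linarith) (by linarith)
    have h8 := mul_le_mul_of_nonneg_right hS2 hx1
    have e2 : S * ((x - 2 + 1 + 1) / x) = S := by rw [e1, mul_one]
    have goal_eq : S * ((x - 2 + 1 + 1) / x) * ((x - 2 + 1) / x) = S * ((x - 2 + 1) / x) := by
      rw [e2]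
    linarith
  -- For c < 1 the mean is raised to `k + 1`, and the single top term i = k - 1 is at least
  -- 1/(4(k+1)).
  · refine le_trans ?_ (antitoneOn_poissonCdfLt k (mem_Ici.mpr ht0)
      (mem_Ici.mpr (by positivity : (0 : ℝ) ≤ ((k + 1 : ℕ) : ℝ))) (by push_cast; linarith))
    obtain ⟨m, rfl⟩ : ∃ m, k = m + 1 := ⟨k - 1, by omega⟩
    have hS := one_div_le_exp_mul_pow_div_factorial (k := m + 1 + 1) (by omega)
    have hE := exp_one_mul_sqrt_le (n := m + 1 + 1) (by omega)
    have hz : ((m + 1 + 1 : ℕ) : ℝ) ≠ 0 := by positivity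
    rw [poissonCdfLt_succ, poisson_term_pred (k := m) _ hz, poisson_term_pred (k := m + 1) _ hz]
    have hP := poissonCdfLt_nonneg m (by positivity : (0 : ℝ) ≤ ((m + 1 + 1 : ℕ) : ℝ))
    set S : ℝ := Real.exp (-((m + 1 + 1 : ℕ) : ℝ)) * ((m + 1 + 1 : ℕ) : ℝ) ^ (m + 1 + 1) /
      (m + 1 + 1).factorial with hSdef
    set x : ℝ := ((m + 1 + 1 : ℕ) : ℝ) with hx
    have hm : (m : ℝ) = x - 2 := by rw [hx]; push_cast; ring
    have hx2 : 2 ≤ x := by rw [hx]; push_cast; linarith [(Nat.cast_nonneg m : (0 : ℝ) ≤ m)]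
    have hS2 : 1 / (4 * (x - 1)) ≤ S :=
      (one_div_le_one_div_of_le (by positivity) hE).trans hS
    push_cast
    rw [hm]
    have e1 : (x - 2 + 1 + 1) / x = 1 := by rw [div_eq_one_iff_eq hz]; ring
    rw [e1, mul_one]
    have e3 : x - 2 + 1 = x - 1 := by ring
    rw [e3, sub_add_cancel]
    have hb : c ^ 2 / (4 * x) ≤ 1 / (4 * x) := by gcongr; nlinarith
    have hx1 : 0 < x - 1 := by linarith
    have h8 := mul_le_mul_of_nonneg_right hS2 (by positivity : 0 ≤ (x - 1) / x)
    have e4 : 1 / (4 * (x - 1)) * ((x - 1) / x) = 1 / (4 * x) := by field_simp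
    linarith

/-! ### Asymptotic estimates for small radii -/

/-- The mean duration of an excursion from radius `r`, up to a bounded error. -/
def logScale (r : ℝ) : ℝ := 1 / Real.pi * Real.log (1 / r)

lemma tendsto_logScale : Tendsto logScale (𝓝[>] 0) atTop := by
  have h : logScale = fun r => 1 / Real.pi * -Real.log r := by
    ext r; rw [logScale, one_div r, Real.log_inv]
  rw [h]
  exact (tendsto_neg_atBot_atTop.comp Real.tendsto_log_nhdsGT_zero).const_mul_atTop
    (by positivity)

lemma logScale_nonneg {r : ℝ} (h₀ : 0 < r) (h₁ : r ≤ 1) : 0 ≤ logScale r :=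
  mul_nonneg (by positivity) (Real.log_nonneg (by rw [le_div_iff₀ h₀]; linarith))

lemma logScale_sub {R r : ℝ} (hR : 0 < R) (hr : 0 < r) :
    1 / Real.pi * Real.log (R / r) = logScale r - logScale R := by
  rw [logScale, logScale, one_div r, one_div R, Real.log_inv, Real.log_inv,
    Real.log_div hR.ne' hr.ne']
  ring

lemma half_sub_norm_le (a : ℝ) :
    1 / 2 - ‖(a : UnitAddCircle)‖ ≤ ‖((a - 1 / 2 : ℝ) : UnitAddCircle)‖ := by
  have h : ‖((1 / 2 : ℝ) : UnitAddCircle)‖ = 1 / 2 := by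
    rw [UnitAddCircle.norm_eq]
    norm_num [round_eq]
  have h2 := norm_sub_le (a : UnitAddCircle) ((a - 1 / 2 : ℝ) : UnitAddCircle)
  rw [← AddCircle.coe_sub, sub_sub_cancel, h] at h2
  linarith

lemma le_latticeDistSq_sub_half {z : ℝ × ℝ} (hz : latticeDistSq z ≤ 1 / 4) :
    1 / 32 ≤ latticeDistSq (z - (1 / 2, 1 / 2)) := by
  have h1 := half_sub_norm_le z.1
  have h2 := half_sub_norm_le z.2
  unfold latticeDistSq at hz ⊢
  simp only [Prod.fst_sub, Prod.snd_sub]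
  set a := ‖(z.1 : UnitAddCircle)‖
  set b := ‖(z.2 : UnitAddCircle)‖
  set a' := ‖((z.1 - 1 / 2 : ℝ) : UnitAddCircle)‖
  set b' := ‖((z.2 - 1 / 2 : ℝ) : UnitAddCircle)‖
  have h3 : a + b ≤ 3 / 4 := by nlinarith [sq_nonneg (a - b), norm_nonneg (z.1 : UnitAddCircle)]
  nlinarith [sq_nonneg (a' - b'), norm_nonneg ((z.1 - 1 / 2 : ℝ) : UnitAddCircle)]

/-! ### Upper tail for small radii -/

/-- A bounded function, nonnegative on the ball of radius `1 / 2`, with strictly negative Laplacian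
there. -/
lemma exists_genPair_ball : ∃ (f g : ℝ × ℝ → ℝ) (K : ℝ), GenPair f g ∧ 0 ≤ K ∧
    ∀ z, latticeDistSq z ≤ 1 / 4 → 0 ≤ f z ∧ f z ≤ K ∧ g z ≤ -(1 / 2) := by
  obtain ⟨C, hC, hp⟩ := exists_torusHeat_pow_four_le
  -- The pole of the Green function is moved to the opposite corner (1/2, 1/2), at squared distance
  -- at least 1/32 ≥ r² from the ball; the second bound on r gives C r² ≤ 1/2.
  set r : ℝ := min (1 / 6) (1 / (2 * (C + 1))) with hr
  have hr0 : 0 < r := by positivity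
  have hr1 : r ≤ 1 / 6 := min_le_left _ _
  have hr2 : r ≤ 1 / (2 * (C + 1)) := min_le_right _ _
  have hCr : C * r ^ 2 ≤ 1 / 2 := by
    have h1 : C * r ^ 2 ≤ C * r := by nlinarith [mul_nonneg hC hr0.le]
    have h2 : r * (2 * (C + 1)) ≤ 1 := (le_div_iff₀ (by positivity)).mp hr2
    nlinarith
  have hε : 0 < r ^ 4 := by positivity
  set K := torusGreen (r ^ 4) 0 with hK
  have hK0 : 0 ≤ K := (abs_nonneg _).trans (abs_torusGreen_le hε 0)
  refine ⟨_, _, 2 * K, (GenPair.const K).add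
    (((genPair_torusGreen hε).comp_sub (1 / 2, 1 / 2)).const_mul (-1)), by positivity,
    fun z hz => ?_⟩
  have hV := abs_le.mp (abs_torusGreen_le hε (z - (1 / 2, 1 / 2)))
  have hP := hp r ⟨hr0, by linarith⟩ (z - (1 / 2, 1 / 2))
    (le_trans (by nlinarith) (le_latticeDistSq_sub_half hz))
  refine ⟨by linarith, by linarith, by linarith⟩

lemma eventually_real_le_excTime_le {δ R : ℝ} (hδ : δ ∈ Ioo (0 : ℝ) (1 / 2))
    (hR : R ∈ Ioo (0 : ℝ) (1 / 2)) : ∀ᶠ r in 𝓝[>] (0 : ℝ), ∀ (Ω : Type u) [MeasurableSpace Ω]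
      (P : Measure Ω) [IsProbabilityMeasure P] (F : ℝ≥0 → MeasurableSpace Ω)
      (X : ℝ≥0 → Ω → ℝ × ℝ) (z : ℝ × ℝ), IsPlaneMarkov F P X → (∀ ω, X 0 ω = z) → ∀ (n : ℕ) (T : ℝ≥0),
      (T : ℝ) = (1 + δ) * n * (1 / Real.pi) * Real.log (R / r) →
      P.real {ω | (T : ℝ≥0∞) ≤ excTime X (r ^ 2) (R ^ 2) n ω} ≤
        Real.exp (-(n : ℝ) * (δ ^ 2 / 8)) := by
  obtain ⟨C, hC, hV1, hV2, -⟩ := exists_torusGreen_bounds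
  obtain ⟨C', hC', hp⟩ := exists_torusHeat_pow_four_le
  obtain ⟨f', g', K, hfg', hK, hin⟩ := exists_genPair_ball
  obtain ⟨hδ0, hδ1⟩ := hδ
  set θ : ℝ := (1 + δ) / δ with hθ
  have hθ0 : 1 < θ := by rw [hθ, lt_div_iff₀ hδ0]; linarith
  have hdiv : ∀ c : ℝ, Tendsto (fun r => c / logScale r) (𝓝[>] 0) (𝓝 0) := fun c =>
    tendsto_logScale.const_div_atTop c
  have hκ : Tendsto (fun r : ℝ => (1 - C' * r ^ 2) * θ) (𝓝[>] 0) (𝓝 θ) := by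
    have : ContinuousAt (fun r : ℝ => (1 - C' * r ^ 2) * θ) 0 := by fun_prop
    simpa [ContinuousAt] using this.tendsto.mono_left nhdsWithin_le_nhds
  have hxA : Tendsto (fun r => (1 - C' * r ^ 2) * θ - (1 + 2 * C / logScale r)) (𝓝[>] 0)
      (𝓝 (θ - 1)) := by simpa using hκ.sub ((hdiv (2 * C)).const_add 1)
  have hxB : Tendsto (fun r => θ / 2 - K / logScale r) (𝓝[>] 0) (𝓝 (θ / 2)) := by
    simpa using (hdiv K).const_sub (θ / 2)
  have hA : Tendsto (fun r => (1 - C' * r ^ 2) * θ /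
      ((1 - C' * r ^ 2) * θ - (1 + 2 * C / logScale r))) (𝓝[>] 0) (𝓝 (1 + δ)) := by
    have e : θ / (θ - 1) = 1 + δ := by rw [hθ]; field_simp; ring
    rw [← e]
    exact hκ.div hxA (by linarith)
  have hB : Tendsto (fun r => θ / 2 / (θ / 2 - K / logScale r)) (𝓝[>] 0) (𝓝 1) := by
    have e : θ / 2 / (θ / 2) = 1 := div_self (by positivity)
    rw [← e]
    exact tendsto_const_nhds.div hxB (by positivity)
  have hE : Tendsto (fun r => Real.exp (-(δ * (1 - logScale R / logScale r))) *
      ((1 - C' * r ^ 2) * θ / ((1 - C' * r ^ 2) * θ - (1 + 2 * C / logScale r)) *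
      (θ / 2 / (θ / 2 - K / logScale r)))) (𝓝[>] 0) (𝓝 (Real.exp (-δ) * (1 + δ))) := by
    have h1 : Tendsto (fun r => Real.exp (-(δ * (1 - logScale R / logScale r)))) (𝓝[>] 0)
        (𝓝 (Real.exp (-δ))) := by
      refine (Real.continuous_exp.tendsto _).comp ?_
      simpa using (((hdiv (logScale R)).const_sub 1).const_mul δ).neg
    simpa using h1.mul (hA.mul hB)
  have hlim : Real.exp (-δ) * (1 + δ) < Real.exp (-(δ ^ 2 / 8)) := by
    have h := log_one_add_lt hδ0 hδ1
    rw [← Real.exp_log (by linarith : (0 : ℝ) < 1 + δ), ← Real.exp_add, Real.exp_lt_exp]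
    linarith
  have h1r : ∀ᶠ r in 𝓝[>] (0 : ℝ), r < R :=
    mem_nhdsWithin_of_mem_nhds (Iio_mem_nhds hR.1)
  filter_upwards [hE.eventually_lt_const hlim, hA.eventually_const_lt (u := 1 + δ / 2)
    (by linarith), hB.eventually_lt_const (u := 1 + δ / 2) (by linarith),
    hxA.eventually_const_lt (u := 0) (by linarith),
    hxB.eventually_const_lt (u := 0) (by positivity), tendsto_logScale.eventually_gt_atTop 0,
    h1r, self_mem_nhdsWithin] with r hEr hAr hBr hxAr hxBr hLr hrR hr0 Ω _ P _ F X z hX hz n T hT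
  rw [mem_Ioi] at hr0
  have hr1 : r ≤ 1 := by linarith [hR.2]
  set L := logScale r with hL
  have hε : 0 < r ^ 4 := by positivity
  have hε1 : r ^ 4 ∈ Ioc (0 : ℝ) 1 := ⟨hε, pow_le_one₀ hr0.le hr1⟩
  have hl : (1 / (θ * L)) * (θ * L) = 1 := by field_simp
  have hl0 : 0 < 1 / (θ * L) := by positivity
  set l := 1 / (θ * L) with hldef
  -- The constants make l(a + M) equal to 1 - C'r², the lower bound for minus the generator outside
  -- the circle, and l(a' + M') equal to 1/2, the bound inside the ball.
  have key := hX.integral_exp_excTime_le (c := r ^ 2) (d := R ^ 2) (by gcongr) hz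
    ((GenPair.const (L + C)).add ((genPair_torusGreen hε).const_mul (-1))) hfg'
    (l := l) (a := ((1 - C' * r ^ 2) * θ - (1 + 2 * C / L)) * L)
    (M := (1 + 2 * C / L) * L) (a' := (θ / 2 - K / L) * L) (M' := K / L * L)
    (by positivity) (by positivity) (by positivity) (by positivity)
    (by
      rw [← add_mul, ← add_mul, mul_div_mul_right _ _ hLr.ne', mul_div_mul_right _ _ hLr.ne',
        sub_add_cancel, sub_add_cancel]
      linarith)
    (fun z hzr => by
      have k1 := hV1 _ hε1 z
      have k2 := hV2 _ hε1 r ⟨hr0, hr1⟩ z hzr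
      have k3 := hp r ⟨hr0, hr1⟩ z hzr
      rw [← logScale, ← hL] at k2
      have e : (1 + 2 * C / L) * L = L + 2 * C := by field_simp
      rw [sub_mul, e]
      refine ⟨by linarith, by linarith, ?_⟩
      have k4 : l * ((1 - C' * r ^ 2) * θ * L - (L + 2 * C) + (L + C + -1 * torusGreen (r ^ 4) z)) ≤
          l * ((1 - C' * r ^ 2) * θ * L) := mul_le_mul_of_nonneg_left (by linarith) hl0.le
      have k5 : l * ((1 - C' * r ^ 2) * θ * L) = 1 - C' * r ^ 2 := by
        linear_combination (1 - C' * r ^ 2) * hl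
      linarith)
    (fun z hzr => by
      have e : K / L * L = K := by field_simp
      obtain ⟨k1, k2, k3⟩ := hin z (hzr.trans (by nlinarith [hR.1, hR.2]))
      rw [sub_mul, e]
      refine ⟨k1, k2, ?_⟩
      have k4 : l * (θ / 2 * L - K + f' z) ≤ l * (θ / 2 * L) :=
        mul_le_mul_of_nonneg_left (by linarith) hl0.le
      have k5 : l * (θ / 2 * L) = 1 / 2 := by linear_combination 1 / 2 * hl
      linarith) T n
  refine (hX.real_le_excTime_le key).trans ?_
  rw [← add_mul, ← add_mul, mul_div_mul_right _ _ hLr.ne', mul_div_mul_right _ _ hLr.ne',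
    sub_add_cancel, sub_add_cancel]
  have hlT : -l * T = n * -(δ * (1 - logScale R / L)) := by
    rw [mul_assoc ((1 + δ) * (n : ℝ)), logScale_sub hR.1 hr0, ← hL] at hT
    rw [hT, hldef, hθ]
    field_simp
  have hn : -(n : ℝ) * (δ ^ 2 / 8) = n * -(δ ^ 2 / 8) := by ring
  rw [hlT, hn, Real.exp_nat_mul, ← mul_pow, Real.exp_nat_mul]
  have hpos : 0 ≤ Real.exp (-(δ * (1 - logScale R / L))) *
      ((1 - C' * r ^ 2) * θ / ((1 - C' * r ^ 2) * θ - (1 + 2 * C / L)) *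
      (θ / 2 / (θ / 2 - K / L))) := by
    have : 0 ≤ (1 - C' * r ^ 2) * θ / ((1 - C' * r ^ 2) * θ - (1 + 2 * C / L)) := by linarith
    positivity
  exact pow_le_pow_left₀ hpos hEr.le n

lemma eventually_real_excTime_le_le {δ R η : ℝ} (hδ : δ ∈ Ioo (0 : ℝ) (1 / 2))
    (hR : R ∈ Ioo (0 : ℝ) (1 / 2)) (hη : 0 < η) :
    ∀ᶠ r in 𝓝[>] (0 : ℝ), ∀ (Ω : Type u) [MeasurableSpace Ω]
      (P : Measure Ω) [IsProbabilityMeasure P] (F : ℝ≥0 → MeasurableSpace Ω)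
      (X : ℝ≥0 → Ω → ℝ × ℝ) (z : ℝ × ℝ), IsPlaneMarkov F P X → (∀ ω, X 0 ω = z) → ∀ (n : ℕ) (T : ℝ≥0),
      (T : ℝ) = (1 - δ) * n * (1 / Real.pi) * Real.log (R / r) →
      4 ≤ n * δ ∨ η ^ 2 ≤ latticeDistSq z →
      P.real {ω | excTime X (r ^ 2) (R ^ 2) n ω ≤ T} ≤
        Real.exp (-(n : ℝ) * (δ ^ 2 / 4)) := by
  obtain ⟨C, hC, hV1, hV2, hV3⟩ := exists_torusGreen_bounds
  obtain ⟨hδ0, hδ1⟩ := hδ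
  set θ : ℝ := (1 - δ) / δ with hθ
  have hθ0 : 0 < θ := div_pos (by linarith) hδ0
  set η' : ℝ := min η R with hη'
  have hη0 : 0 < η' := lt_min hη hR.1
  have hηR : η' ≤ R := min_le_right _ _
  have hη1 : η' ∈ Ioc (0 : ℝ) 1 := ⟨hη0, by linarith [hR.2]⟩
  have hD0 : 0 ≤ logScale η' := logScale_nonneg hη0 hη1.2
  set D : ℝ := 2 * C + logScale η' with hD
  have hQ : Tendsto (fun r => (θ + D / logScale r) / (θ + 1)) (𝓝[>] 0) (𝓝 (1 - δ)) := by
    have e : (θ + 0) / (θ + 1) = 1 - δ := by rw [hθ]; field_simp; ring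
    rw [← e]
    exact ((tendsto_logScale.const_div_atTop D).const_add θ).div_const _
  have hs := (hQ.log (by linarith)).neg
  have hlog := lt_neg_log_one_sub hδ0 hδ1
  have hδ3 : 0 < δ ^ 3 := by positivity
  have hδ2 : 0 < δ ^ 2 := by positivity
  have h1r : ∀ᶠ r in 𝓝[>] (0 : ℝ), r < R :=
    mem_nhdsWithin_of_mem_nhds (Iio_mem_nhds hR.1)
  filter_upwards [hs.eventually_const_lt (u := δ + δ ^ 2 / 4) (by linarith),
    (hs.const_mul (4 - δ)).eventually_const_lt (lt_mul_neg_log_one_sub hδ0 hδ1),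
    tendsto_logScale.eventually_gt_atTop 0, h1r, self_mem_nhdsWithin]
    with r hs1 hs2 hLr hrR hr0 Ω _ P _ F X z hX hz n T hT hn
  rw [mem_Ioi] at hr0
  have hr1 : r ≤ 1 := by linarith [hR.2]
  set L := logScale r with hL
  have hε : 0 < r ^ 2 := by positivity
  have hε1 : r ^ 2 ∈ Ioc (0 : ℝ) 1 := ⟨hε, pow_le_one₀ hr0.le hr1⟩
  have hl : (1 / (θ * L)) * (θ * L) = 1 := by field_simp
  have hl0 : 0 < 1 / (θ * L) := by positivity
  set l := 1 / (θ * L) with hldef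
  -- The additive constant keeps the function at least θL = 1/l everywhere, so its generator 1 - p ≤
  -- 1 is at most l times the function. It is at least (θ + 1)L on the circle and at most θL + D
  -- away from it.
  have hfg := (GenPair.const (θ * L + C)).add (genPair_torusGreen hε)
  have hm₀ : 0 ≤ (θ + D / L) * L := by positivity
  have hm₁ : 0 < (θ + 1) * L := by positivity
  have hDL : (θ + D / L) * L = θ * L + D := by field_simp
  have hf : ∀ z, θ * L ≤ θ * L + C + torusGreen (r ^ 2) z := fun z => by
    linarith [hV1 _ hε1 z]
  have hf0 : ∀ z, 0 ≤ θ * L + C + torusGreen (r ^ 2) z := fun z =>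
    le_trans (by positivity) (hf z)
  have hg : ∀ z, 0 + (1 - torusHeat (r ^ 2) z) ≤ l * (θ * L + C + torusGreen (r ^ 2) z) :=
    fun z => by
      have := mul_le_mul_of_nonneg_left (hf z) hl0.le
      linarith [torusHeat_nonneg hε z]
  have hcirc : ∀ z, latticeDistSq z = r ^ 2 →
      (θ + 1) * L ≤ θ * L + C + torusGreen (r ^ 2) z := fun z hzr => by
    have := hV3 r ⟨hr0, hr1⟩ z hzr.le
    rw [← logScale, ← hL] at this
    linarith
  have hfar : ∀ z, η' ^ 2 ≤ latticeDistSq z →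
      θ * L + C + torusGreen (r ^ 2) z ≤ (θ + D / L) * L := fun z hzr => by
    have := hV2 _ hε1 η' hη1 z hzr
    rw [← logScale] at this
    rw [hDL, hD]
    linarith
  have hfarR : ∀ z, R ^ 2 ≤ latticeDistSq z →
      θ * L + C + torusGreen (r ^ 2) z ≤ (θ + D / L) * L := fun z hzr =>
    hfar z (le_trans (by gcongr) hzr)
  have hlT : l * T ≤ n * δ := by
    rw [mul_assoc ((1 - δ) * (n : ℝ)), logScale_sub hR.1 hr0, ← hL] at hT
    have h1 : (T : ℝ) ≤ (1 - δ) * n * L := by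
      rw [hT]
      have := logScale_nonneg hR.1 (by linarith [hR.2])
      have h2 : 0 ≤ (1 - δ) * n := mul_nonneg (by linarith) (Nat.cast_nonneg n)
      exact mul_le_mul_of_nonneg_left (by linarith) h2
    have h3 : l * ((1 - δ) * n * L) = n * δ := by
      rw [hldef, hθ]
      have : 1 - δ ≠ 0 := by linarith
      field_simp
    exact (mul_le_mul_of_nonneg_left h1 hl0.le).trans h3.le
  have hQeq : (θ + D / L) * L / ((θ + 1) * L) = Real.exp (-(-Real.log ((θ + D / L) / (θ + 1)))) := by
    rw [mul_div_mul_right _ _ hLr.ne', neg_neg, Real.exp_log (by positivity)]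
  set s := -Real.log ((θ + D / L) / (θ + 1)) with hsdef
  have hlTe : Real.exp (l * T) ≤ Real.exp (n * δ) := Real.exp_le_exp.mpr hlT
  rcases hn with hn | hn
  · obtain ⟨m, rfl⟩ : ∃ m, n = m + 1 := Nat.exists_eq_succ_of_ne_zero (by
      rintro rfl; norm_num at hn)
    refine (hX.real_excTime_le_le hl0.le (hX.excLaplace_succ_le_pow hfg hl0.le hm₀ hm₁ hf0 hg
      hcirc hfarR T m)).trans ?_
    rw [hQeq, ← Real.exp_nat_mul, ← Real.exp_add]
    refine Real.exp_le_exp.mpr ?_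
    push_cast at hlT hn ⊢
    have hw : 0 < s - (δ + δ ^ 2 / 4) := by linarith
    have k1 : δ * s ≤ 4 * (s - (δ + δ ^ 2 / 4)) := by linarith
    have k2 := mul_le_mul_of_nonneg_right hn hw.le
    have k3 : s ≤ (m + 1) * (s - (δ + δ ^ 2 / 4)) := by
      refine le_of_mul_le_mul_left ?_ hδ0
      linarith
    linarith
  · refine (hX.real_excTime_le_le hl0.le (hX.excLaplace_le_pow hz hfg hl0.le hm₀ hm₁ hf0 hg
      hcirc hfarR (hfar z (le_trans (by gcongr; exact min_le_left _ _) hn)) T n)).trans ?_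
    rw [hQeq, ← Real.exp_nat_mul, ← Real.exp_add]
    refine Real.exp_le_exp.mpr ?_
    have := mul_le_mul_of_nonneg_left hs1.le (Nat.cast_nonneg n : (0 : ℝ) ≤ n)
    linarith

/-- The first passage is ignored and the other `k` waits are compared with a Poisson process of rate
close to 1/L. As r → 0 the bound tends to a Poisson probability whose mean is within a factor 1 + ν
of (1 - δ)(k + 1). -/
lemma eventually_real_excTime_succ_le {δ R : ℝ} (hδ : δ ∈ Ioo (0 : ℝ) (1 / 2))
    (hR : R ∈ Ioo (0 : ℝ) (1 / 2)) {k : ℕ} (hk : 1 ≤ k) (h4 : (k + 1) * δ < 4) :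
    ∀ᶠ r in 𝓝[>] (0 : ℝ), ∀ (Ω : Type u) [MeasurableSpace Ω]
      (P : Measure Ω) [IsProbabilityMeasure P] (F : ℝ≥0 → MeasurableSpace Ω)
      (X : ℝ≥0 → Ω → ℝ × ℝ), IsPlaneMarkov F P X → ∀ T : ℝ≥0,
      (T : ℝ) = (1 - δ) * (k + 1 : ℕ) * (1 / Real.pi) * Real.log (R / r) →
      P.real {ω | excTime X (r ^ 2) (R ^ 2) (k + 1) ω ≤ T} ≤
        Real.exp (-((k + 1 : ℕ) : ℝ) * (δ ^ 2 / 4)) := by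
  obtain ⟨C, hC, hV1, hV2, hV3⟩ := exists_torusGreen_bounds
  have hF := le_poissonCdfLt_of_lt_four hδ.1 hδ.2 hk h4
  obtain ⟨hδ0, hδ1⟩ := hδ
  set t₀ : ℝ := (1 - δ) * (k + 1) with ht₀
  have ht₀0 : 0 ≤ t₀ := mul_nonneg (by linarith) (by positivity)
  have hF1 : 1 - Real.exp (-((k + 1 : ℕ) : ℝ) * (δ ^ 2 / 4)) < poissonCdfLt k t₀ := by
    have h := Real.add_one_lt_exp (x := -((k + 1 : ℕ) : ℝ) * (δ ^ 2 / 4))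
      (mul_ne_zero (neg_ne_zero.mpr (by positivity)) (by positivity))
    push_cast at h ⊢
    linarith
  have hFc := continuous_poissonCdfLt k
  -- The inequality is strict, so the rate may be enlarged by a factor 1 + ν. This pays for the
  -- auxiliary term `ν * torusGreen ε`.
  obtain ⟨ν, hνF, hν1, hν0⟩ : ∃ ν : ℝ, 1 - Real.exp (-((k + 1 : ℕ) : ℝ) * (δ ^ 2 / 4)) <
      poissonCdfLt k ((1 + ν) * t₀) ∧ ν < 1 ∧ 0 < ν := by
    have h1 : Tendsto (fun ν : ℝ => poissonCdfLt k ((1 + ν) * t₀)) (𝓝[>] 0)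
        (𝓝 (poissonCdfLt k t₀)) := by
      have : ContinuousAt (fun ν : ℝ => poissonCdfLt k ((1 + ν) * t₀)) 0 := by fun_prop
      simpa [ContinuousAt] using this.tendsto.mono_left nhdsWithin_le_nhds
    have h2 : ∀ᶠ ν in 𝓝[>] (0 : ℝ), ν < 1 :=
      mem_nhdsWithin_of_mem_nhds (Iio_mem_nhds one_pos)
    exact ((h1.eventually_const_lt hF1).and (h2.and self_mem_nhdsWithin)).exists
  -- With this value ν p_ε ≥ 2 ≥ 1 + ν within squared distance `ε` of the lattice.
  set ε : ℝ := ν * Real.exp (-1 / 2) / (4 * Real.pi) with hε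
  have hε0 : 0 < ε := by positivity
  have hε1 : ε ≤ 1 := by
    rw [hε, div_le_one (by positivity)]
    have h1 : Real.exp (-1 / 2) ≤ 1 := Real.exp_le_one_iff.mpr (by norm_num)
    have h2 := Real.pi_gt_three
    nlinarith [Real.exp_pos (-1 / 2)]
  set K := torusGreen ε 0 with hK
  have hVε : ∀ z, |torusGreen ε z| ≤ K := abs_torusGreen_le hε0
  have hK0 : 0 ≤ K := (abs_nonneg _).trans (hVε 0)
  have hνV : ∀ z, -C ≤ ν * torusGreen ε z ∧ ν * torusGreen ε z ≤ K := fun z => by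
    have h1 := hV1 ε ⟨hε0, hε1⟩ z
    have h2 := (abs_le.mp (hVε z)).2
    exact ⟨by nlinarith, by nlinarith⟩
  have hp : ∀ z, latticeDistSq z ≤ ε → 1 + ν ≤ ν * torusHeat ε z := fun z hz => by
    have h1 : Real.exp (-1 / 2) ≤ Real.exp (-latticeDistSq z / (2 * ε)) := by
      refine Real.exp_le_exp.mpr ?_
      rw [div_le_div_iff₀ (by positivity) (by positivity)]
      linarith
    have h2 : ν * (1 / (2 * Real.pi * ε) * Real.exp (-1 / 2)) = 2 := by
      rw [hε]; field_simp; norm_num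
    have h3 : ν * (1 / (2 * Real.pi * ε) * Real.exp (-1 / 2)) ≤ ν * torusHeat ε z := by
      refine mul_le_mul_of_nonneg_left (le_trans ?_ (torusHeat_ge hε0 z)) hν0.le
      gcongr
    linarith
  have hsq : √ε ∈ Ioc (0 : ℝ) 1 := ⟨Real.sqrt_pos.mpr hε0, Real.sqrt_le_one.mpr hε1⟩
  set S : ℝ := logScale √ε + C with hS
  have hSR : 0 ≤ logScale R := logScale_nonneg hR.1 (by linarith [hR.2])
  set D : ℝ := 3 * C + K with hD
  have hD0 : 0 ≤ D := by positivity
  set E : ℝ := 3 * C + logScale R + K with hE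
  have hE0 : 0 ≤ E := by positivity
  set D' : ℝ := 2 * C + S + K with hD'
  have hrate : Tendsto (fun r => (1 + ν) / (1 + (D - D') / logScale r)) (𝓝[>] 0) (𝓝 (1 + ν)) := by
    have h := ((tendsto_logScale.const_div_atTop (D - D')).const_add 1)
    have h2 := (tendsto_const_nhds (x := 1 + ν)).div h (by norm_num)
    simpa [Pi.div_def] using h2
  have hlim : Tendsto (fun r => poissonCdfLt k ((1 + ν) / (1 + (D - D') / logScale r) * t₀) -
      k * (E / (logScale r + D) + D / (logScale r + D))) (𝓝[>] 0)
      (𝓝 (poissonCdfLt k ((1 + ν) * t₀))) := by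
    have h1 := (hFc.tendsto _).comp (hrate.mul_const t₀)
    have h2 : Tendsto (fun r => logScale r + D) (𝓝[>] 0) atTop :=
      tendsto_atTop_add_const_right _ _ tendsto_logScale
    have h3 := ((h2.const_div_atTop E).add (h2.const_div_atTop D)).const_mul (k : ℝ)
    simpa using h1.sub h3
  have h1r : ∀ᶠ r in 𝓝[>] (0 : ℝ), r < R :=
    mem_nhdsWithin_of_mem_nhds (Iio_mem_nhds hR.1)
  filter_upwards [hlim.eventually_const_lt hνF, tendsto_logScale.eventually_gt_atTop 0,
    tendsto_logScale.eventually_gt_atTop (D' - D), h1r, self_mem_nhdsWithin]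
    with r hGr hLr hLr' hrR hr0 Ω _ P _ F X hX T hT
  rw [mem_Ioi] at hr0
  have hr1 : r ≤ 1 := by linarith [hR.2]
  set L := logScale r with hL
  have hr2 : 0 < r ^ 2 := by positivity
  have hr3 : r ^ 2 ∈ Ioc (0 : ℝ) 1 := ⟨hr2, pow_le_one₀ hr0.le hr1⟩
  set b := L + D with hb
  have hb0 : 0 < b := by positivity
  have hbD : 0 < b - D' := by linarith
  set l := (1 + ν) / (b - D') with hl
  have hl0 : 0 < l := by positivity
  have hlb : l * (b - D') = 1 + ν := by rw [hl]; field_simp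
  have hφ := (GenPair.const 1).add ((((GenPair.const (2 * C)).add (genPair_torusGreen hr2)).add
    ((genPair_torusGreen hε0).const_mul ν)).const_mul (-(1 / b)))
  have hG : ∀ z, 0 ≤ 2 * C + torusGreen (r ^ 2) z + ν * torusGreen ε z := fun z => by
    linarith [hV1 _ hr3 z, (hνV z).1]
  have hib : 0 < 1 / b := by positivity
  have hbib : 1 / b * b = 1 := by field_simp
  have key := hX.poissonCdfLt_sub_le (c := r ^ 2) (d := R ^ 2) (by gcongr) hφ (l := l)
    (e₀ := E / b) (e₁ := D / b) hl0.le (by positivity) (by positivity)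
    (fun z => by nlinarith [hG z])
    (fun z hz => by
      have e : l * (1 + -(1 / b) * (2 * C + torusGreen (r ^ 2) z + ν * torusGreen ε z)) +
          (0 + -(1 / b) * (0 + (1 - torusHeat (r ^ 2) z) + ν * (1 - torusHeat ε z))) =
          1 / b * (l * (b - (2 * C + torusGreen (r ^ 2) z + ν * torusGreen ε z)) -
            (1 - torusHeat (r ^ 2) z + ν * (1 - torusHeat ε z))) := by
        linear_combination -l * hbib
      rw [e]
      refine mul_nonneg hib.le ?_
      have k0 := torusHeat_nonneg hr2 z
      have k1 := torusHeat_nonneg hε0 z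
      have k2 := (hνV z).2
      have k6 := mul_nonneg hν0.le k1
      -- Near the circle φ is too small for lφ to offset the generator of the Green function; there
      -- the source ν p_ε does so. Farther away φ is close to 1, and l(b - D') = 1 + ν covers
      -- everything.
      rcases le_total (latticeDistSq z) ε with hzε | hzε
      · have k3 := hV2 _ hr3 r ⟨hr0, hr1⟩ z hz
        rw [← logScale, ← hL] at k3
        have k4 := mul_nonneg hl0.le (by linarith :
          0 ≤ b - (2 * C + torusGreen (r ^ 2) z + ν * torusGreen ε z))
        linarith [hp z hzε]
      · have k3 := hV2 _ hr3 √ε hsq z (by rwa [Real.sq_sqrt hε0.le])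
        rw [← logScale] at k3
        have k4 := mul_le_mul_of_nonneg_left (by linarith : b - D' ≤
          b - (2 * C + torusGreen (r ^ 2) z + ν * torusGreen ε z)) hl0.le
        linarith)
    (fun z hz => by
      have k3 := hV2 _ hr3 R ⟨hR.1, by linarith [hR.2]⟩ z hz
      rw [← logScale] at k3
      have k4 : 1 / b * (2 * C + torusGreen (r ^ 2) z + ν * torusGreen ε z) ≤ 1 / b * E :=
        mul_le_mul_of_nonneg_left (by linarith [(hνV z).2]) hib.le
      have k5 : 1 / b * E = E / b := by ring
      linarith)
    (fun z hz => by
      have k3 := hV3 r ⟨hr0, hr1⟩ z hz.le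
      rw [← logScale, ← hL] at k3
      have k4 : 1 / b * L ≤ 1 / b * (2 * C + torusGreen (r ^ 2) z + ν * torusGreen ε z) :=
        mul_le_mul_of_nonneg_left (by linarith [(hνV z).1]) hib.le
      have k5 : D / b = 1 - 1 / b * L := by rw [hb]; field_simp; ring
      linarith) T k
  have hlT : l * T ≤ (1 + ν) / (1 + (D - D') / L) * t₀ := by
    rw [mul_assoc ((1 - δ) * ((k + 1 : ℕ) : ℝ)), logScale_sub hR.1 hr0, ← hL] at hT
    have h1 : (T : ℝ) ≤ t₀ * L := by
      rw [hT, ht₀]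
      push_cast
      exact mul_le_mul_of_nonneg_left (by linarith) ht₀0
    have h2 : l * (t₀ * L) = (1 + ν) / (1 + (D - D') / L) * t₀ := by
      have h3 : 1 + (D - D') / L = (b - D') / L := by rw [hb]; field_simp; ring
      rw [h3, hl]
      field_simp
    exact (mul_le_mul_of_nonneg_left h1 hl0.le).trans h2.le
  have hmono := antitoneOn_poissonCdfLt k
    (mem_Ici.mpr (by positivity : 0 ≤ l * (T : ℝ))) (mem_Ici.mpr (le_trans (by positivity) hlT)) hlT
  have hms : MeasurableSet {ω | excTime X (r ^ 2) (R ^ 2) (k + 1) ω ≤ T} :=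
    hX.le T _ (hX.isStop_excTime (k + 1) T)
  have hcompl : {ω | (T : ℝ≥0∞) < excTime X (r ^ 2) (R ^ 2) (k + 1) ω} =
      {ω | excTime X (r ^ 2) (R ^ 2) (k + 1) ω ≤ T}ᶜ := by ext ω; simp
  rw [hcompl, probReal_compl_eq_one_sub hms] at key
  linarith

/-! ### Return to the torus and assembly -/

/-- The passage times of the lift of a Brownian motion on the torus. -/
lemma IsPlanarBrownian.exists_excursionTime_eq {Ω : Type*} [MeasurableSpace Ω] {P : Measure Ω}
    [IsProbabilityMeasure P] {B : ℝ≥0 → Ω → Plane} (hB : IsPlanarBrownian B P) (y x : UnitTorus)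
    {R r : ℝ} (hR : 0 ≤ R) (hr : 0 ≤ r) :
    ∃ (F : ℝ≥0 → MeasurableSpace Ω) (X : ℝ≥0 → Ω → ℝ × ℝ) (z : ℝ × ℝ), IsPlaneMarkov F P X ∧
      (∀ ω, X 0 ω = z) ∧ torusDist x y = √(latticeDistSq z) ∧
      ∀ᵐ ω ∂P, ∀ n, excursionTime (torusPath y (fun t => B t ω)) x R r n =
        excTime X (r ^ 2) (R ^ 2) n ω := by
  obtain ⟨F, X, hX, h0, hXB⟩ := hB.exists_isPlaneMarkov (y.1 0 - x.1 0, y.1 1 - x.1 1)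
  refine ⟨F, X, _, hX, h0, ?_, ?_⟩
  · conv_lhs => rw [← modOne_self y]
    exact torusDist_modOne _ _
  · filter_upwards [hXB] with ω hω n
    rw [excursionTime_eq_levelExc x y _ hR hr n, excTime]
    congr 1
    funext t
    rw [latticePath, hω]

/-- Choosing `a` as minus the rate makes the claimed bound equal to 1 for radii that are not small
enough. An estimate valid for all small radii thus yields one for all radii, with an error function
independent of n, the points and the probability space. -/
lemma exists_tendsto_zero_of_eventually {p : ℝ → Prop} (h : ∀ᶠ r in 𝓝[>] (0 : ℝ), p r) (a : ℝ) :
    ∃ o : ℝ → ℝ, Tendsto o (𝓝[>] 0) (𝓝 0) ∧ ∀ r, p r ∧ o r = 0 ∨ o r = a := by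
  classical
  refine ⟨fun r => if p r then 0 else a, ?_, fun r => ?_⟩
  · refine tendsto_const_nhds.congr' ?_
    filter_upwards [h] with r hr
    rw [if_pos hr]
  · by_cases hr : p r
    · exact Or.inl ⟨hr, if_pos hr⟩
    · exact Or.inr (if_neg hr)

end

theorem proposition3 (δ R : ℝ) (hδ : δ ∈ Set.Ioo (0 : ℝ) (1 / 2))
    (hR : R ∈ Set.Ioo (0 : ℝ) (1 / 2)) :
    (∃ o : ℝ → ℝ, Tendsto o (𝓝[>] 0) (𝓝 0) ∧
      ∀ r₁ ∈ Set.Ioo (0 : ℝ) R,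
      ∀ (Ω : Type u) [MeasurableSpace Ω] (P : Measure Ω) [IsProbabilityMeasure P]
        (B : ℝ≥0 → Ω → Plane), IsPlanarBrownian B P →
      ∀ (y x : UnitTorus) (n : ℕ),
        P.real {ω | ENNReal.ofReal ((1 + δ) * n * (1 / Real.pi) * Real.log (R / r₁)) ≤
            excursionTime (torusPath y (fun t => B t ω)) x R r₁ n} ≤
          Real.exp (-(n : ℝ) * (δ ^ 2 / 8 + o r₁))) ∧
    (∀ η : ℝ, 0 < η → ∃ o : ℝ → ℝ, Tendsto o (𝓝[>] 0) (𝓝 0) ∧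
      ∀ r₁ ∈ Set.Ioo (0 : ℝ) R,
      ∀ (Ω : Type u) [MeasurableSpace Ω] (P : Measure Ω) [IsProbabilityMeasure P]
        (B : ℝ≥0 → Ω → Plane), IsPlanarBrownian B P →
      ∀ (y x : UnitTorus) (n : ℕ), (n ≠ 1 ∨ η ≤ torusDist x y) →
        P.real {ω | excursionTime (torusPath y (fun t => B t ω)) x R r₁ n ≤
            ENNReal.ofReal ((1 - δ) * n * (1 / Real.pi) * Real.log (R / r₁))} ≤
          Real.exp (-(n : ℝ) * (δ ^ 2 / 4 + o r₁))) := by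
  have hpos : ∀ r ∈ Ioo (0 : ℝ) R, 0 ≤ Real.log (R / r) := fun r hr =>
    Real.log_nonneg ((one_le_div hr.1).mpr hr.2.le)
  constructor
  · obtain ⟨o, ho, hor⟩ := exists_tendsto_zero_of_eventually
      (eventually_real_le_excTime_le.{u} hδ hR) (-(δ ^ 2 / 8))
    refine ⟨o, ho, fun r hr Ω _ P _ B hB y x n => ?_⟩
    rcases hor r with ⟨h, h0⟩ | h0 <;> rw [h0]
    · obtain ⟨F, X, z, hX, hz, -, hXB⟩ := hB.exists_excursionTime_eq y x hR.1.le hr.1.le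
      set t := (1 + δ) * n * (1 / Real.pi) * Real.log (R / r) with ht
      have ht0 : 0 ≤ t := by
        have := hpos r hr
        have := hδ.1
        positivity
      rw [add_zero]
      refine le_trans (le_of_eq (measureReal_congr ?_)) (h Ω P F X z hX hz n t.toNNReal (Real.coe_toNNReal t ht0))
      filter_upwards [hXB] with ω hω
      rw [eq_iff_iff]
      change _ ≤ _ ↔ _ ≤ _
      rw [hω, ENNReal.ofReal]
    · rw [add_neg_cancel, mul_zero, Real.exp_zero]
      exact measureReal_le_one
  · intro η hη
    -- The Poisson comparison gives a threshold for `r` that depends on `k`; finiteness makes it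
    -- uniform.
    have hfin : {k : ℕ | 1 ≤ k ∧ ((k : ℝ) + 1) * δ < 4}.Finite := by
      refine (Set.finite_Iic ⌈4 / δ⌉₊).subset fun k hk => ?_
      have h1 : (k : ℝ) < 4 / δ := by
        rw [lt_div_iff₀ hδ.1]
        linarith [hk.2, hδ.1]
      exact_mod_cast h1.le.trans (Nat.le_ceil _)
    obtain ⟨o, ho, hor⟩ := exists_tendsto_zero_of_eventually
      ((eventually_real_excTime_le_le.{u} hδ hR hη).and ((eventually_all_finite hfin).mpr
        fun k hk => eventually_real_excTime_succ_le.{u} hδ hR hk.1 hk.2)) (-(δ ^ 2 / 4))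
    refine ⟨o, ho, fun r hr Ω _ P _ B hB y x n hn => ?_⟩
    rcases hor r with ⟨⟨h, h'⟩, h0⟩ | h0 <;> rw [h0]
    · obtain ⟨F, X, z, hX, hz, hd, hXB⟩ := hB.exists_excursionTime_eq y x hR.1.le hr.1.le
      set t := (1 - δ) * n * (1 / Real.pi) * Real.log (R / r) with ht
      have ht0 : 0 ≤ t := by
        have := hpos r hr
        have : 0 ≤ 1 - δ := by linarith [hδ.2]
        positivity
      rw [add_zero]
      have heq : P.real {ω | excursionTime (torusPath y (fun t => B t ω)) x R r n ≤
          ENNReal.ofReal t} = P.real {ω | excTime X (r ^ 2) (R ^ 2) n ω ≤ t.toNNReal} := by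
        refine measureReal_congr ?_
        filter_upwards [hXB] with ω hω
        rw [eq_iff_iff]
        change _ ≤ _ ↔ _ ≤ _
        rw [hω, ENNReal.ofReal]
      rw [heq]
      rcases Nat.eq_zero_or_pos n with rfl | hn0
      · simp
      rcases le_or_gt 4 (n * δ) with h4 | h4
      · exact h Ω P F X z hX hz n t.toNNReal (Real.coe_toNNReal t ht0) (Or.inl h4)
      rcases eq_or_ne n 1 with h1 | h1
      · refine h Ω P F X z hX hz n t.toNNReal (Real.coe_toNNReal t ht0) (Or.inr ?_)
        have h2 := hn.resolve_left (not_not.mpr h1)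
        rw [hd] at h2
        exact (Real.le_sqrt hη.le (latticeDistSq_nonneg z)).mp h2
      · obtain ⟨k, rfl⟩ : ∃ k, n = k + 1 := Nat.exists_eq_succ_of_ne_zero hn0.ne'
        exact h' k ⟨by omega, by exact_mod_cast h4⟩ Ω P F X hX t.toNNReal (Real.coe_toNNReal t ht0)
    · rw [add_neg_cancel, mul_zero, Real.exp_zero]
      exact measureReal_le_one
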